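/- Let $\mathbb{M}_2=\mathbb{R}^2$ with points $(t,r)$ and metric $\mathrm{diag}(-1,1)$, and give $C^\infty(\mathbb{M}_2)=C^\infty(\mathbb{M}_2,\mathbb{R})$ its Fréchet topology. A functional $F\colon C^\infty(\mathbb{M}_2)\to\mathbb{C}$ is *microcausal* if all its iterated directional derivatives exist and are jointly continuous, its $n$-th functional derivative $\frac{\delta^n}{\delta\varphi^n}F[\varphi]$ is, for all $n$ and $\varphi$, a distribution with compact support on $\mathbb{M}_2^n$, and the wave front set of this distribution contains no point $(x_1,\dots,x_n;\xi_1,\dots,\xi_n)$ with all $\xi_i$ in the closed forward light cone $\overline{V}_+$, or all $\xi_i$ in the closed backward light cone $\overline{V}_-$. Let $\mathcal{F}_{\mu c}[[\hbar]]$ be the set of formal power series in $\hbar$ with microcausal coefficients. The product $BC$ of such series is the pointwise one, extended to power series, and functional derivatives are taken coefficient by coefficient. Fix a scale $\mu>0$ and let $W(x,y)=\lim_{\varepsilon\to0^+}W_\varepsilon(x-y)$ be the massless Wightman two-point function, the distributional boundary value of $$W_\varepsilon(t,r)=-\frac{1}{4\pi}\log\!\big(\mu^2\,(r^2-(t-i\varepsilon)^2)\big)$$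 (principal logarithm). For compactly supported distributions $u$ on $\mathbb{M}_2^{k+n}$ and $v$ on $\mathbb{M}_2^{n}$, let $u\,(W)^n\,v$ be the distribution on $\mathbb{M}_2^k$ obtained by contracting the last $n$ variables of $u$ with the variables of $v$, $$(u\,(W)^n\,v)(f)=\lim_{\varepsilon\to0^+}\Big\langle u(x)\otimes v(y),\ f(x_1,\dots,x_k)\prod_{i=1}^nW_\varepsilon(x_{k+i}-y_i)\Big\rangle ,\qquad f\in C^\infty(\mathbb{M}_2^k),$$ which for $k=0$ is the number $\langle u,(W)^nv\rangle$. Extend these operations bilinearly to formal power series in $\hbar$. The star product is $$A\star G=\sum_{n=0}^\infty\frac{\hbar^n}{n!}\Big\langle\frac{\delta^n}{\delta\varphi^n}A,\,(W)^n\,\frac{\delta^n}{\delta\varphi^n}G\Big\rangle .$$ **Proposition.** Let $A,B,C\in\mathcal{F}_{\mu c}[[\hbar]]$ and $c\in\mathbb{N}$ be such that $\frac{\delta^i}{\delta\varphi^i}C=0$ for all $i>c$ (while $A$ and $B$ may have non-zero functional derivatives of every order). Then the coefficients of $BC$ are smooth functionals whose functional derivatives are distributions with compact support, all the limits that enter the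 two sides of the following formula exist, and, as formal power series in $\hbar$ with coefficients in the functionals on $C^\infty(\mathbb{M}_2)$, $$A\star(B\,C)=\sum_{k=0}^{c}\frac{\hbar^k}{k!}\bigg(\sum_{n=0}^\infty\frac{\hbar^n}{n!}\Big(\frac{\delta^k}{\delta\varphi^k}\frac{\delta^n}{\delta\varphi^n}A\Big)(W)^n\frac{\delta^n}{\delta\varphi^n}B\bigg)(W)^k\frac{\delta^k}{\delta\varphi^k}C .$$ Here the inner bracket is a power series with values in the distributions in the $k$ variables of $\frac{\delta^k}{\delta\varphi^k}$ acting on $A$, and the outer contraction pairs it completely with $\frac{\delta^k}{\delta\varphi^k}C$ through $(W)^k$. -/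

import Mathlib

open scoped ContDiff

noncomputable section

namespace PAQFT

/-- Two-dimensional Minkowski space, with points `(t, x)` and metric `diag(-1, 1)`. -/
abbrev Mink : Type := ℝ × ℝ

/-- Field configurations: smooth real functions on Minkowski space. -/
structure Config where
  toFun : Mink → ℝ
  smooth : ContDiff ℝ ∞ toFun

/-- The configuration `φ + s ψ`. -/
def Config.shift (φ : Config) (s : ℝ) (ψ : Config) : Config where
  toFun x := φ.toFun x + s * ψ.toFun x
  smooth := φ.smooth.add (contDiff_const.mul ψ.smooth)

/-- The `m`-th derivative of a configuration, as a continuous map. -/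
def Config.jet (m : ℕ) (φ : Config) : C(Mink, Mink [×m]→L[ℝ] ℝ) where
  toFun := iteratedFDeriv ℝ m φ.toFun
  continuous_toFun := φ.smooth.continuous_iteratedFDeriv (by exact_mod_cast le_top)

/-- The Fréchet topology of `C^∞`: uniform convergence of every derivative on compact sets. -/
instance : TopologicalSpace Config :=
  ⨅ m : ℕ, TopologicalSpace.induced (Config.jet m) inferInstance

/-! ### Distributions with compact support and wave front sets -/

/-- `u`, applied to smooth functions on `X`, is a distribution with compact support.
(The values of `u` on functions that are not smooth are irrelevant and never used.) -/
structure IsCompactDistribution {X : Type*} [NormedAddCommGroup X] [NormedSpace ℝ X]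
    (u : (X → ℂ) → ℂ) : Prop where
  map_add : ∀ f g : X → ℂ, ContDiff ℝ ∞ f → ContDiff ℝ ∞ g → u (f + g) = u f + u g
  map_smul : ∀ (a : ℂ) (f : X → ℂ), ContDiff ℝ ∞ f → u (a • f) = a * u f
  bound : ∃ K : Set X, IsCompact K ∧ ∃ (m : ℕ) (C : ℝ), ∀ f : X → ℂ, ContDiff ℝ ∞ f →
    ∀ b : ℝ, 0 ≤ b → (∀ j ≤ m, ∀ x ∈ K, ‖iteratedFDeriv ℝ j f x‖ ≤ b) → ‖u f‖ ≤ C * b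

/-- The pairing of a covector `ξ` with a point `x` of `n` copies of Minkowski space. -/
def covPair {n : ℕ} (ξ x : Fin n → Mink) : ℝ :=
  ∑ i, ((ξ i).1 * (x i).1 + (ξ i).2 * (x i).2)

/-- The Fourier transform of the localized distribution `χ u`. -/
def localFourier {n : ℕ} (u : ((Fin n → Mink) → ℂ) → ℂ) (χ : (Fin n → Mink) → ℂ)
    (ξ : Fin n → Mink) : ℂ :=
  u (fun x => χ x * Complex.exp (-(Complex.I * (covPair ξ x : ℂ))))

/-- The wave front set: `(x, ξ)` with `ξ ≠ 0` such that no localization of `u` near `x` has a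
Fourier transform which decays rapidly in an open cone around `ξ`. -/
def waveFrontSet {n : ℕ} (u : ((Fin n → Mink) → ℂ) → ℂ) :
    Set ((Fin n → Mink) × (Fin n → Mink)) :=
  {p | p.2 ≠ 0 ∧ ¬ ∃ χ : (Fin n → Mink) → ℂ,
    ContDiff ℝ ∞ χ ∧ HasCompactSupport χ ∧ χ p.1 ≠ 0 ∧
    ∃ Γ : Set (Fin n → Mink), IsOpen Γ ∧ p.2 ∈ Γ ∧ (∀ ξ ∈ Γ, ∀ s : ℝ, 0 < s → s • ξ ∈ Γ) ∧
      ∀ N : ℕ, ∃ C : ℝ, ∀ ξ ∈ Γ, (1 + ‖ξ‖) ^ N * ‖localFourier u χ ξ‖ ≤ C}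

/-- The closed forward light cone. -/
def forwardCone : Set Mink := {k | |k.2| ≤ k.1}

/-- The closed backward light cone. -/
def backwardCone : Set Mink := {k | |k.2| ≤ -k.1}

/-! ### Functionals and their functional derivatives -/

/-- Complex functionals of the field configuration, with pointwise operations. -/
abbrev Functional : Type := Config → ℂ

/-- The `n`-th Gateaux derivative of `F` at `φ` in the directions `ψ 0, …, ψ (n - 1)`. -/
def gateaux (F : Functional) : (n : ℕ) → Config → (Fin n → Config) → ℂ
  | 0, φ, _ => F φ
  | n + 1, φ, ψ => deriv (fun s : ℝ => gateaux F n (φ.shift s (ψ 0)) (fun i => ψ i.succ)) 0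

/-- Smooth functionals: all iterated directional derivatives exist and are jointly continuous. -/
def IsSmoothFunctional (F : Functional) : Prop :=
  (∀ (n : ℕ) (φ χ : Config) (ψ : Fin n → Config),
    DifferentiableAt ℝ (fun s : ℝ => gateaux F n (φ.shift s χ) ψ) 0) ∧
  ∀ n : ℕ, Continuous (fun p : Config × (Fin n → Config) => gateaux F n p.1 p.2)

/-- `u` is the distributional kernel on `n` copies of Minkowski space of the `n`-th derivative
of `F` at `φ`. -/
def IsFunDeriv (F : Functional) (n : ℕ) (φ : Config) (u : ((Fin n → Mink) → ℂ) → ℂ) : Prop :=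
  IsCompactDistribution u ∧
  ∀ ψ : Fin n → Config, u (fun x => ∏ i, ((ψ i).toFun (x i) : ℂ)) = gateaux F n φ ψ

open Classical in
/-- The `n`-th functional derivative of `F` at `φ`, a distribution with compact support on `n`
copies of Minkowski space. It is determined on smooth functions by `IsFunDeriv`. -/
def funDeriv (F : Functional) (n : ℕ) (φ : Config) : ((Fin n → Mink) → ℂ) → ℂ :=
  if h : ∃ u, IsFunDeriv F n φ u then h.choose else 0

/-- `F` is smooth and its functional derivatives are distributions with compact support. -/
def HasFunDerivs (F : Functional) : Prop :=
  IsSmoothFunctional F ∧ ∀ (n : ℕ) (φ : Config), ∃ u, IsFunDeriv F n φ u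

/-- Microcausal functionals: the wave front set of no functional derivative contains a point
all of whose covectors are in the closed forward cone, or all in the closed backward cone. -/
def IsMicrocausal (F : Functional) : Prop :=
  HasFunDerivs F ∧ ∀ (n : ℕ) (φ : Config), ∀ p ∈ waveFrontSet (funDeriv F n φ),
    ¬ ((∀ i, p.2 i ∈ forwardCone) ∨ (∀ i, p.2 i ∈ backwardCone))

/-- Fields: formal power series in `ħ` (the variable `PowerSeries.X`) with coefficients in the
microcausal functionals. -/
def IsField (A : PowerSeries Functional) : Prop :=
  ∀ a : ℕ, IsMicrocausal (PowerSeries.coeff a A)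

/-! ### The Wightman two-point function and contractions with it -/

/-- The massless Wightman two-point function `W(x, y) = w (x - y)` with length scale `1 / μ`, at
`z = x - y = (t, r)` and time `t - i ε`. The distribution `W` is the boundary value `ε → 0+` of
`-(1 / 4π) log (μ² (r² - (t - i ε)²))`. The logarithm is the principal one; for `ε > 0` its
argument is never a real number `≤ 0`. -/
def wightman (μ ε : ℝ) (z : Mink) : ℂ :=
  -(1 / (4 * (Real.pi : ℂ))) *
    Complex.log ((μ : ℂ) ^ 2 * ((z.2 : ℂ) ^ 2 - ((z.1 : ℂ) - Complex.I * (ε : ℂ)) ^ 2))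

/-- The contraction `u W^n v`, before the limit `ε → 0+`, of a distribution `u` in `k + n`
variables with a distribution `v` in `n` variables, by `n` factors `W(x_{k+i}, y_i)`. The result is
a distribution in the first `k` variables of `u`, here evaluated at `f`. -/
def contractReg (μ ε : ℝ) (k n : ℕ) (u : ((Fin (k + n) → Mink) → ℂ) → ℂ)
    (v : ((Fin n → Mink) → ℂ) → ℂ) (f : (Fin k → Mink) → ℂ) : ℂ :=
  u (fun x => f (fun j => x (Fin.castAdd n j)) *
    v (fun y => ∏ i : Fin n, wightman μ ε (x (Fin.natAdd k i) - y i)))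

/-- The contraction `u W^n v`, a distribution in `k` variables. -/
def contract (μ : ℝ) (k n : ℕ) (u : ((Fin (k + n) → Mink) → ℂ) → ℂ)
    (v : ((Fin n → Mink) → ℂ) → ℂ) (f : (Fin k → Mink) → ℂ) : ℂ :=
  Filter.limUnder (nhdsWithin (0 : ℝ) (Set.Ioi 0)) (fun ε => contractReg μ ε k n u v f)

/-- The limit defining the contraction `u W^n v` exists. -/
def ContractExists (μ : ℝ) (k n : ℕ) (u : ((Fin (k + n) → Mink) → ℂ) → ℂ)
    (v : ((Fin n → Mink) → ℂ) → ℂ) : Prop :=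
  ∀ f : (Fin k → Mink) → ℂ, ContDiff ℝ ∞ f → ∃ l : ℂ, Filter.Tendsto
    (fun ε => contractReg μ ε k n u v f) (nhdsWithin (0 : ℝ) (Set.Ioi 0)) (nhds l)

/-- The full pairing `⟨u, W^n v⟩` of distributions in `n` variables, before the limit. -/
def pairingReg (μ ε : ℝ) (n : ℕ) (u v : ((Fin n → Mink) → ℂ) → ℂ) : ℂ :=
  u (fun x => v (fun y => ∏ i : Fin n, wightman μ ε (x i - y i)))

/-- The full pairing `⟨u, W^n v⟩` of distributions in `n` variables. -/
def pairing (μ : ℝ) (n : ℕ) (u v : ((Fin n → Mink) → ℂ) → ℂ) : ℂ :=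
  Filter.limUnder (nhdsWithin (0 : ℝ) (Set.Ioi 0)) (fun ε => pairingReg μ ε n u v)

/-- The limit defining the pairing `⟨u, W^n v⟩` exists. -/
def PairingExists (μ : ℝ) (n : ℕ) (u v : ((Fin n → Mink) → ℂ) → ℂ) : Prop :=
  ∃ l : ℂ, Filter.Tendsto
    (fun ε => pairingReg μ ε n u v) (nhdsWithin (0 : ℝ) (Set.Ioi 0)) (nhds l)

/-! ### Formal power series in `ħ` -/

/-- Formal power series in `ħ` whose coefficients are functionals of the configuration with values
in the distributions on `k` copies of Minkowski space. -/
abbrev DistSeries (k : ℕ) : Type := ℕ → Config → ((Fin k → Mink) → ℂ) → ℂ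

/-- The `k`-th functional derivative of a formal power series, coefficient by coefficient. -/
def funDerivSeries (k : ℕ) (A : PowerSeries Functional) : DistSeries k :=
  fun a φ => funDeriv (PowerSeries.coeff a A) k φ

/-- The pairing `⟨S, W^k T⟩`, extended to formal power series by bilinearity over `ℂ[[ħ]]`. -/
def pairingSeries (μ : ℝ) (k : ℕ) (S T : DistSeries k) : PowerSeries Functional :=
  PowerSeries.mk fun N φ => ∑ p ∈ Finset.HasAntidiagonal.antidiagonal N, pairing μ k (S p.1 φ) (T p.2 φ)

/-- The contraction `S W^n T`, extended to formal power series by bilinearity over `ℂ[[ħ]]`. -/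
def contractSeries (μ : ℝ) (k n : ℕ) (S : DistSeries (k + n)) (T : DistSeries n) :
    DistSeries k :=
  fun N φ f => ∑ p ∈ Finset.HasAntidiagonal.antidiagonal N, contract μ k n (S p.1 φ) (T p.2 φ) f

/-- The star product `A ⋆ G = ∑_{n ≥ 0} (ħ^n / n!) ⟨A^(n), W^n G^(n)⟩`. The coefficient of `ħ^N` is
a finite sum. -/
def star (μ : ℝ) (A G : PowerSeries Functional) : PowerSeries Functional :=
  PowerSeries.mk fun N φ => ∑ p ∈ Finset.HasAntidiagonal.antidiagonal N, ((p.1.factorial : ℂ)⁻¹) *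
    PowerSeries.coeff p.2
      (pairingSeries μ p.1 (funDerivSeries p.1 A) (funDerivSeries p.1 G)) φ

/-- The distribution-valued series `∑_{n ≥ 0} (ħ^n / n!) A^(k+n) W^n B^(n)`, in which the first `k`
variables of `A^(k+n)` stay free. -/
def partialStar (μ : ℝ) (k : ℕ) (A B : PowerSeries Functional) : DistSeries k :=
  fun N φ f => ∑ p ∈ Finset.HasAntidiagonal.antidiagonal N, ((p.1.factorial : ℂ)⁻¹) *
    contractSeries μ k p.1 (funDerivSeries (k + p.1) A) (funDerivSeries p.1 B) p.2 φ f

end PAQFT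

end

/-! Algebraically the identity is the Leibniz rule. Distribute the $n$ derivatives of $BC$ over $C$
and $B$. Since $A^{(n)}$ is symmetric, the $\binom{n}{k}$ summands with $k$ derivatives on $C$ and
$m=n-k$ on $B$ contribute equally, and $\binom{n}{k}/n!=1/(k!\,m!)$. Both sides become the sum over
$k,m$ of $\hbar^{k+m}/(k!\,m!)$ times $\langle A^{(k+m)},W^{k+m}(C^{(k)}\otimes B^{(m)})\rangle$
(`splitPairing`), and the terms with $k>c$ vanish.

The analytic content is that the limits exist, and that removing two regulators in succession, as on
the right-hand side, agrees with removing one common regulator, as on the left. Both follow from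
`exists_tendsto_pairingMulti`: if every factor $W$ has its own regulator, the pairing converges
jointly as the vector of regulators tends to $0$ inside the open positive orthant. The diagonal
gives the left-hand side; a joint limit is also an iterated one (`tendsto_of_tendsto_prod`), which
gives the right-hand side.

For the joint limit, Frullani's integral represents $W_\varepsilon$ as a superposition over
$p\in\mathbb{R}$ of plane waves with covectors $(|p|,p)$, minus an infrared subtraction
(`integral_spectralKernel`). The pairing of $u$ and $v$ is then an integral over $p\in\mathbb{R}^n$.
After the plane wave is pulled out of the integrand, the remaining factor has derivatives bounded
uniformly in $p$ and in the regulators. Microcausality of $A$ makes the Fourier transform of $u$,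
even after multiplication by smooth functions, decay rapidly on forward covectors
(`IsCompactDistribution.rapidDecayOn`), whereas $v$ costs only a power of $p$. Dominated convergence
concludes.

Two general facts support this. By Hahn–Banach, a compactly supported distribution is a finite sum
of bounded functionals of jets on a compact set, so it depends smoothly on parameters and commutes
with integrals. And it is determined by its values on plane waves, hence on products of
configurations, so functional derivatives are unique and symmetric on smooth functions. -/

open scoped ContDiff

namespace PAQFT

noncomputable section

/-! ### Bounds on finitely many derivatives over a set. -/

section Jets

variable {X Y Z E : Type} [NormedAddCommGroup X] [NormedSpace ℝ X]
  [NormedAddCommGroup Y] [NormedSpace ℝ Y] [NormedAddCommGroup Z] [NormedSpace ℝ Z]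
  [NormedAddCommGroup E] [NormedSpace ℝ E]

/-- The derivatives of `f` up to order `m` are bounded by `b` on `K`. -/
def JetBound (m : ℕ) (K : Set X) (f : X → E) (b : ℝ) : Prop :=
  ∀ j ≤ m, ∀ x ∈ K, ‖iteratedFDeriv ℝ j f x‖ ≤ b

theorem JetBound.mono {m m' : ℕ} {K K' : Set X} {f : X → E} {b b' : ℝ}
    (h : JetBound m K f b) (hm : m' ≤ m) (hK : K' ⊆ K) (hb : b ≤ b') : JetBound m' K' f b' :=
  fun j hj x hx => (h j (hj.trans hm) x (hK hx)).trans hb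

theorem exists_jetBound (m : ℕ) {K : Set X} (hK : IsCompact K) {f : X → E}
    (hf : ContDiff ℝ ∞ f) : ∃ b, 0 ≤ b ∧ JetBound m K f b := by
  have h : ∀ j : ℕ, ∃ b, ∀ x ∈ K, ‖iteratedFDeriv ℝ j f x‖ ≤ b := fun j =>
    hK.exists_bound_of_continuousOn
      (hf.continuous_iteratedFDeriv (by exact_mod_cast le_top)).continuousOn
  choose b hb using h
  refine ⟨∑ j ∈ Finset.range (m + 1), |b j|, Finset.sum_nonneg fun _ _ => abs_nonneg _,
    fun j hj x hx => (hb j x hx).trans ((le_abs_self _).trans ?_)⟩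
  exact Finset.single_le_sum (f := fun j => |b j|) (fun _ _ => abs_nonneg _)
    (Finset.mem_range.2 (Nat.lt_succ_of_le hj))

theorem JetBound.mul {m : ℕ} {K : Set X} {f g : X → ℂ} {a b : ℝ} (ha : 0 ≤ a)
    (hf : ContDiff ℝ ∞ f) (hg : ContDiff ℝ ∞ g)
    (h : JetBound m K f a) (h' : JetBound m K g b) :
    JetBound m K (fun x => f x * g x) (2 ^ m * (a * b)) := by
  intro j hj x hx
  have hb : 0 ≤ b := (norm_nonneg _).trans (h' 0 (Nat.zero_le _) x hx)
  calc ‖iteratedFDeriv ℝ j (fun x => f x * g x) x‖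
      ≤ ∑ i ∈ Finset.range (j + 1),
        (j.choose i : ℝ) * ‖iteratedFDeriv ℝ i f x‖ * ‖iteratedFDeriv ℝ (j - i) g x‖ :=
        norm_iteratedFDeriv_mul_le hf hg x (by exact_mod_cast le_top)
    _ ≤ ∑ i ∈ Finset.range (j + 1), (j.choose i : ℝ) * a * b := by
        gcongr with i hi
        · exact h i (by have := Finset.mem_range.1 hi; omega) x hx
        · exact h' (j - i) (by omega) x hx
    _ = 2 ^ j * (a * b) := by
        rw [← Finset.sum_mul, ← Finset.sum_mul, ← Nat.cast_sum, Nat.sum_range_choose]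
        push_cast; ring
    _ ≤ 2 ^ m * (a * b) := by gcongr; norm_num

theorem JetBound.comp_clm {m : ℕ} {K : Set X} (T : X →L[ℝ] Z) {f : Z → E} {b : ℝ}
    (hf : ContDiff ℝ ∞ f) (h : JetBound m (T '' K) f b) :
    JetBound m K (fun x => f (T x)) (max 1 ‖T‖ ^ m * b) := by
  intro j hj x hx
  have := T.iteratedFDeriv_comp_right (n := ∞) hf x (i := j) (by exact_mod_cast le_top)
  change ‖iteratedFDeriv ℝ j (f ∘ T) x‖ ≤ _
  rw [this]
  refine (ContinuousMultilinearMap.norm_compContinuousLinearMap_le _ _).trans ?_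
  rw [Finset.prod_const, Finset.card_univ, Fintype.card_fin, mul_comm]
  have h1 : ‖T‖ ^ j ≤ max 1 ‖T‖ ^ m :=
    (pow_le_pow_left₀ (norm_nonneg _) (le_max_right _ _) _).trans
      (pow_le_pow_right₀ (le_max_left _ _) hj)
  have h2 := h j hj (T x) (Set.mem_image_of_mem _ hx)
  gcongr

theorem norm_iteratedFDeriv_iteratedFDeriv (f : X → E) (i j : ℕ) (x : X) :
    ‖iteratedFDeriv ℝ i (iteratedFDeriv ℝ j f) x‖ = ‖iteratedFDeriv ℝ (i + j) f x‖ := by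
  induction j generalizing i with
  | zero =>
    rw [iteratedFDeriv_zero_eq_comp, LinearIsometryEquiv.norm_iteratedFDeriv_comp_left]; rfl
  | succ j ih =>
    rw [iteratedFDeriv_succ_eq_comp_left]
    have h := LinearIsometryEquiv.norm_iteratedFDeriv_comp_left (𝕜 := ℝ)
      (continuousMultilinearCurryLeftEquiv ℝ (fun _ : Fin (j + 1) => X) E).symm
      (fderiv ℝ (iteratedFDeriv ℝ j f)) x i
    rw [norm_iteratedFDeriv_fderiv, ih, add_right_comm] at h
    exact h

end Jets

/-! ### Compactly supported distributions and their representation by functionals of jets. -/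

section CompactDistribution

variable {X Y Z : Type} [NormedAddCommGroup X] [NormedSpace ℝ X]
  [NormedAddCommGroup Y] [NormedSpace ℝ Y] [NormedAddCommGroup Z] [NormedSpace ℝ Z]

namespace IsCompactDistribution

variable {u v : (X → ℂ) → ℂ}

theorem exists_bound (hu : IsCompactDistribution u) : ∃ K : Set X, IsCompact K ∧ ∃ (m : ℕ) (C : ℝ),
    0 ≤ C ∧ ∀ f : X → ℂ, ContDiff ℝ ∞ f → ∀ b : ℝ, 0 ≤ b → JetBound m K f b → ‖u f‖ ≤ C * b := by
  obtain ⟨K, hK, m, C, h⟩ := hu.bound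
  refine ⟨K, hK, m, |C|, abs_nonneg _, fun f hf b hb hj => (h f hf b hb hj).trans ?_⟩
  gcongr
  exact le_abs_self _

theorem map_zero (hu : IsCompactDistribution u) : u (fun _ => 0) = 0 := by
  have := hu.map_smul 0 (fun _ => 0) contDiff_const
  rwa [zero_mul, zero_smul] at this

theorem map_const_mul (hu : IsCompactDistribution u) (a : ℂ) {f : X → ℂ} (hf : ContDiff ℝ ∞ f) :
    u (fun x => a * f x) = a * u f :=
  hu.map_smul a f hf

theorem map_mul_const (hu : IsCompactDistribution u) (a : ℂ) {f : X → ℂ} (hf : ContDiff ℝ ∞ f) :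
    u (fun x => f x * a) = u f * a := by
  rw [mul_comm, ← hu.map_const_mul a hf]
  congr 1; ext; ring

theorem map_sub (hu : IsCompactDistribution u) {f g : X → ℂ} (hf : ContDiff ℝ ∞ f)
    (hg : ContDiff ℝ ∞ g) : u (fun x => f x - g x) = u f - u g := by
  have h := hu.map_add f (fun x => (-1) * g x) hf (contDiff_const.mul hg)
  rw [hu.map_const_mul _ hg] at h
  rw [sub_eq_add_neg, ← neg_one_mul, ← h]
  congr 1; ext; simp [sub_eq_add_neg]

theorem map_sum (hu : IsCompactDistribution u) {ι : Type*} (s : Finset ι) {f : ι → X → ℂ}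
    (hf : ∀ i ∈ s, ContDiff ℝ ∞ (f i)) : u (fun x => ∑ i ∈ s, f i x) = ∑ i ∈ s, u (f i) := by
  classical
  induction s using Finset.induction_on with
  | empty => simpa using hu.map_zero
  | insert a s ha ih =>
    rw [Finset.sum_insert ha, ← ih fun i hi => hf i (Finset.mem_insert_of_mem hi),
      ← hu.map_add _ _ (hf a (Finset.mem_insert_self _ _))
        (ContDiff.sum fun i hi => hf i (Finset.mem_insert_of_mem hi))]
    congr 1; ext x; simp [Finset.sum_insert ha]

/-- Equal values on `K` would not suffice, because the bound involves derivatives. Equality near the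
points of `K` makes all derivatives of the difference vanish there, and the bound applies with `b =
0`. -/
theorem exists_congr (hu : IsCompactDistribution u) : ∃ K : Set X, IsCompact K ∧
    ∀ f g : X → ℂ, ContDiff ℝ ∞ f → ContDiff ℝ ∞ g → (∀ x ∈ K, f =ᶠ[nhds x] g) → u f = u g := by
  obtain ⟨K, hK, m, C, -, h⟩ := hu.exists_bound
  refine ⟨K, hK, fun f g hf hg hfg => ?_⟩
  rw [← sub_eq_zero, ← hu.map_sub hf hg, ← norm_le_zero_iff]
  refine (h _ (hf.sub hg) 0 le_rfl fun j _ x hx => ?_).trans (by simp)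
  have : (fun x => f x - g x) =ᶠ[nhds x] fun _ => (0 : ℂ) := by
    filter_upwards [hfg x hx] with y hy
    simp [hy]
  rw [(this.iteratedFDeriv ℝ j).self_of_nhds]
  have h0 := congrFun (iteratedFDeriv_fun_zero (𝕜 := ℝ) (E := X) (F := ℂ) (n := j)) x
  exact (congrArg norm h0).trans_le (by simp)

theorem zero : IsCompactDistribution (fun _ : X → ℂ => (0 : ℂ)) where
  map_add _ _ _ _ := by simp
  map_smul _ _ _ := by simp
  bound := ⟨∅, isCompact_empty, 0, 0, fun _ _ _ _ _ => by simp⟩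

theorem add (hu : IsCompactDistribution u) (hv : IsCompactDistribution v) :
    IsCompactDistribution (fun f => u f + v f) where
  map_add f g hf hg := by rw [hu.map_add f g hf hg, hv.map_add f g hf hg]; ring
  map_smul a f hf := by rw [hu.map_smul a f hf, hv.map_smul a f hf]; ring
  bound := by
    obtain ⟨K, hK, m, C, hC, h⟩ := hu.exists_bound
    obtain ⟨K', hK', m', C', hC', h'⟩ := hv.exists_bound
    refine ⟨K ∪ K', hK.union hK', max m m', C + C', fun f hf b hb hj => ?_⟩
    have hj : JetBound (max m m') (K ∪ K') f b := hj
    rw [add_mul]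
    exact (norm_add_le _ _).trans (add_le_add
      (h f hf b hb (hj.mono (le_max_left _ _) Set.subset_union_left le_rfl))
      (h' f hf b hb (hj.mono (le_max_right _ _) Set.subset_union_right le_rfl)))

theorem sum {ι : Type*} (s : Finset ι) {w : ι → (X → ℂ) → ℂ}
    (hw : ∀ i ∈ s, IsCompactDistribution (w i)) :
    IsCompactDistribution (fun f => ∑ i ∈ s, w i f) := by
  classical
  induction s using Finset.induction_on with
  | empty => simpa using zero
  | insert a s ha ih =>
    have := (hw a (Finset.mem_insert_self _ _)).add
      (ih fun i hi => hw i (Finset.mem_insert_of_mem hi))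
    convert this using 2 with f
    rw [Finset.sum_insert ha]

theorem list_sum {ι : Type*} (s : List ι) {w : ι → (X → ℂ) → ℂ}
    (hw : ∀ i, IsCompactDistribution (w i)) :
    IsCompactDistribution (fun f => (s.map fun i => w i f).sum) := by
  induction s with
  | nil => simpa using zero
  | cons a s ih => simpa using (hw a).add ih

theorem pushforward (hu : IsCompactDistribution u) (T : X →L[ℝ] Z) :
    IsCompactDistribution (fun f : Z → ℂ => u (fun x => f (T x))) where
  map_add f g hf hg := hu.map_add _ _ (hf.comp T.contDiff) (hg.comp T.contDiff)
  map_smul a f hf := hu.map_smul a _ (hf.comp T.contDiff)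
  bound := by
    obtain ⟨K, hK, m, C, hC, h⟩ := hu.exists_bound
    refine ⟨T '' K, hK.image T.continuous, m, C * max 1 ‖T‖ ^ m, fun f hf b hb hj => ?_⟩
    rw [mul_assoc]
    exact h _ (hf.comp T.contDiff) _ (by positivity) (JetBound.comp_clm T hf hj)

theorem mul (hu : IsCompactDistribution u) {χ : X → ℂ} (hχ : ContDiff ℝ ∞ χ) :
    IsCompactDistribution (fun f : X → ℂ => u (fun x => χ x * f x)) where
  map_add f g hf hg := by
    rw [← hu.map_add _ _ (hχ.mul hf) (hχ.mul hg)]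
    congr 1; ext; simp [mul_add]
  map_smul a f hf := by
    rw [← hu.map_smul _ _ (hχ.mul hf)]
    congr 1; ext; simp; ring
  bound := by
    obtain ⟨K, hK, m, C, hC, h⟩ := hu.exists_bound
    obtain ⟨a, ha, haj⟩ := exists_jetBound m hK hχ
    refine ⟨K, hK, m, C * (2 ^ m * a), fun f hf b hb hj => ?_⟩
    refine (h _ (hχ.mul hf) _ (by positivity) (JetBound.mul ha hχ hf haj hj)).trans_eq (by ring)

end IsCompactDistribution

variable (X) in
/-- The smooth complex functions on `X`. -/
def smoothFunctions : Submodule ℂ (X → ℂ) where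
  carrier := {f | ContDiff ℝ ∞ f}
  add_mem' {f _} hf hg := (show ContDiff ℝ ∞ f from hf).add hg
  zero_mem' := show ContDiff ℝ ∞ fun _ : X => (0 : ℂ) from contDiff_const
  smul_mem' a f hf := show ContDiff ℝ ∞ fun x => a * f x from
    contDiff_const.mul (show ContDiff ℝ ∞ f from hf)

theorem smooth_coe (f : smoothFunctions X) : ContDiff ℝ ∞ f.1 := f.2

/-- Continuous maps on `K` with values in a normed space. -/
abbrev ContinuousOnSet (K : Set X) (E : Type) [NormedAddCommGroup E] : Type := C(K, E)

/-- Jets of order `j` along a compact set. -/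
abbrev JetSpace (K : Set X) (j : ℕ) : Type := ContinuousOnSet K (X [×j]→L[ℝ] ℂ)

/-- The `j`-th derivative of a smooth function along `K`. -/
def jet (K : Set X) (j : ℕ) : smoothFunctions X →ₗ[ℂ] JetSpace K j where
  toFun f := ⟨fun x => iteratedFDeriv ℝ j f.1 x,
    ((smooth_coe f).continuous_iteratedFDeriv (by exact_mod_cast le_top)).comp continuous_subtype_val⟩
  map_add' f g := by
    ext1 x
    have hf : ContDiff ℝ j f.1 := (smooth_coe f).of_le (by exact_mod_cast le_top)
    have hg : ContDiff ℝ j g.1 := (smooth_coe g).of_le (by exact_mod_cast le_top)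
    exact iteratedFDeriv_add_apply hf.contDiffAt hg.contDiffAt
  map_smul' a f := by
    ext1 x
    have hf : ContDiff ℝ j f.1 := (smooth_coe f).of_le (by exact_mod_cast le_top)
    exact iteratedFDeriv_const_smul_apply (a := a) hf.contDiffAt

theorem jet_apply (K : Set X) (j : ℕ) (f : smoothFunctions X) (x : K) :
    jet K j f x = iteratedFDeriv ℝ j f.1 x := rfl

theorem norm_comp_single_le {ι : Type} [Fintype ι] [DecidableEq ι] {G : ι → Type}
    [∀ i, NormedAddCommGroup (G i)] [∀ i, NormedSpace ℂ (G i)] (L : (∀ i, G i) →L[ℂ] ℂ) (i : ι) :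
    ‖L.comp (ContinuousLinearMap.single ℂ G i)‖ ≤ ‖L‖ := by
  refine ContinuousLinearMap.opNorm_le_bound _ (norm_nonneg _) fun x => ?_
  exact (L.le_opNorm _).trans_eq (congrArg (‖L‖ * ·) (Pi.norm_single (i := i) x))

/-- A distribution with compact support is a continuous functional of finitely many derivatives on
a compact set. -/
theorem IsCompactDistribution.exists_representation_of_bound {u : (X → ℂ) → ℂ}
    (hu : IsCompactDistribution u) {K : Set X} [CompactSpace K] {m : ℕ} {C : ℝ} (hC : 0 ≤ C)
    (h : ∀ f : X → ℂ, ContDiff ℝ ∞ f → ∀ b : ℝ, 0 ≤ b → JetBound m K f b → ‖u f‖ ≤ C * b) :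
    ∃ L : ∀ j : Fin (m + 1), JetSpace K j →L[ℂ] ℂ,
      (∀ f : smoothFunctions X, u f.1 = ∑ j, L j (jet K j f)) ∧ ∀ j, ‖L j‖ ≤ C := by
  let J : smoothFunctions X →ₗ[ℂ] (∀ j : Fin (m + 1), JetSpace K j) :=
    LinearMap.pi fun j => jet K j
  let U : smoothFunctions X →ₗ[ℂ] ℂ :=
    { toFun := fun f => u f.1
      map_add' := fun f g => hu.map_add _ _ f.2 g.2
      map_smul' := fun a f => hu.map_smul a _ f.2 }
  have hb : ∀ f, ‖U f‖ ≤ C * ‖J f‖ := by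
    intro f
    refine h f.1 f.2 _ (norm_nonneg _) fun j hj x hx => ?_
    exact (ContinuousMap.norm_coe_le_norm (jet K j f) ⟨x, hx⟩).trans
      (norm_le_pi_norm (J f) ⟨j, Nat.lt_succ_of_le hj⟩)
  have hker : ∀ f, J f = 0 → U f = 0 := by
    intro f hf
    exact norm_le_zero_iff.1 (by simpa [hf] using hb f)
  let p := LinearMap.range J
  have hex : ∀ y : p, ∃ f, J f = y.1 := fun y => y.2
  choose g hg using hex
  -- The value of `u` depends only on the jets, so it descends to the range of `J`.
  have hU : ∀ f f', J f = J f' → U f = U f' := fun f f' hff => by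
    rw [← sub_eq_zero, ← U.map_sub]
    exact hker _ (by rw [J.map_sub, hff, sub_self])
  let V : p →ₗ[ℂ] ℂ :=
    { toFun := fun y => U (g y)
      map_add' := fun y z => by
        rw [← U.map_add]; exact hU _ _ (by rw [J.map_add, hg, hg, hg]; rfl)
      map_smul' := fun a y => by
        rw [RingHom.id_apply, ← U.map_smul]; exact hU _ _ (by rw [J.map_smul, hg, hg]; rfl) }
  let V' : StrongDual ℂ p := V.mkContinuous C fun y => by
    refine (hb (g y)).trans_eq ?_
    rw [hg]; rfl
  -- Hahn–Banach extends the functional from jets of smooth functions to all tuples of continuous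
  -- functions on `K`, a Banach space in which derivatives and integrals can be taken.
  obtain ⟨L, hL, hLn⟩ := exists_extension_norm_eq p V'
  have hLC : ‖L‖ ≤ C := hLn.trans_le (LinearMap.mkContinuous_norm_le _ hC _)
  refine ⟨fun j => L.comp (ContinuousLinearMap.single ℂ (fun j : Fin (m + 1) => JetSpace K j) j),
    fun f => ?_, fun j => ?_⟩
  swap
  · exact (norm_comp_single_le (G := fun j : Fin (m + 1) => JetSpace K j) L j).trans hLC
  have h1 : u f.1 = L (J f) := by
    have := hL ⟨J f, f, rfl⟩
    rw [this]
    exact (hU _ _ (hg ⟨J f, f, rfl⟩)).symm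
  rw [h1]
  conv_lhs => rw [← LinearMap.sum_single_apply (φ := fun j : Fin (m + 1) => JetSpace K j) (J f)]
  rw [_root_.map_sum]
  rfl

theorem IsCompactDistribution.exists_representation {u : (X → ℂ) → ℂ}
    (hu : IsCompactDistribution u) : ∃ K : Set X, ∃ _ : CompactSpace K, ∃ (m : ℕ)
      (L : ∀ j : Fin (m + 1), JetSpace K j →L[ℂ] ℂ),
      ∀ f : smoothFunctions X, u f.1 = ∑ j, L j (jet K j f) := by
  obtain ⟨K, hK, m, C, hC, h⟩ := hu.exists_bound
  have := isCompact_iff_compactSpace.1 hK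
  obtain ⟨L, hL, -⟩ := hu.exists_representation_of_bound hC h
  exact ⟨K, this, m, L, hL⟩

end CompactDistribution

/-! ### Smooth functions of two variables as smooth maps into spaces of continuous functions. -/

section Slices

variable {X Y E : Type} [NormedAddCommGroup X] [NormedAddCommGroup Y] [NormedAddCommGroup E]

/-- A continuous function of two variables, as a function of the first one with values in the
continuous functions of the second one on `K`. -/
def slice (K : Set Y) (Φ : X × Y → E) (hΦ : Continuous Φ) (x : X) : ContinuousOnSet K E :=
  ⟨fun y => Φ (x, y), hΦ.comp (by fun_prop)⟩

theorem continuous_slice (K : Set Y) {Φ : X × Y → E} (hΦ : Continuous Φ) :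
    Continuous (slice K Φ hΦ) :=
  ContinuousMap.continuous_of_continuous_uncurry _
    (hΦ.comp (continuous_fst.prodMk (continuous_subtype_val.comp continuous_snd)))

variable [NormedSpace ℝ X] [NormedSpace ℝ Y] [NormedSpace ℝ E]

variable (X E) in
/-- Evaluation of continuous families of continuous linear maps. -/
def applyFamily (K : Set Y) [CompactSpace K] :
    ContinuousOnSet K (X →L[ℝ] E) →L[ℝ] (X →L[ℝ] ContinuousOnSet K E) :=
  LinearMap.mkContinuous₂
    (LinearMap.mk₂ ℝ (fun (g : ContinuousOnSet K (X →L[ℝ] E)) (h : X) =>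
        (⟨fun y => g y h, by fun_prop⟩ : ContinuousOnSet K E))
      (fun _ _ _ => by ext; simp) (fun _ _ _ => by ext; simp)
      (fun _ _ _ => by ext; simp) (fun _ _ _ => by ext; simp)) 1
    (fun g h => by
      rw [one_mul]
      refine (ContinuousMap.norm_le _ (by positivity)).2 fun y => ?_
      refine ((g y).le_opNorm h).trans ?_
      gcongr
      exact g.norm_coe_le_norm y)

/-- Mean value inequality in `x` for each fixed `y`. The partial derivative, viewed as a map into
continuous functions on `K`, is continuous, so one radius `δ` serves all `y ∈ K`. -/
theorem hasFDerivAt_slice (K : Set Y) [CompactSpace K] {Φ : X × Y → E} (hΦ : ContDiff ℝ ∞ Φ)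
    (hc : Continuous fun z : X × Y => (fderiv ℝ Φ z).comp (ContinuousLinearMap.inl ℝ X Y)) (x : X) :
    HasFDerivAt (slice K Φ hΦ.continuous) (applyFamily X E K (slice K _ hc x)) x := by
  rw [hasFDerivAt_iff_isLittleO, Asymptotics.isLittleO_iff]
  intro c hc0
  obtain ⟨δ, hδ, h⟩ := Metric.continuous_iff.1 (continuous_slice K hc) x c hc0
  filter_upwards [Metric.ball_mem_nhds x hδ] with x' hx'
  refine (ContinuousMap.norm_le _ (by positivity)).2 fun y => ?_
  have := (convex_ball x δ).norm_image_sub_le_of_norm_hasFDerivWithin_le'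
    (f := fun x' => Φ (x', (y : Y)))
    (f' := fun x' => (fderiv ℝ Φ (x', (y : Y))).comp (ContinuousLinearMap.inl ℝ X Y))
    (φ := (fderiv ℝ Φ (x, (y : Y))).comp (ContinuousLinearMap.inl ℝ X Y)) (C := c)
    (fun z _ => by
      have h1 : HasFDerivAt Φ (fderiv ℝ Φ (z, (y : Y))) (z, (y : Y)) :=
        (hΦ.differentiable (by simp) _).hasFDerivAt
      exact (h1.comp z (hasFDerivAt_prodMk_left z (y : Y))).hasFDerivWithinAt)
    (fun z hz => by
      refine le_trans ?_ (h z hz).le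
      rw [dist_eq_norm]
      exact (slice K _ hc z - slice K _ hc x).norm_coe_le_norm y)
    (Metric.mem_ball_self hδ) hx'
  exact this

/-- Induction on the order with `E` varying, since the partial derivative takes values in `X →L[ℝ]
E`; `applyFamily` moves the linear argument out of the function space. -/
theorem contDiff_slice (K : Set Y) [CompactSpace K] {Φ : X × Y → E} (hΦ : ContDiff ℝ ∞ Φ) :
    ContDiff ℝ ∞ (slice K Φ hΦ.continuous) := by
  refine contDiff_infty.2 fun n => ?_
  induction n generalizing E with
  | zero => exact contDiff_zero.2 (continuous_slice K hΦ.continuous)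
  | succ n ih =>
    have h : ContDiff ℝ ∞ fun z : X × Y =>
        (fderiv ℝ Φ z).comp (ContinuousLinearMap.inl ℝ X Y) :=
      (hΦ.fderiv_right (m := ∞) (by simp)).clm_comp contDiff_const
    rw [Nat.cast_succ, contDiff_succ_iff_hasFDerivAt]
    exact ⟨_, (applyFamily X E K).contDiff.comp (ih h),
      hasFDerivAt_slice K hΦ h.continuous⟩

theorem norm_iteratedFDeriv_slice_le (K : Set Y) [CompactSpace K] {Φ : X × Y → E}
    (hΦ : ContDiff ℝ ∞ Φ) (i : ℕ) (x : X) {b : ℝ} (hb : 0 ≤ b)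
    (h : ∀ y ∈ K, ‖iteratedFDeriv ℝ i (fun x' => Φ (x', y)) x‖ ≤ b) :
    ‖iteratedFDeriv ℝ i (slice K Φ hΦ.continuous) x‖ ≤ b := by
  refine ContinuousMultilinearMap.opNorm_le_bound hb fun w => ?_
  refine (ContinuousMap.norm_le _ (by positivity)).2 fun y => ?_
  let ev : ContinuousOnSet K E →L[ℝ] E := ContinuousMap.evalCLM ℝ y
  have h1 := ev.iteratedFDeriv_comp_left
    (contDiff_slice K hΦ).contDiffAt (x := x) (i := i) (by exact_mod_cast le_top)
  have h2 : (iteratedFDeriv ℝ i (slice K Φ hΦ.continuous) x w) y =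
      iteratedFDeriv ℝ i (fun x' => Φ (x', (y : Y))) x w :=
    (congrArg (fun T => T w) h1).symm
  rw [h2]
  refine (ContinuousMultilinearMap.le_opNorm _ _).trans ?_
  gcongr
  exact h y y.2

/-- The slice is a translate of `f` composed with the linear inclusion of `Y`. -/
theorem iteratedFDeriv_slice_right {f : X × Y → E} (hf : ContDiff ℝ ∞ f) (j : ℕ) (x : X) (y : Y) :
    iteratedFDeriv ℝ j (fun y' => f (x, y')) y =
      (iteratedFDeriv ℝ j f (x, y)).compContinuousLinearMap
        fun _ => ContinuousLinearMap.inr ℝ X Y := by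
  have h := (ContinuousLinearMap.inr ℝ X Y).iteratedFDeriv_comp_right (n := ∞)
    (f := fun z => f (z + (x, 0))) (hf.comp (contDiff_id.add contDiff_const)) y (i := j)
    (by exact_mod_cast le_top)
  rw [iteratedFDeriv_comp_add_right] at h
  convert h using 2
  · ext y'; simp
  · simp

theorem iteratedFDeriv_slice_left {f : X × Y → E} (hf : ContDiff ℝ ∞ f) (j : ℕ) (x : X) (y : Y) :
    iteratedFDeriv ℝ j (fun x' => f (x', y)) x =
      (iteratedFDeriv ℝ j f (x, y)).compContinuousLinearMap
        fun _ => ContinuousLinearMap.inl ℝ X Y := by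
  have h := (ContinuousLinearMap.inl ℝ X Y).iteratedFDeriv_comp_right (n := ∞)
    (f := fun z => f (z + (0, y))) (hf.comp (contDiff_id.add contDiff_const)) x (i := j)
    (by exact_mod_cast le_top)
  rw [iteratedFDeriv_comp_add_right] at h
  convert h using 2
  · ext y'; simp
  · simp

theorem norm_compContinuousLinearMap_le_of_norm_le_one {W : Type} [NormedAddCommGroup W]
    [NormedSpace ℝ W] {j : ℕ} (g : W [×j]→L[ℝ] E)
    {T : X →L[ℝ] W} (hT : ‖T‖ ≤ 1) : ‖g.compContinuousLinearMap fun _ => T‖ ≤ ‖g‖ := by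
  refine (ContinuousMultilinearMap.norm_compContinuousLinearMap_le _ _).trans ?_
  rw [Finset.prod_const, Finset.card_univ, Fintype.card_fin]
  exact mul_le_of_le_one_right (norm_nonneg _) (pow_le_one₀ (norm_nonneg _) hT)

theorem contDiff_jet_slice {f : X × Y → E} (hf : ContDiff ℝ ∞ f) (j : ℕ) :
    ContDiff ℝ ∞ fun z : X × Y => iteratedFDeriv ℝ j (fun y' => f (z.1, y')) z.2 := by
  simp_rw [iteratedFDeriv_slice_right hf]
  exact (ContinuousMultilinearMap.compContinuousLinearMapL
    fun _ : Fin j => ContinuousLinearMap.inr ℝ X Y).contDiff.comp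
      (hf.iteratedFDeriv_right (m := ∞) (by exact_mod_cast le_top))

theorem norm_iteratedFDeriv_jet_slice_le {f : X × Y → E} (hf : ContDiff ℝ ∞ f) (i j : ℕ) (x : X)
    (y : Y) : ‖iteratedFDeriv ℝ i (fun x' => iteratedFDeriv ℝ j (fun y' => f (x', y')) y) x‖ ≤
      ‖iteratedFDeriv ℝ (i + j) f (x, y)‖ := by
  have h0 : ContDiff ℝ ∞ (iteratedFDeriv ℝ j f) :=
    hf.iteratedFDeriv_right (m := ∞) (by exact_mod_cast le_top)
  have h1 : ContDiff ℝ ∞ fun x' => iteratedFDeriv ℝ j f (x', y) :=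
    h0.comp (contDiff_id.prodMk contDiff_const)
  simp_rw [iteratedFDeriv_slice_right hf]
  let T : ((X × Y) [×j]→L[ℝ] E) →L[ℝ] (Y [×j]→L[ℝ] E) :=
    ContinuousMultilinearMap.compContinuousLinearMapL fun _ => ContinuousLinearMap.inr ℝ X Y
  have h2 := T.norm_iteratedFDeriv_comp_left
      h1.contDiffAt (x := x) (n := i) (by exact_mod_cast le_top)
  refine h2.trans ?_
  rw [← norm_iteratedFDeriv_iteratedFDeriv, iteratedFDeriv_slice_left h0]
  refine (mul_le_of_le_one_left (norm_nonneg _) ?_).trans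
    (norm_compContinuousLinearMap_le_of_norm_le_one _ (ContinuousLinearMap.norm_inl_le_one ℝ X Y))
  refine ContinuousLinearMap.opNorm_le_bound _ zero_le_one fun g => ?_
  rw [one_mul]
  exact norm_compContinuousLinearMap_le_of_norm_le_one _ (ContinuousLinearMap.norm_inr_le_one ℝ X Y)

end Slices

/-! ### Distributions applied to smooth families, and tensor products. -/

section Parameters

variable {X Y : Type} [NormedAddCommGroup X] [NormedSpace ℝ X]
  [NormedAddCommGroup Y] [NormedSpace ℝ Y]

/-- A distribution with compact support, applied to a smooth function with a parameter, depends
smoothly on the parameter. -/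
theorem IsCompactDistribution.param_bound {v : (Y → ℂ) → ℂ} (hv : IsCompactDistribution v)
    {K : Set Y} (hK : IsCompact K) {m : ℕ} {C : ℝ} (hC : 0 ≤ C)
    (h : ∀ f : Y → ℂ, ContDiff ℝ ∞ f → ∀ b : ℝ, 0 ≤ b → JetBound m K f b → ‖v f‖ ≤ C * b)
    {f : X × Y → ℂ} (hf : ContDiff ℝ ∞ f) :
    ContDiff ℝ ∞ (fun x => v fun y => f (x, y)) ∧
      ∀ (m' : ℕ) (K' : Set X) (b : ℝ), 0 ≤ b → JetBound (m' + m) (K' ×ˢ K) f b →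
        JetBound m' K' (fun x => v fun y => f (x, y)) ((m + 1) * C * b) := by
  have := isCompact_iff_compactSpace.1 hK
  obtain ⟨L, hL, hLC⟩ := hv.exists_representation_of_bound hC h
  have hfx : ∀ x, ContDiff ℝ ∞ fun y => f (x, y) := fun x =>
    hf.comp (contDiff_const.prodMk contDiff_id)
  -- Through the representation, the dependence on `x` is a fixed bounded operator applied to a
  -- smooth map into continuous functions on `K`.
  have hrep : (fun x => v fun y => f (x, y)) = fun x => ∑ j, ((L j).restrictScalars ℝ)
      (slice K _ (contDiff_jet_slice hf j).continuous x) := by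
    ext x
    exact hL ⟨_, hfx x⟩
  have hs : ∀ j : Fin (m + 1), ContDiff ℝ ∞ fun x => ((L j).restrictScalars ℝ)
      (slice K _ (contDiff_jet_slice hf j).continuous x) := fun j =>
    ((L j).restrictScalars ℝ).contDiff.comp (contDiff_slice K (contDiff_jet_slice hf j))
  rw [hrep]
  refine ⟨ContDiff.sum fun j _ => hs j, fun m' K' b hb h i hi x hx => ?_⟩
  rw [iteratedFDeriv_sum fun j _ => (hs j).of_le (by exact_mod_cast le_top),
    Finset.sum_apply]
  -- Each of the `m + 1` jet orders contributes at most `C * b`.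
  refine (norm_sum_le_of_le (n := fun _ : Fin (m + 1) => C * b) _ fun j _ => ?_).trans_eq (by
    simp; ring)
  refine (((L j).restrictScalars ℝ).norm_iteratedFDeriv_comp_left
    (contDiff_slice K (contDiff_jet_slice hf j)).contDiffAt (n := i)
      (by exact_mod_cast le_top)).trans ?_
  rw [ContinuousLinearMap.norm_restrictScalars]
  refine mul_le_mul (hLC j) ?_ (norm_nonneg _) hC
  refine norm_iteratedFDeriv_slice_le K (contDiff_jet_slice hf j) i x hb fun y hy => ?_
  exact (norm_iteratedFDeriv_jet_slice_le hf i j x y).trans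
    (h _ (add_le_add hi (Nat.lt_succ_iff.1 j.2)) _ ⟨hx, hy⟩)

theorem IsCompactDistribution.exists_param_bound {v : (Y → ℂ) → ℂ} (hv : IsCompactDistribution v) :
    ∃ K : Set Y, IsCompact K ∧ ∃ (m : ℕ) (C : ℝ), 0 ≤ C ∧ ∀ f : X × Y → ℂ, ContDiff ℝ ∞ f →
      ContDiff ℝ ∞ (fun x => v fun y => f (x, y)) ∧
      ∀ (m' : ℕ) (K' : Set X) (b : ℝ), 0 ≤ b → JetBound (m' + m) (K' ×ˢ K) f b →
        JetBound m' K' (fun x => v fun y => f (x, y)) (C * b) := by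
  obtain ⟨K, hK, m, C, hC, h⟩ := hv.exists_bound
  exact ⟨K, hK, m, (m + 1) * C, by positivity, fun f hf => hv.param_bound hK hC h hf⟩

theorem IsCompactDistribution.contDiff_param {v : (Y → ℂ) → ℂ} (hv : IsCompactDistribution v)
    {f : X × Y → ℂ} (hf : ContDiff ℝ ∞ f) : ContDiff ℝ ∞ (fun x => v fun y => f (x, y)) := by
  obtain ⟨_, _, _, _, _, h⟩ := hv.exists_param_bound (X := X)
  exact (h f hf).1

/-- The tensor product of distributions with compact support. -/
theorem IsCompactDistribution.tensor {u : (X → ℂ) → ℂ} {v : (Y → ℂ) → ℂ}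
    (hu : IsCompactDistribution u) (hv : IsCompactDistribution v) :
    IsCompactDistribution fun f : X × Y → ℂ => u fun x => v fun y => f (x, y) where
  map_add f g hf hg := by
    rw [← hu.map_add _ _ (hv.contDiff_param hf) (hv.contDiff_param hg)]
    congr 1; ext x
    exact hv.map_add _ _ (hf.comp (contDiff_const.prodMk contDiff_id))
      (hg.comp (contDiff_const.prodMk contDiff_id))
  map_smul a f hf := by
    rw [← hu.map_smul _ _ (hv.contDiff_param hf)]
    congr 1; ext x
    exact hv.map_smul a _ (hf.comp (contDiff_const.prodMk contDiff_id))
  bound := by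
    obtain ⟨K, hK, m, C, hC, h⟩ := hu.exists_bound
    obtain ⟨K', hK', m', C', hC', h'⟩ := hv.exists_param_bound (X := X)
    refine ⟨K ×ˢ K', hK.prod hK', m + m', C * C', fun f hf b hb hj => ?_⟩
    rw [mul_assoc]
    exact h _ (h' f hf).1 _ (by positivity) ((h' f hf).2 m K b hb hj)

end Parameters

/-! ### Interchange of distributions with integrals over parameters. -/

section Interchange

open MeasureTheory

variable {X Y Z Ω : Type} [NormedAddCommGroup X] [NormedSpace ℝ X]
  [NormedAddCommGroup Z] [NormedSpace ℝ Z]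
  [MeasurableSpace Ω] {ν : Measure Ω}

/-- All derivatives of the family of functions are measurable in the parameter, uniformly on compact
sets. -/
def JetMeasurable (G : Ω → smoothFunctions X) (ν : Measure Ω) : Prop :=
  ∀ (K : Set X) [CompactSpace K] (j : ℕ), AEStronglyMeasurable (fun w => jet K j (G w)) ν

/-- All derivatives of the family of functions are dominated by integrable functions of the
parameter, uniformly on compact sets. -/
def JetDominated (G : Ω → smoothFunctions X) (ν : Measure Ω) : Prop :=
  ∀ (m : ℕ) (K : Set X), IsCompact K → ∃ bd : Ω → ℝ, Integrable bd ν ∧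
    ∀ᵐ w ∂ν, JetBound m K (G w).1 (bd w)

theorem JetMeasurable.iteratedFDeriv {G : Ω → smoothFunctions X} (h : JetMeasurable G ν) (j : ℕ)
    (x : X) : AEStronglyMeasurable (fun w => iteratedFDeriv ℝ j (G w).1 x) ν :=
  (continuous_eval_const
    (⟨x, Set.mem_singleton x⟩ : ({x} : Set X))).comp_aestronglyMeasurable (h {x} j)

theorem JetMeasurable.const_mul {G : Ω → smoothFunctions X} (h : JetMeasurable G ν) {c : Ω → ℂ}
    (hc : AEStronglyMeasurable c ν) : JetMeasurable (fun w => c w • G w) ν := by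
  intro K _ j
  simp_rw [map_smul]
  exact hc.smul (h K j)

theorem JetMeasurable.sum {ι : Type*} (s : Finset ι) {G : ι → Ω → smoothFunctions X}
    (h : ∀ i ∈ s, JetMeasurable (G i) ν) : JetMeasurable (fun w => ∑ i ∈ s, G i w) ν := by
  intro K _ j
  simp_rw [map_sum]
  exact Finset.aestronglyMeasurable_fun_sum s fun i hi => h i hi K j

/-- The sections of a smooth function of two variables. -/
def sectionAt {f : Z × X → ℂ} (hf : ContDiff ℝ ∞ f) (z : Z) : smoothFunctions X :=
  ⟨fun x => f (z, x), hf.comp (contDiff_const.prodMk contDiff_id)⟩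

theorem continuous_jet_sectionAt {f : Z × X → ℂ} (hf : ContDiff ℝ ∞ f) (K : Set X) (j : ℕ) :
    Continuous fun z => jet K j (sectionAt hf z) :=
  continuous_slice K (contDiff_jet_slice hf j).continuous

theorem jetMeasurable_sectionAt [FiniteDimensional ℝ Z] [MeasurableSpace Z] [BorelSpace Z]
    {f : Z × X → ℂ} (hf : ContDiff ℝ ∞ f) {ζ : Ω → Z} (hζ : Measurable ζ) :
    JetMeasurable (fun w => sectionAt hf (ζ w)) ν := by
  intro K _ j
  have : ProperSpace Z := FiniteDimensional.proper ℝ Z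
  exact ((continuous_jet_sectionAt hf K j).stronglyMeasurable.comp_measurable
    hζ).aestronglyMeasurable

theorem integrable_iteratedFDeriv {G : Ω → smoothFunctions X} (hm : JetMeasurable G ν)
    (hd : JetDominated G ν) (j : ℕ) (x : X) :
    Integrable (fun w => iteratedFDeriv ℝ j (G w).1 x) ν := by
  obtain ⟨bd, hbd, h⟩ := hd j {x} isCompact_singleton
  exact hbd.mono' (hm.iteratedFDeriv j x) (h.mono fun w hw => hw j le_rfl x rfl)

theorem hasFDerivAt_integral_iteratedFDeriv [ProperSpace X] {G : Ω → smoothFunctions X}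
    (hm : JetMeasurable G ν) (hd : JetDominated G ν) (j : ℕ) (x : X) :
    HasFDerivAt (fun x => ∫ w, iteratedFDeriv ℝ j (G w).1 x ∂ν)
      (∫ w, iteratedFDeriv ℝ (j + 1) (G w).1 x ∂ν).curryLeft x := by
  -- Differentiation under the integral needs the next derivative dominated on a whole neighbourhood
  -- of `x`; closed balls are compact in a proper space.
  obtain ⟨bd, hbd, h⟩ := hd (j + 1) (Metric.closedBall x 1) (isCompact_closedBall x 1)
  have hF : ∀ x, AEStronglyMeasurable (fun w => fderiv ℝ (iteratedFDeriv ℝ j (G w).1) x) ν := by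
    intro x
    exact (continuousMultilinearCurryLeftEquiv ℝ
      (fun _ : Fin (j + 1) => X) ℂ).continuous.comp_aestronglyMeasurable
        (hm.iteratedFDeriv (j + 1) x)
  have h1 := hasFDerivAt_integral_of_dominated_of_fderiv_le (𝕜 := ℝ) (μ := ν)
    (F := fun x w => iteratedFDeriv ℝ j (G w).1 x)
    (F' := fun x w => fderiv ℝ (iteratedFDeriv ℝ j (G w).1) x) (x₀ := x) (bound := bd)
    (Metric.closedBall_mem_nhds x one_pos)
    (Filter.Eventually.of_forall fun x => hm.iteratedFDeriv j x)
    (integrable_iteratedFDeriv hm hd j x) (hF x)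
    (h.mono fun w hw x' hx' => by
      rw [norm_fderiv_iteratedFDeriv]
      exact hw (j + 1) le_rfl x' hx')
    hbd
    (Filter.Eventually.of_forall fun w x' _ =>
      (((smooth_coe (G w)).differentiable_iteratedFDeriv
        (m := j) (by exact_mod_cast WithTop.coe_lt_top _)) x').hasFDerivAt)
  let T : (X [×(j + 1)]→L[ℝ] ℂ) →L[ℝ] (X →L[ℝ] X [×j]→L[ℝ] ℂ) :=
    ((continuousMultilinearCurryLeftEquiv ℝ
      (fun _ : Fin (j + 1) => X) ℂ).toContinuousLinearEquiv : _ →L[ℝ] _)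
  have h2 := ContinuousLinearMap.integral_comp_comm (𝕜 := ℝ) (E := X [×(j + 1)]→L[ℝ] ℂ)
    (Fₗ := X →L[ℝ] X [×j]→L[ℝ] ℂ) T (integrable_iteratedFDeriv hm hd (j + 1) x)
  have h3 : (∫ w, fderiv ℝ (iteratedFDeriv ℝ j (G w).1) x ∂ν) =
    (∫ w, iteratedFDeriv ℝ (j + 1) (G w).1 x ∂ν).curryLeft := h2
  rwa [h3] at h1

theorem hasFTaylorSeriesUpTo_integral [ProperSpace X] {G : Ω → smoothFunctions X}
    (hm : JetMeasurable G ν) (hd : JetDominated G ν) :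
    HasFTaylorSeriesUpTo ∞ (fun x => ∫ w, (G w).1 x ∂ν)
      (fun x j => ∫ w, iteratedFDeriv ℝ j (G w).1 x ∂ν) where
  zero_eq x := by
    have h := (continuousMultilinearCurryFin0 ℝ X ℂ).toContinuousLinearEquiv.integral_comp_comm
      (μ := ν) (fun w => iteratedFDeriv ℝ 0 (G w).1 x)
    exact h.symm
  fderiv j _ x := hasFDerivAt_integral_iteratedFDeriv hm hd j x
  cont j _ := continuous_iff_continuousAt.2 fun x =>
    (hasFDerivAt_integral_iteratedFDeriv hm hd j x).continuousAt

theorem contDiff_integral [ProperSpace X] {G : Ω → smoothFunctions X}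
    (hm : JetMeasurable G ν) (hd : JetDominated G ν) :
    ContDiff ℝ ∞ (fun x => ∫ w, (G w).1 x ∂ν) :=
  (hasFTaylorSeriesUpTo_integral hm hd).contDiff

theorem integrable_jet {G : Ω → smoothFunctions X} (hm : JetMeasurable G ν)
    (hd : JetDominated G ν) (K : Set X) [CompactSpace K] (j : ℕ) :
    Integrable (fun w => jet K j (G w)) ν := by
  obtain ⟨bd, hbd, h⟩ := hd j K (isCompact_iff_compactSpace.2 inferInstance)
  refine hbd.norm.mono' (hm K j) (h.mono fun w hw => ?_)
  refine (ContinuousMap.norm_le _ (norm_nonneg _)).2 fun x => ?_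
  exact (hw j le_rfl x x.2).trans (le_abs_self _)

theorem IsCompactDistribution.integrable_apply {u : (X → ℂ) → ℂ}
    (hu : IsCompactDistribution u) {G : Ω → smoothFunctions X}
    (hm : JetMeasurable G ν) (hd : JetDominated G ν) : Integrable (fun w => u (G w).1) ν := by
  obtain ⟨K, hK, m, L, hL⟩ := hu.exists_representation
  simp_rw [hL]
  exact integrable_finsetSum _ fun j _ => (L j).integrable_comp (integrable_jet hm hd K j)

/-- Distributions with compact support commute with integrals over parameters. -/
theorem IsCompactDistribution.apply_integral [ProperSpace X] {u : (X → ℂ) → ℂ}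
    (hu : IsCompactDistribution u) {G : Ω → smoothFunctions X}
    (hm : JetMeasurable G ν) (hd : JetDominated G ν) :
    u (fun x => ∫ w, (G w).1 x ∂ν) = ∫ w, u (G w).1 ∂ν := by
  obtain ⟨K, hK, m, L, hL⟩ := hu.exists_representation
  -- The jet of the integral is the Bochner integral of the jets in `JetSpace K j`, and each bounded
  -- functional `L j` commutes with that integral.
  have hjet : ∀ j, jet K j ⟨fun x => ∫ w, (G w).1 x ∂ν, contDiff_integral hm hd⟩ =
      ∫ w, jet K j (G w) ∂ν := by
    intro j
    ext1 x
    have h1 := (hasFTaylorSeriesUpTo_integral hm hd).eq_iteratedFDeriv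
      (m := j) (by exact_mod_cast le_top) (x : X)
    let ev : JetSpace K j →L[ℝ] (X [×j]→L[ℝ] ℂ) := ContinuousMap.evalCLM ℝ x
    have h2 := ev.integral_comp_comm (integrable_jet hm hd K j)
    rw [jet_apply, ← h1]
    exact h2
  simp_rw [hL]
  have := hL ⟨fun x => ∫ w, (G w).1 x ∂ν, contDiff_integral hm hd⟩
  rw [this, integral_finsetSum _ fun j _ => (L j).integrable_comp (integrable_jet hm hd K j)]
  refine Finset.sum_congr rfl fun j _ => ?_
  rw [hjet, ContinuousLinearMap.integral_comp_comm _ (integrable_jet hm hd K j)]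

end Interchange

/-! ### Cutoff functions and derivative bounds for plane waves. -/

section PlaneWaves

variable {X : Type} [NormedAddCommGroup X] [NormedSpace ℝ X]

/-- The function equals `1` near the points of `K`, not merely on `K`, so that multiplication by it
preserves the germs required in `IsCompactDistribution.exists_congr`. -/
theorem exists_cutoff [FiniteDimensional ℝ X] {K U : Set X} (hK : IsCompact K) (hU : IsOpen U)
    (hKU : K ⊆ U) : ∃ χ : X → ℝ, ContDiff ℝ ∞ χ ∧ HasCompactSupport χ ∧
      (∀ x ∈ K, ∀ᶠ y in nhds x, χ y = 1) ∧ (∀ x ∉ U, χ x = 0) ∧ ∀ x, χ x ∈ Set.Icc (0 : ℝ) 1 := by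
  have : ProperSpace X := FiniteDimensional.proper ℝ X
  obtain ⟨K', hK', h1, h2⟩ := exists_compact_between hK hU hKU
  obtain ⟨f, hf1, hf0, hf⟩ := exists_contMDiffMap_one_nhds_of_subset_interior
    (n := (⊤ : ℕ∞)) (modelWithCornersSelf ℝ X) hK.isClosed h1
  refine ⟨f, f.contMDiff.contDiff, ?_, fun x hx => ?_, fun x hx => hf0 x fun h => hx (h2 h), hf⟩
  · exact HasCompactSupport.intro hK' hf0
  · exact Filter.Eventually.filter_mono (nhds_le_nhdsSet hx) hf1

theorem iteratedDeriv_cexp_mul (c : ℂ) (j : ℕ) (s : ℝ) :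
    iteratedDeriv j (fun s : ℝ => Complex.exp (c * s)) s = c ^ j * Complex.exp (c * s) := by
  induction j generalizing s with
  | zero => simp
  | succ j ih =>
    rw [iteratedDeriv_succ, funext ih]
    have h : HasDerivAt (fun s : ℝ => c ^ j * Complex.exp (c * s))
        (c ^ j * (Complex.exp (c * s) * (c * 1))) s :=
      ((Complex.ofRealCLM.hasDerivAt.const_mul c).cexp).const_mul _
    rw [h.deriv]
    ring

theorem norm_iteratedFDeriv_comp_functional_le {h : ℝ → ℂ} (hh : ContDiff ℝ ∞ h) (l : X →L[ℝ] ℝ)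
    (j : ℕ) (x : X) :
    ‖iteratedFDeriv ℝ j (fun x => h (l x)) x‖ ≤ ‖iteratedDeriv j h (l x)‖ * ‖l‖ ^ j := by
  have := l.iteratedFDeriv_comp_right (n := ∞) hh x (i := j) (by exact_mod_cast le_top)
  change ‖iteratedFDeriv ℝ j (h ∘ l) x‖ ≤ _
  rw [this, ← norm_iteratedFDeriv_eq_norm_iteratedDeriv]
  refine (ContinuousMultilinearMap.norm_compContinuousLinearMap_le _ _).trans ?_
  rw [Finset.prod_const, Finset.card_univ, Fintype.card_fin]

/-- The plane wave with covector `k`. -/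
def planeWave {n : ℕ} (k x : Fin n → Mink) : ℂ := Complex.exp (-(Complex.I * (covPair k x : ℂ)))

theorem covPair_add_left {n : ℕ} (k k' x : Fin n → Mink) :
    covPair (k + k') x = covPair k x + covPair k' x := by
  simp only [covPair, ← Finset.sum_add_distrib]
  exact Finset.sum_congr rfl fun i _ => by simp; ring

theorem covPair_add_right {n : ℕ} (k x x' : Fin n → Mink) :
    covPair k (x + x') = covPair k x + covPair k x' := by
  simp only [covPair, ← Finset.sum_add_distrib]
  exact Finset.sum_congr rfl fun i _ => by simp; ring

theorem covPair_smul_right {n : ℕ} (a : ℝ) (k x : Fin n → Mink) :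
    covPair k (a • x) = a * covPair k x := by
  simp only [covPair, Finset.mul_sum]
  exact Finset.sum_congr rfl fun i _ => by simp; ring

theorem abs_covPair_le {n : ℕ} (k x : Fin n → Mink) : |covPair k x| ≤ (2 * n * ‖k‖) * ‖x‖ := by
  refine (Finset.abs_sum_le_sum_abs _ _).trans ?_
  have h : ∀ i ∈ Finset.univ, |(k i).1 * (x i).1 + (k i).2 * (x i).2| ≤ 2 * ‖k‖ * ‖x‖ := by
    intro i _
    have h1 : |(k i).1| ≤ ‖k‖ := (norm_fst_le (k i)).trans (norm_le_pi_norm k i)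
    have h2 : |(k i).2| ≤ ‖k‖ := (norm_snd_le (k i)).trans (norm_le_pi_norm k i)
    have h3 : |(x i).1| ≤ ‖x‖ := (norm_fst_le (x i)).trans (norm_le_pi_norm x i)
    have h4 : |(x i).2| ≤ ‖x‖ := (norm_snd_le (x i)).trans (norm_le_pi_norm x i)
    calc _ ≤ |(k i).1| * |(x i).1| + |(k i).2| * |(x i).2| := by
          rw [← abs_mul, ← abs_mul]; exact abs_add_le _ _
      _ ≤ ‖k‖ * ‖x‖ + ‖k‖ * ‖x‖ := by gcongr
      _ = _ := by ring
  refine (Finset.sum_le_sum h).trans_eq ?_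
  simp; ring

/-- Pairing with a covector, as a continuous linear functional. -/
def covPairL {n : ℕ} (k : Fin n → Mink) : (Fin n → Mink) →L[ℝ] ℝ :=
  LinearMap.mkContinuous
    { toFun := covPair k
      map_add' := covPair_add_right k
      map_smul' := fun a x => covPair_smul_right a k x } (2 * n * ‖k‖) (abs_covPair_le k)

theorem covPairL_apply {n : ℕ} (k x : Fin n → Mink) : covPairL k x = covPair k x := rfl

theorem norm_covPairL_le {n : ℕ} (k : Fin n → Mink) : ‖covPairL k‖ ≤ 2 * n * ‖k‖ :=
  LinearMap.mkContinuous_norm_le _ (by positivity) _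

theorem planeWave_add {n : ℕ} (k k' x : Fin n → Mink) :
    planeWave (k + k') x = planeWave k x * planeWave k' x := by
  rw [planeWave, planeWave, planeWave, ← Complex.exp_add, covPair_add_left]
  congr 1; push_cast; ring

theorem contDiff_covPair {n : ℕ} :
    ContDiff ℝ ∞ fun z : (Fin n → Mink) × (Fin n → Mink) => covPair z.1 z.2 := by
  unfold covPair
  fun_prop

theorem contDiff_planeWave_prod {n : ℕ} :
    ContDiff ℝ ∞ fun z : (Fin n → Mink) × (Fin n → Mink) => planeWave z.1 z.2 :=
  ((contDiff_const.mul (Complex.ofRealCLM.contDiff.comp contDiff_covPair)).neg).cexp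

theorem contDiff_planeWave {n : ℕ} (k : Fin n → Mink) : ContDiff ℝ ∞ (planeWave k) :=
  show ContDiff ℝ ∞ fun x => Complex.exp (-(Complex.I * ((covPairL k x : ℝ) : ℂ))) from
    ((contDiff_const.mul (Complex.ofRealCLM.contDiff.comp (covPairL k).contDiff)).neg).cexp

/-- Each derivative costs one factor of the covector; this is the source of the polynomial growth of
Fourier transforms. The factor `1 + 2 * n` comes from the norm of `covPairL k` for sup norms. -/
theorem jetBound_planeWave {n : ℕ} (m : ℕ) (K : Set (Fin n → Mink)) (k : Fin n → Mink) :
    JetBound m K (planeWave k) ((1 + 2 * n) ^ m * (1 + ‖k‖) ^ m) := by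
  intro j hj x _
  have h1 : planeWave k = fun x => (fun s : ℝ => Complex.exp (-Complex.I * s)) (covPairL k x) := by
    ext x; simp [planeWave, covPairL_apply]
  have h2 : ContDiff ℝ ∞ fun s : ℝ => Complex.exp (-Complex.I * s) :=
    (contDiff_const.mul Complex.ofRealCLM.contDiff).cexp
  rw [h1]
  refine (norm_iteratedFDeriv_comp_functional_le h2 _ j x).trans ?_
  rw [iteratedDeriv_cexp_mul]
  have h3 : ‖(-Complex.I) ^ j * Complex.exp (-Complex.I * (covPairL k x : ℝ))‖ = 1 := by
    rw [norm_mul, norm_pow, Complex.norm_exp]; simp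
  rw [h3, one_mul, ← mul_pow]
  have h4 : ‖covPairL k‖ ≤ (1 + 2 * n) * (1 + ‖k‖) := by
    refine (norm_covPairL_le k).trans ?_
    nlinarith [norm_nonneg k, Nat.cast_nonneg (α := ℝ) n]
  have h5 : 1 ≤ (1 + 2 * (n : ℝ)) * (1 + ‖k‖) := by
    nlinarith [norm_nonneg k, Nat.cast_nonneg (α := ℝ) n,
      mul_nonneg (Nat.cast_nonneg (α := ℝ) n) (norm_nonneg k)]
  exact (pow_le_pow_left₀ (norm_nonneg _) h4 j).trans (pow_le_pow_right₀ h5 hj)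

end PlaneWaves

/-! ### Fourier inversion in Euclidean coordinates, and expansion of distributions in plane waves.
-/

section Fourier

open MeasureTheory FourierTransform

/-- Euclidean coordinates on `n` copies of Minkowski space. -/
abbrev Eucl (n : ℕ) : Type := EuclideanSpace ℝ (Fin n ⊕ Fin n)

/-- The identification of Euclidean coordinates with points. -/
def ofEucl (n : ℕ) : Eucl n ≃L[ℝ] (Fin n → Mink) :=
  LinearEquiv.toContinuousLinearEquiv
    { toFun := fun v i => (v (Sum.inl i), v (Sum.inr i))
      map_add' := fun _ _ => rfl
      map_smul' := fun _ _ => rfl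
      invFun := fun x => WithLp.toLp 2 (Sum.elim (fun i => (x i).1) fun i => (x i).2)
      left_inv := fun v => by ext i; cases i <;> rfl
      right_inv := fun x => rfl }

theorem covPair_ofEucl {n : ℕ} (v w : Eucl n) :
    covPair (ofEucl n v) (ofEucl n w) = inner ℝ w v := by
  rw [PiLp.inner_apply, Fintype.sum_sum_type, ← Finset.sum_add_distrib]
  rfl

/-- The covector of a Fourier mode in Euclidean coordinates. -/
def mode {n : ℕ} (v : Eucl n) : Fin n → Mink := (-(2 * Real.pi)) • ofEucl n v

/-- The Fourier coefficients of a function on `n` copies of Minkowski space. -/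
def fourierCoeff {n : ℕ} (φ : (Fin n → Mink) → ℂ) (v : Eucl n) : ℂ :=
  𝓕 (fun y : Eucl n => φ (ofEucl n y)) v

variable {n : ℕ} {φ : (Fin n → Mink) → ℂ}

/-- The sign and the factor $2\pi$ in `mode` make `planeWave (mode v)` the wave $e^{2\pi i\langle
v,\cdot\rangle}$ of the inversion formula. -/
theorem covPair_mode (v : Eucl n) (x : Fin n → Mink) :
    covPair (mode v) x = -(2 * Real.pi * inner ℝ v ((ofEucl n).symm x)) := by
  obtain ⟨y, rfl⟩ := (ofEucl n).surjective x
  rw [ContinuousLinearEquiv.symm_apply_apply, real_inner_comm, ← covPair_ofEucl, mode]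
  simp only [covPair, Finset.mul_sum, ← Finset.sum_neg_distrib]
  exact Finset.sum_congr rfl fun i _ => by simp; ring

theorem continuous_mode : Continuous (mode : Eucl n → Fin n → Mink) :=
  (ofEucl n).continuous.const_smul (-(2 * Real.pi))

theorem exists_norm_mode_le (n : ℕ) : ∃ C : ℝ, 1 ≤ C ∧ ∀ v : Eucl n, 1 + ‖mode v‖ ≤ C * (1 + ‖v‖) := by
  refine ⟨1 + 2 * Real.pi * ‖(ofEucl n : Eucl n →L[ℝ] (Fin n → Mink))‖, ?_, fun v => ?_⟩
  · have : 0 ≤ 2 * Real.pi * ‖(ofEucl n : Eucl n →L[ℝ] (Fin n → Mink))‖ := by positivity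
    linarith
  · have h1 : ‖mode v‖ ≤ 2 * Real.pi * ‖(ofEucl n : Eucl n →L[ℝ] (Fin n → Mink))‖ * ‖v‖ := by
      rw [mode, norm_smul, norm_neg, Real.norm_of_nonneg (by positivity), mul_assoc (2 * Real.pi)]
      gcongr
      exact (ofEucl n : Eucl n →L[ℝ] (Fin n → Mink)).le_opNorm v
    have h2 : 0 ≤ 2 * Real.pi * ‖(ofEucl n : Eucl n →L[ℝ] (Fin n → Mink))‖ := by positivity
    nlinarith [norm_nonneg v]

theorem contDiff_comp_ofEucl (hφ : ContDiff ℝ ∞ φ) :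
    ContDiff ℝ ∞ fun y : Eucl n => φ (ofEucl n y) := hφ.comp (ofEucl n).contDiff

theorem hasCompactSupport_comp_ofEucl (hs : HasCompactSupport φ) :
    HasCompactSupport fun y : Eucl n => φ (ofEucl n y) :=
  hs.comp_homeomorph (ofEucl n).toHomeomorph

theorem continuous_fourierCoeff (hφ : ContDiff ℝ ∞ φ) (hs : HasCompactSupport φ) :
    Continuous (fourierCoeff φ) :=
  (𝓕 ((hasCompactSupport_comp_ofEucl hs).toSchwartzMap (contDiff_comp_ofEucl hφ))).continuous

theorem integral_fourierCoeff (hφ : ContDiff ℝ ∞ φ) (hs : HasCompactSupport φ) (x : Fin n → Mink) :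
    ∫ v, fourierCoeff φ v * planeWave (mode v) x = φ x := by
  let g := (hasCompactSupport_comp_ofEucl hs).toSchwartzMap (contDiff_comp_ofEucl hφ)
  have hi : Integrable (fun y : Eucl n => φ (ofEucl n y)) volume := g.integrable (μ := volume)
  have hi' : Integrable (𝓕 (fun y : Eucl n => φ (ofEucl n y))) volume :=
    (𝓕 g : SchwartzMap (Eucl n) ℂ).integrable (μ := volume)
  have h1 : 𝓕⁻ (𝓕 (fun y : Eucl n => φ (ofEucl n y))) ((ofEucl n).symm x) = φ x := by
    rw [Continuous.fourierInv_fourier_eq (contDiff_comp_ofEucl hφ).continuous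
      hi hi']
    simp
  rw [← h1, Real.fourierInv_eq']
  refine integral_congr_ae (Filter.Eventually.of_forall fun v => ?_)
  simp only [fourierCoeff, planeWave, covPair_mode, smul_eq_mul]
  rw [mul_comm]
  congr 2
  push_cast; ring

/-- What matters is that `C` does not depend on `φ`: with the support confined to `K`, the integrals
of the derivatives are at most the volume times the jet bound. -/
theorem pow_mul_norm_fourierCoeff_le (M : ℕ) {K : Set (Fin n → Mink)} (hK : IsCompact K) :
    ∃ C : ℝ, 0 ≤ C ∧ ∀ (φ : (Fin n → Mink) → ℂ) (b : ℝ), 0 ≤ b → ContDiff ℝ ∞ φ → tsupport φ ⊆ K →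
      JetBound M K φ b → ∀ v, ‖v‖ ^ M * ‖fourierCoeff φ v‖ ≤ C * b := by
  let T : Eucl n →L[ℝ] (Fin n → Mink) := ofEucl n
  let K' : Set (Eucl n) := ofEucl n ⁻¹' K
  have hK' : IsCompact K' := (ofEucl n).toHomeomorph.isCompact_preimage.2 hK
  refine ⟨2 ^ M * ∑ _p ∈ Finset.range 1 ×ˢ Finset.range (M + 1),
    max 1 ‖T‖ ^ M * volume.real K', by positivity, fun φ b hb hφ hsupp hj v => ?_⟩
  have hs : HasCompactSupport φ := hK.of_isClosed_subset (isClosed_tsupport φ) hsupp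
  let g := (hasCompactSupport_comp_ofEucl hs).toSchwartzMap (contDiff_comp_ofEucl hφ)
  have h1 := Real.pow_mul_norm_iteratedFDeriv_fourier_le (K := ⊤) (N := ⊤) (k := 0) (n := M)
    (f := g) (g.smooth ⊤) (fun k n _ _ => g.integrable_pow_mul_iteratedFDeriv volume k n)
    (by simp) (by exact_mod_cast le_top) v
  simp only [pow_zero, norm_iteratedFDeriv_zero, CharP.cast_eq_zero, mul_zero, zero_add, one_mul]
    at h1
  refine h1.trans ?_
  rw [mul_assoc, Finset.sum_mul]
  gcongr with p hp
  rw [Finset.mem_product, Finset.mem_range, Finset.mem_range] at hp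
  have hp1 : p.1 = 0 := by omega
  simp only [hp1, pow_zero, one_mul]
  have hjet : JetBound M K' (fun y => φ (T y)) (max 1 ‖T‖ ^ M * b) :=
    JetBound.comp_clm T hφ (hj.mono le_rfl (by rintro _ ⟨y, hy, rfl⟩; exact hy) le_rfl)
  have hzero : ∀ y ∉ K', ‖iteratedFDeriv ℝ p.2 g y‖ = 0 := by
    intro y hy
    rw [norm_eq_zero]
    by_contra hne
    have h2 : y ∈ tsupport g := support_iteratedFDeriv_subset (𝕜 := ℝ) p.2 hne
    refine hy (hsupp ?_)
    exact tsupport_comp_subset_preimage (f := ofEucl n) φ (ofEucl n).continuous h2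
  rw [← setIntegral_eq_integral_of_forall_compl_eq_zero hzero]
  have h3 := norm_setIntegral_le_of_norm_le_const (μ := volume) (s := K')
    (f := fun y => ‖iteratedFDeriv ℝ p.2 g y‖) (C := max 1 ‖T‖ ^ M * b) hK'.measure_lt_top
    fun y hy => by
      rw [norm_norm]
      exact hjet p.2 (by omega) y hy
  refine (le_abs_self _).trans (h3.trans_eq (by ring))

theorem exists_fourierCoeff_bound (M : ℕ) {K : Set (Fin n → Mink)} (hK : IsCompact K) :
    ∃ C : ℝ, 0 ≤ C ∧ ∀ (φ : (Fin n → Mink) → ℂ) (b : ℝ), 0 ≤ b → ContDiff ℝ ∞ φ → tsupport φ ⊆ K →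
      JetBound M K φ b → ∀ v, (1 + ‖v‖) ^ M * ‖fourierCoeff φ v‖ ≤ C * b := by
  obtain ⟨C0, hC0, h0⟩ := pow_mul_norm_fourierCoeff_le 0 hK
  obtain ⟨C1, hC1, h1⟩ := pow_mul_norm_fourierCoeff_le M hK
  refine ⟨2 ^ (M - 1) * (C0 + C1), by positivity, fun φ b hb hφ hs hj v => ?_⟩
  have h2 := h0 φ b hb hφ hs (hj.mono (Nat.zero_le _) subset_rfl le_rfl) v
  have h3 := h1 φ b hb hφ hs hj v
  have h4 := _root_.add_pow_le (zero_le_one) (norm_nonneg v) M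
  rw [pow_zero, one_mul] at h2
  calc (1 + ‖v‖) ^ M * ‖fourierCoeff φ v‖
      ≤ (2 ^ (M - 1) * (1 ^ M + ‖v‖ ^ M)) * ‖fourierCoeff φ v‖ := by gcongr
    _ = 2 ^ (M - 1) * (‖fourierCoeff φ v‖ + ‖v‖ ^ M * ‖fourierCoeff φ v‖) := by
      rw [one_pow]; ring
    _ ≤ 2 ^ (M - 1) * (C0 * b + C1 * b) := by gcongr
    _ = _ := by ring

theorem integrable_one_add_norm_pow_inv (n : ℕ) : ∃ d : ℕ,
    Integrable (fun v : Eucl n => ((1 + ‖v‖) ^ d)⁻¹) := by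
  refine ⟨Module.finrank ℝ (Eucl n) + 1, ?_⟩
  have := integrable_one_add_norm (E := Eucl n) (μ := volume)
    (r := (Module.finrank ℝ (Eucl n) + 1 : ℕ)) (by push_cast; linarith)
  refine this.congr (Filter.Eventually.of_forall fun v => ?_)
  simp only [Real.rpow_neg (by positivity : (0 : ℝ) ≤ 1 + ‖v‖), Real.rpow_natCast]

/-- Fourier expansion under a distribution with compact support. -/
theorem IsCompactDistribution.apply_mul_eq_integral {u : ((Fin n → Mink) → ℂ) → ℂ}
    (hu : IsCompactDistribution u) {ρ : (Fin n → Mink) → ℂ} (hρ : ContDiff ℝ ∞ ρ)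
    (hφ : ContDiff ℝ ∞ φ) (hs : HasCompactSupport φ) :
    u (fun x => ρ x * φ x) =
      ∫ v, fourierCoeff φ v * u (fun x => ρ x * planeWave (mode v) x) := by
  have hsm : ContDiff ℝ ∞ fun z : (Fin n → Mink) × (Fin n → Mink) => ρ z.2 * planeWave z.1 z.2 :=
    (hρ.comp contDiff_snd).mul contDiff_planeWave_prod
  let G : Eucl n → smoothFunctions (Fin n → Mink) := fun v =>
    fourierCoeff φ v • sectionAt hsm (mode v)
  have hm : JetMeasurable G volume :=
    (jetMeasurable_sectionAt hsm continuous_mode.measurable).const_mul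
      (continuous_fourierCoeff hφ hs).aestronglyMeasurable
  have hd : JetDominated G volume := by
    intro m K hK
    obtain ⟨d, hd⟩ := integrable_one_add_norm_pow_inv n
    obtain ⟨a, ha, haj⟩ := exists_jetBound m hK hρ
    -- Decay of order `m + d`: the `m` powers beat the growth of the derivatives of the plane wave,
    -- and the other `d` leave an integrable weight.
    obtain ⟨b, hb, hbj⟩ := exists_jetBound (m + d) hs hφ
    obtain ⟨C, hC, h⟩ := exists_fourierCoeff_bound (m + d) (K := tsupport φ) hs
    obtain ⟨D, hD1, hD⟩ := exists_norm_mode_le n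
    refine ⟨fun v => (2 ^ m * (a * ((1 + 2 * n) ^ m * D ^ m)) * (C * b)) * ((1 + ‖v‖) ^ d)⁻¹,
      hd.const_mul _, Filter.Eventually.of_forall fun v j hj x hx => ?_⟩
    have h1 : ‖iteratedFDeriv ℝ j (fun x => ρ x * planeWave (mode v) x) x‖ ≤ _ :=
      JetBound.mul ha hρ (contDiff_planeWave (mode v)) haj
        (jetBound_planeWave m K (mode v)) j hj x hx
    have h2 : ‖iteratedFDeriv ℝ j (G v).1 x‖ =
        ‖fourierCoeff φ v‖ * ‖iteratedFDeriv ℝ j (fun x => ρ x * planeWave (mode v) x) x‖ := by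
      rw [← norm_smul]
      exact congrArg norm (iteratedFDeriv_const_smul_apply (a := fourierCoeff φ v)
        ((hρ.mul (contDiff_planeWave (mode v))).of_le (by exact_mod_cast le_top)).contDiffAt)
    rw [h2]
    have h3 := h φ b hb hφ subset_rfl hbj v
    have h4 : (1 + ‖mode v‖) ^ m ≤ D ^ m * (1 + ‖v‖) ^ m := by
      rw [← mul_pow]; exact pow_le_pow_left₀ (by positivity) (hD v) m
    beta_reduce
    rw [← div_eq_mul_inv, le_div_iff₀ (by positivity)]
    calc ‖fourierCoeff φ v‖ * ‖iteratedFDeriv ℝ j (fun x => ρ x * planeWave (mode v) x) x‖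
          * (1 + ‖v‖) ^ d
        ≤ ‖fourierCoeff φ v‖ * (2 ^ m * (a * ((1 + 2 * n) ^ m * (D ^ m * (1 + ‖v‖) ^ m))))
          * (1 + ‖v‖) ^ d := by
          gcongr
          refine h1.trans ?_
          gcongr
      _ = (2 ^ m * (a * ((1 + 2 * n) ^ m * D ^ m))) *
          ((1 + ‖v‖) ^ (m + d) * ‖fourierCoeff φ v‖) := by rw [pow_add]; ring
      _ ≤ _ := by gcongr
  have key := hu.apply_integral hm hd
  have h5 : (fun x => ∫ v, (G v).1 x) = fun x => ρ x * φ x := by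
    ext x
    rw [← integral_fourierCoeff hφ hs x, ← integral_const_mul]
    refine integral_congr_ae (Filter.Eventually.of_forall fun v => ?_)
    change fourierCoeff φ v * (ρ x * planeWave (mode v) x) = _
    ring
  rw [h5] at key
  rw [key]
  refine integral_congr_ae (Filter.Eventually.of_forall fun v => ?_)
  exact hu.map_smul _ _ (hρ.mul (contDiff_planeWave (mode v)))

/-- A distribution with compact support is determined by its values on plane waves. -/
theorem IsCompactDistribution.ext_planeWave {u v : ((Fin n → Mink) → ℂ) → ℂ}
    (hu : IsCompactDistribution u) (hv : IsCompactDistribution v)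
    (h : ∀ k, u (planeWave k) = v (planeWave k)) (hφ : ContDiff ℝ ∞ φ) : u φ = v φ := by
  obtain ⟨K, hK, hKu⟩ := hu.exists_congr
  obtain ⟨K', hK', hKv⟩ := hv.exists_congr
  -- A common cutoff changes neither value and makes Fourier inversion available for `φ`.
  obtain ⟨χ, hχ, hχs, hχ1, -, -⟩ := exists_cutoff (hK.union hK') isOpen_univ (Set.subset_univ _)
  have hχc : ContDiff ℝ ∞ fun x => (χ x : ℂ) := Complex.ofRealCLM.contDiff.comp hχ
  have hsm : ContDiff ℝ ∞ fun x => (χ x : ℂ) * φ x := hχc.mul hφ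
  have hsupp : HasCompactSupport fun x => (χ x : ℂ) * φ x :=
    (hχs.comp_left (g := fun r : ℝ => (r : ℂ)) Complex.ofReal_zero).mul_right
  have hloc : ∀ x ∈ K ∪ K', φ =ᶠ[nhds x] fun x => (χ x : ℂ) * φ x := fun x hx => by
    filter_upwards [hχ1 x hx] with y hy
    simp [hy]
  have h1 := hu.apply_mul_eq_integral (ρ := fun _ => 1) contDiff_const hsm hsupp
  have h2 := hv.apply_mul_eq_integral (ρ := fun _ => 1) contDiff_const hsm hsupp
  simp only [one_mul] at h1 h2
  rw [hKu _ _ hφ hsm fun x hx => hloc x (Or.inl hx), hKv _ _ hφ hsm fun x hx => hloc x (Or.inr hx),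
    h1, h2]
  simp_rw [h]

end Fourier

/-! ### From wave front sets to rapid decay on closed cones, uniform in smooth multipliers. -/

section RapidDecay

open MeasureTheory

variable {n : ℕ}

/-- The products of `u` with smooth functions have Fourier transforms which decay rapidly on `Λ`,
uniformly in finitely many derivatives of the smooth function. -/
def RapidDecayOn (Λ : Set (Fin n → Mink)) (u : ((Fin n → Mink) → ℂ) → ℂ) : Prop :=
  ∀ N : ℕ, ∃ K : Set (Fin n → Mink), IsCompact K ∧ ∃ (m : ℕ) (C : ℝ), 0 ≤ C ∧
    ∀ s : (Fin n → Mink) → ℂ, ContDiff ℝ ∞ s → ∀ b : ℝ, 0 ≤ b → JetBound m K s b →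
      ∀ k ∈ Λ, (1 + ‖k‖) ^ N * ‖u (fun x => planeWave k x * s x)‖ ≤ C * b

variable {Λ Λ' : Set (Fin n → Mink)} {u v : ((Fin n → Mink) → ℂ) → ℂ}

theorem RapidDecayOn.mono (h : RapidDecayOn Λ u) (hΛ : Λ' ⊆ Λ) : RapidDecayOn Λ' u := fun N => by
  obtain ⟨K, hK, m, C, hC, h'⟩ := h N
  exact ⟨K, hK, m, C, hC, fun s hs b hb hj k hk => h' s hs b hb hj k (hΛ hk)⟩

theorem RapidDecayOn.union (h : RapidDecayOn Λ u) (h' : RapidDecayOn Λ' u) :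
    RapidDecayOn (Λ ∪ Λ') u := fun N => by
  obtain ⟨K, hK, m, C, hC, h1⟩ := h N
  obtain ⟨K', hK', m', C', hC', h2⟩ := h' N
  refine ⟨K ∪ K', hK.union hK', max m m', C + C', by positivity, fun s hs b hb hj k hk => ?_⟩
  rw [add_mul]
  rcases hk with hk | hk
  · exact (h1 s hs b hb (hj.mono (le_max_left _ _) Set.subset_union_left le_rfl) k hk).trans
      (le_add_of_nonneg_right (by positivity))
  · exact (h2 s hs b hb (hj.mono (le_max_right _ _) Set.subset_union_right le_rfl) k hk).trans
      (le_add_of_nonneg_left (by positivity))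

theorem RapidDecayOn.add (h : RapidDecayOn Λ u) (h' : RapidDecayOn Λ v) :
    RapidDecayOn Λ (fun f => u f + v f) := fun N => by
  obtain ⟨K, hK, m, C, hC, h1⟩ := h N
  obtain ⟨K', hK', m', C', hC', h2⟩ := h' N
  refine ⟨K ∪ K', hK.union hK', max m m', C + C', by positivity, fun s hs b hb hj k hk => ?_⟩
  have h3 := h1 s hs b hb (hj.mono (le_max_left _ _) Set.subset_union_left le_rfl) k hk
  have h4 := h2 s hs b hb (hj.mono (le_max_right _ _) Set.subset_union_right le_rfl) k hk
  calc _ ≤ (1 + ‖k‖) ^ N * (‖u (fun x => planeWave k x * s x)‖ +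
        ‖v (fun x => planeWave k x * s x)‖) := by
        gcongr; exact norm_add_le _ _
    _ ≤ _ := by rw [mul_add, add_mul]; exact add_le_add h3 h4

/-- The factor `g` is absorbed into the test function `s`; this is how localizers get multiplied or
divided out. -/
theorem RapidDecayOn.mul {χ g : (Fin n → Mink) → ℂ} (hg : ContDiff ℝ ∞ g)
    (h : RapidDecayOn Λ fun f => u fun x => χ x * f x) :
    RapidDecayOn Λ fun f => u fun x => (χ x * g x) * f x := fun N => by
  obtain ⟨K, hK, m, C, hC, h1⟩ := h N
  obtain ⟨a, ha, haj⟩ := exists_jetBound m hK hg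
  refine ⟨K, hK, m, C * (2 ^ m * a), by positivity, fun s hs b hb hj k hk => ?_⟩
  have := h1 _ (hg.mul hs) _ (by positivity) (JetBound.mul ha hg hs haj hj) k hk
  have he : (fun x => (χ x * g x) * (planeWave k x * s x)) =
      fun x => χ x * (planeWave k x * (g x * s x)) := by
    ext x; ring
  beta_reduce at this ⊢
  rw [he]
  exact this.trans_eq (by ring)

theorem IsCompactDistribution.exists_planeWave_bound (hu : IsCompactDistribution u)  :
    ∃ (m : ℕ) (C : ℝ), 0 ≤ C ∧ ∀ k, ‖u (planeWave k)‖ ≤ C * (1 + ‖k‖) ^ m := by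
  obtain ⟨K, hK, m, C, hC, h⟩ := hu.exists_bound
  refine ⟨m, C * (1 + 2 * n) ^ m, by positivity, fun k => ?_⟩
  rw [mul_assoc]
  exact h _ (contDiff_planeWave k) _ (by positivity) (jetBound_planeWave m K k)

/-- Wave front sets say nothing about the covector `0`, which lies in the closed cones considered;
there the estimate is just continuity of `u`. -/
theorem IsCompactDistribution.rapidDecayOn_zero (hu : IsCompactDistribution u) :
    RapidDecayOn {0} u := fun N => by
  obtain ⟨K, hK, m, C, hC, h⟩ := hu.exists_bound
  refine ⟨K, hK, m, C, hC, fun s hs b hb hj k hk => ?_⟩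
  rw [Set.mem_singleton_iff.1 hk]
  have : (fun x => planeWave (0 : Fin n → Mink) x * s x) = s := by
    ext x; simp [planeWave, covPair]
  rw [this]
  simpa using h s hs b hb hj

/-- The cone generated by a set. -/
def coneOf (T : Set (Fin n → Mink)) : Set (Fin n → Mink) := {k | ∃ t : ℝ, 0 < t ∧ t • k ∈ T}

/-- Two regimes. If `η` is small relative to `k`, then `k + η` stays in `Γ`, and
$1+\|k\|\le(1+\|k+\eta\|)(1+\|\eta\|)$ transfers the decay at a cost in powers of `η`. Otherwise `k`
is bounded by a multiple of `η`, and the polynomial bound on `F` suffices. -/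
theorem shifted_decay {F : (Fin n → Mink) → ℂ} {m : ℕ} {C₀ CN : ℝ} (hC₀ : 0 ≤ C₀)
    {Γ : Set (Fin n → Mink)} {N : ℕ}
    (hF : ∀ k, ‖F k‖ ≤ C₀ * (1 + ‖k‖) ^ m) (hCN : 0 ≤ CN)
    (hΓ : ∀ k ∈ Γ, (1 + ‖k‖) ^ N * ‖F k‖ ≤ CN) {k : Fin n → Mink} {c : ℝ} (hc : 0 < c)
    (hk : ∀ η, ‖η‖ ≤ c * ‖k‖ → k + η ∈ Γ) (η : Fin n → Mink) :
    (1 + ‖k‖) ^ N * ‖F (k + η)‖ ≤ (CN + C₀ * (1 + c⁻¹) ^ (m + N)) * (1 + ‖η‖) ^ (2 * m + N) := by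
  have hη : 1 ≤ 1 + ‖η‖ := by linarith [norm_nonneg η]
  have hc' : 0 < c⁻¹ := inv_pos.2 hc
  by_cases h : ‖η‖ ≤ c * ‖k‖
  · have h1 : 1 + ‖k‖ ≤ (1 + ‖k + η‖) * (1 + ‖η‖) := by
      have : ‖k‖ ≤ ‖k + η‖ + ‖η‖ := by simpa using norm_sub_le (k + η) η
      nlinarith [norm_nonneg (k + η), norm_nonneg η]
    calc (1 + ‖k‖) ^ N * ‖F (k + η)‖
        ≤ ((1 + ‖k + η‖) * (1 + ‖η‖)) ^ N * ‖F (k + η)‖ := by gcongr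
      _ = ((1 + ‖k + η‖) ^ N * ‖F (k + η)‖) * (1 + ‖η‖) ^ N := by rw [mul_pow]; ring
      _ ≤ (CN + C₀ * (1 + c⁻¹) ^ (m + N)) * (1 + ‖η‖) ^ (2 * m + N) := by
        gcongr
        · exact (hΓ _ (hk η h)).trans (le_add_of_nonneg_right (by positivity))
        · omega
  · push Not at h
    have h1 : 1 + ‖k‖ ≤ (1 + c⁻¹) * (1 + ‖η‖) := by
      have : ‖k‖ ≤ c⁻¹ * ‖η‖ := by
        rw [← div_eq_inv_mul, le_div_iff₀ hc]; linarith
      nlinarith [norm_nonneg η]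
    have h2 : 1 + ‖k + η‖ ≤ ((1 + c⁻¹) * (1 + ‖η‖)) * (1 + ‖η‖) := by
      have h3 : 1 + ‖k + η‖ ≤ (1 + ‖k‖) * (1 + ‖η‖) := by
        nlinarith [norm_add_le k η, norm_nonneg η, norm_nonneg k,
          mul_nonneg (norm_nonneg k) (norm_nonneg η)]
      exact h3.trans (by gcongr)
    calc (1 + ‖k‖) ^ N * ‖F (k + η)‖
        ≤ ((1 + c⁻¹) * (1 + ‖η‖)) ^ N * (C₀ * (((1 + c⁻¹) * (1 + ‖η‖)) * (1 + ‖η‖)) ^ m) := by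
          gcongr
          exact (hF _).trans (by gcongr)
      _ = (C₀ * (1 + c⁻¹) ^ (m + N)) * (1 + ‖η‖) ^ (2 * m + N) := by
          rw [mul_pow, mul_pow, mul_pow, pow_add, pow_add, pow_mul']
          ring
      _ ≤ _ := by gcongr; exact le_add_of_nonneg_left hCN

/-- Rapid decay in a cone, of the Fourier transform of a localized distribution, persists in a
smaller cone after multiplication with smooth functions. -/
theorem IsCompactDistribution.exists_rapidDecayOn (hu : IsCompactDistribution u)
    {χ : (Fin n → Mink) → ℂ} (hχ : ContDiff ℝ ∞ χ) (hχs : HasCompactSupport χ)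
    {Γ : Set (Fin n → Mink)} (hΓo : IsOpen Γ) {ξ : Fin n → Mink} (hξ : ξ ∈ Γ) (hξ0 : ξ ≠ 0)
    (hΓc : ∀ ξ ∈ Γ, ∀ s : ℝ, 0 < s → s • ξ ∈ Γ)
    (hdec : ∀ N : ℕ, ∃ C : ℝ, ∀ ξ ∈ Γ, (1 + ‖ξ‖) ^ N * ‖localFourier u χ ξ‖ ≤ C) :
    ∃ T : Set (Fin n → Mink), T ∈ nhds ξ ∧
      RapidDecayOn (coneOf T) fun f => u fun x => χ x * f x := by
  obtain ⟨r, hr, hball⟩ := Metric.isOpen_iff.1 hΓo ξ hξ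
  refine ⟨Metric.ball ξ (r / 2), Metric.ball_mem_nhds _ (by positivity), fun N => ?_⟩
  set R := ‖ξ‖ + r / 2 with hR
  have hRpos : 0 < R := by positivity
  -- Halving the radius leaves room: a perturbation of relative size `r / 2 / R` does not leave `Γ`.
  have hcone : ∀ k ∈ coneOf (Metric.ball ξ (r / 2)), ∀ η, ‖η‖ ≤ r / 2 / R * ‖k‖ → k + η ∈ Γ := by
    rintro k ⟨t, ht, hk⟩ η hη
    have hk' : ‖t • k - ξ‖ < r / 2 := by rwa [← dist_eq_norm]
    have h1 : ‖t • k‖ ≤ R := by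
      have := norm_add_le (t • k - ξ) ξ
      rw [sub_add_cancel] at this
      linarith
    have h2 : ‖t • η‖ ≤ r / 2 := by
      rw [norm_smul, Real.norm_of_nonneg ht.le] at h1 ⊢
      calc t * ‖η‖ ≤ t * (r / 2 / R * ‖k‖) := by gcongr
        _ = r / 2 / R * (t * ‖k‖) := by ring
        _ ≤ r / 2 / R * R := by gcongr
        _ = r / 2 := by field_simp
    have h3 : t • (k + η) ∈ Γ := by
      apply hball
      rw [Metric.mem_ball, dist_eq_norm, smul_add]
      calc ‖t • k + t • η - ξ‖ = ‖(t • k - ξ) + t • η‖ := by congr 1; abel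
        _ ≤ ‖t • k - ξ‖ + ‖t • η‖ := norm_add_le _ _
        _ < r := by linarith
    have h4 := hΓc _ h3 t⁻¹ (inv_pos.2 ht)
    rwa [smul_smul, inv_mul_cancel₀ ht.ne', one_smul] at h4
  obtain ⟨m₀, C₀, hC₀, hF⟩ := (hu.mul hχ).exists_planeWave_bound
  obtain ⟨CN, hCN⟩ := hdec N
  have hCN' : ∀ k ∈ Γ, (1 + ‖k‖) ^ N * ‖u (fun x => χ x * planeWave k x)‖ ≤ |CN| :=
    fun k hk => (hCN k hk).trans (le_abs_self _)
  set c := r / 2 / R with hc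
  have hcpos : 0 < c := by positivity
  set B := |CN| + C₀ * (1 + c⁻¹) ^ (m₀ + N)
  set M := 2 * m₀ + N
  have hB : 0 ≤ B := by positivity
  -- As `κ = 1` on the support of `χ`, the arbitrary smooth `s` can be replaced by the compactly
  -- supported `κ s`.
  obtain ⟨κ, hκ, hκs, hκ1, -, -⟩ := exists_cutoff hχs isOpen_univ (Set.subset_univ _)
  have hκc : ContDiff ℝ ∞ fun x => (κ x : ℂ) := Complex.ofRealCLM.contDiff.comp hκ
  have hκcs : HasCompactSupport fun x => (κ x : ℂ) :=
    hκs.comp_left (g := fun r : ℝ => (r : ℂ)) Complex.ofReal_zero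
  obtain ⟨d, hd⟩ := integrable_one_add_norm_pow_inv n
  obtain ⟨D, hD1, hD⟩ := exists_norm_mode_le n
  obtain ⟨C1, hC1, hcoef⟩ := exists_fourierCoeff_bound (M + d) (K := tsupport fun x => (κ x : ℂ)) hκcs
  obtain ⟨a, ha, haj⟩ := exists_jetBound (M + d) hκcs hκc
  have hI : 0 ≤ ∫ v : Eucl n, ((1 + ‖v‖) ^ d)⁻¹ := integral_nonneg fun v => by positivity
  refine ⟨_, hκcs, M + d, B * D ^ M * C1 * (2 ^ (M + d) * a) * ∫ v : Eucl n, ((1 + ‖v‖) ^ d)⁻¹,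
    by positivity, fun s hs b hb hj k hk => ?_⟩
  have hφ : ContDiff ℝ ∞ fun x => (κ x : ℂ) * s x := hκc.mul hs
  have hφs : HasCompactSupport fun x => (κ x : ℂ) * s x := hκcs.mul_right
  have hφj := JetBound.mul ha hκc hs haj hj
  have hbd := hcoef _ _ (by positivity) hφ (tsupport_mul_subset_left) hφj
  -- The Fourier transform of a product is a convolution: the value at `k` is an average of the
  -- values of the transform of `χ u` at `k + mode v`, weighted by the rapidly decreasing
  -- coefficients of `κ s`.
  have hrep := hu.apply_mul_eq_integral (hχ.mul (contDiff_planeWave k)) hφ hφs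
  have h1 : (fun x => χ x * planeWave k x * ((κ x : ℂ) * s x)) =
      fun x => χ x * (planeWave k x * s x) := by
    ext x
    by_cases hx : x ∈ tsupport χ
    · rw [(hκ1 x hx).self_of_nhds]; push_cast; ring
    · rw [image_eq_zero_of_notMem_tsupport hx]; ring
  rw [h1] at hrep
  beta_reduce
  rw [hrep]
  have h2 : (1 + ‖k‖) ^ N * ‖∫ v, fourierCoeff (fun x => (κ x : ℂ) * s x) v *
      u (fun x => χ x * planeWave k x * planeWave (mode v) x)‖ =
      ‖∫ v, ((1 + ‖k‖) ^ N : ℝ) • (fourierCoeff (fun x => (κ x : ℂ) * s x) v *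
      u (fun x => χ x * planeWave k x * planeWave (mode v) x))‖ := by
    rw [integral_smul, norm_smul, Real.norm_of_nonneg (by positivity)]
  rw [h2]
  refine (norm_integral_le_of_norm_le
    (hd.const_mul (B * D ^ M * (C1 * (2 ^ (M + d) * (a * b))))) (Filter.Eventually.of_forall
      fun v => ?_)).trans_eq ?_
  · have h3 : (fun x => χ x * planeWave k x * planeWave (mode v) x) =
        fun x => χ x * planeWave (k + mode v) x := by
      ext x; rw [planeWave_add]; ring
    rw [h3, norm_smul, norm_mul, Real.norm_of_nonneg (by positivity), ← div_eq_mul_inv,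
      le_div_iff₀ (by positivity)]
    have h4 := shifted_decay hC₀ hF (abs_nonneg CN) hCN' hcpos (hcone k hk) (mode v)
    have h5 : (1 + ‖mode v‖) ^ M ≤ D ^ M * (1 + ‖v‖) ^ M := by
      rw [← mul_pow]; exact pow_le_pow_left₀ (by positivity) (hD v) M
    calc (1 + ‖k‖) ^ N * (‖fourierCoeff (fun x => (κ x : ℂ) * s x) v‖ *
          ‖u fun x => χ x * planeWave (k + mode v) x‖) * (1 + ‖v‖) ^ d
        = ((1 + ‖k‖) ^ N * ‖u fun x => χ x * planeWave (k + mode v) x‖) *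
          (‖fourierCoeff (fun x => (κ x : ℂ) * s x) v‖ * (1 + ‖v‖) ^ d) := by ring
      _ ≤ (B * (D ^ M * (1 + ‖v‖) ^ M)) *
          (‖fourierCoeff (fun x => (κ x : ℂ) * s x) v‖ * (1 + ‖v‖) ^ d) := by
          refine mul_le_mul_of_nonneg_right (h4.trans ?_) (by positivity)
          gcongr
      _ = B * D ^ M * ((1 + ‖v‖) ^ (M + d) * ‖fourierCoeff (fun x => (κ x : ℂ) * s x) v‖) := by
          rw [pow_add]; ring
      _ ≤ _ := mul_le_mul_of_nonneg_left (hbd v) (by positivity)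
  · rw [integral_const_mul]; ring

theorem coneOf_union (T T' : Set (Fin n → Mink)) : coneOf (T ∪ T') = coneOf T ∪ coneOf T' := by
  ext k
  constructor
  · rintro ⟨t, ht, h | h⟩
    exacts [Or.inl ⟨t, ht, h⟩, Or.inr ⟨t, ht, h⟩]
  · rintro (⟨t, ht, h⟩ | ⟨t, ht, h⟩)
    exacts [⟨t, ht, Or.inl h⟩, ⟨t, ht, Or.inr h⟩]

theorem coneOf_mono {T T' : Set (Fin n → Mink)} (h : T ⊆ T') : coneOf T ⊆ coneOf T' :=
  fun _ ⟨t, ht, hk⟩ => ⟨t, ht, h hk⟩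

/-- A distribution decays rapidly, near each point, in the directions outside its wave front set. -/
theorem IsCompactDistribution.exists_localized_rapidDecayOn (hu : IsCompactDistribution u)
    (hΛ : IsClosed Λ) (x : Fin n → Mink) (hwf : ∀ ξ ∈ Λ, (x, ξ) ∉ waveFrontSet u) :
    ∃ χ : (Fin n → Mink) → ℂ, ContDiff ℝ ∞ χ ∧ χ x ≠ 0 ∧
      RapidDecayOn (coneOf (Metric.sphere 0 1 ∩ Λ)) fun f => u fun x => χ x * f x := by
  -- Compactness of the set of unit directions in `Λ`: for a union of cones, the product of the two
  -- localizers works.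
  refine ((isCompact_sphere (0 : Fin n → Mink) 1).inter_right hΛ).induction_on
    (p := fun T => ∃ χ : (Fin n → Mink) → ℂ, ContDiff ℝ ∞ χ ∧ χ x ≠ 0 ∧
      RapidDecayOn (coneOf T) fun f => u fun x => χ x * f x) ?_ ?_ ?_ ?_
  · refine ⟨fun _ => 1, contDiff_const, one_ne_zero, fun N => ⟨∅, isCompact_empty, 0, 0, le_rfl, ?_⟩⟩
    rintro s - b - - k ⟨t, -, hk⟩
    exact hk.elim
  · rintro S T hST ⟨χ, hχ, hx, h⟩
    exact ⟨χ, hχ, hx, h.mono (coneOf_mono hST)⟩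
  · rintro S T ⟨χ, hχ, hx, h⟩ ⟨χ', hχ', hx', h'⟩
    refine ⟨fun x => χ x * χ' x, hχ.mul hχ', mul_ne_zero hx hx', ?_⟩
    rw [coneOf_union]
    refine (h.mul hχ').union ?_
    convert h'.mul hχ using 4
    ring
  · rintro ξ ⟨hξ, hξΛ⟩
    have hξ0 : ξ ≠ 0 := by
      rintro rfl
      simp at hξ
    have h := hwf ξ hξΛ
    simp only [waveFrontSet, Set.mem_ofPred_eq, not_and, not_not] at h
    obtain ⟨χ, hχ, hχs, hx, Γ, hΓo, hξΓ, hΓc, hdec⟩ := h hξ0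
    obtain ⟨T, hT, hTd⟩ := hu.exists_rapidDecayOn hχ hχs hΓo hξΓ hξ0 hΓc hdec
    exact ⟨T, mem_nhdsWithin_of_mem_nhds hT, χ, hχ, hx, hTd⟩

/-- A distribution with compact support decays rapidly on closed cones which avoid its wave front
set. -/
theorem IsCompactDistribution.rapidDecayOn (hu : IsCompactDistribution u)
    (hΛ : IsClosed Λ) (hΛc : ∀ ξ ∈ Λ, ∀ t : ℝ, 0 < t → t • ξ ∈ Λ)
    (hwf : ∀ p ∈ waveFrontSet u, p.2 ∉ Λ) : RapidDecayOn Λ u := by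
  have hsub : Λ ⊆ {0} ∪ coneOf (Metric.sphere 0 1 ∩ Λ) := by
    intro k hk
    by_cases h0 : k = 0
    · exact Or.inl h0
    · have : 0 < ‖k‖⁻¹ := inv_pos.2 (norm_pos_iff.2 h0)
      refine Or.inr ⟨‖k‖⁻¹, this, ?_, hΛc k hk _ this⟩
      simp [norm_smul, h0]
  obtain ⟨K, hK, hcongr⟩ := hu.exists_congr
  -- A second compactness argument, now over base points in `K`: localizers add, so they are taken
  -- nonnegative to prevent cancellation.
  have hcover : ∃ θ : (Fin n → Mink) → ℝ, ContDiff ℝ ∞ θ ∧ (∀ x, 0 ≤ θ x) ∧ (∀ x ∈ K, 0 < θ x) ∧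
      RapidDecayOn Λ fun f => u fun x => (θ x : ℂ) * f x := by
    refine hK.induction_on (p := fun T => ∃ θ : (Fin n → Mink) → ℝ, ContDiff ℝ ∞ θ ∧
      (∀ x, 0 ≤ θ x) ∧ (∀ x ∈ T, 0 < θ x) ∧
      RapidDecayOn Λ fun f => u fun x => (θ x : ℂ) * f x) ?_ ?_ ?_ ?_
    · refine ⟨fun _ => 0, contDiff_const, fun _ => le_rfl, fun _ h => h.elim, fun N =>
        ⟨∅, isCompact_empty, 0, 0, le_rfl, fun s _ b _ _ k _ => ?_⟩⟩
      simp [hu.map_zero]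
    · rintro S T hST ⟨θ, hθ, h0, h1, h⟩
      exact ⟨θ, hθ, h0, fun x hx => h1 x (hST hx), h⟩
    · rintro S T ⟨θ, hθ, h0, h1, h⟩ ⟨θ', hθ', h0', h1', h'⟩
      refine ⟨fun x => θ x + θ' x, hθ.add hθ', fun x => add_nonneg (h0 x) (h0' x), ?_, ?_⟩
      · rintro x (hx | hx)
        · exact add_pos_of_pos_of_nonneg (h1 x hx) (h0' x)
        · exact add_pos_of_nonneg_of_pos (h0 x) (h1' x hx)
      · intro N
        obtain ⟨K, hK, m, C, hC, hd⟩ := (h.add h') N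
        refine ⟨K, hK, m, C, hC, fun s hs b hb hj k hk => ?_⟩
        convert hd s hs b hb hj k hk using 3
        have hθc : ContDiff ℝ ∞ fun x => (θ x : ℂ) := Complex.ofRealCLM.contDiff.comp hθ
        have hθc' : ContDiff ℝ ∞ fun x => (θ' x : ℂ) := Complex.ofRealCLM.contDiff.comp hθ'
        have hw := (contDiff_planeWave k).mul hs
        beta_reduce
        rw [← hu.map_add _ _ (hθc.mul hw) (hθc'.mul hw)]
        congr 1; ext x; simp only [Pi.add_apply]; push_cast; ring
    · intro x _
      obtain ⟨χ, hχ, hx, hd⟩ := hu.exists_localized_rapidDecayOn hΛ x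
        fun ξ hξ h => hwf _ h hξ
      have hconj : ContDiff ℝ ∞ fun x => (starRingEnd ℂ) (χ x) :=
        Complex.conjCLE.contDiff.comp hχ
      -- Replacing `χ` by $|\chi|^2=\chi\bar\chi$ gives a nonnegative localizer without losing the
      -- decay.
      have hθ : ContDiff ℝ ∞ fun x => Complex.normSq (χ x) := by
        have : ContDiff ℝ ∞ fun x => (χ x * (starRingEnd ℂ) (χ x)).re :=
          Complex.reCLM.contDiff.comp (hχ.mul hconj)
        simpa only [Complex.mul_conj, Complex.ofReal_re] using this
      have hpos : 0 < Complex.normSq (χ x) := Complex.normSq_pos.2 hx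
      refine ⟨{y | 0 < Complex.normSq (χ y)}, mem_nhdsWithin_of_mem_nhds
        ((isOpen_lt continuous_const hθ.continuous).mem_nhds hpos),
        _, hθ, fun y => Complex.normSq_nonneg _, fun y hy => hy, ?_⟩
      have := ((hu.mul hχ).rapidDecayOn_zero.union hd).mono hsub
      convert this.mul hconj using 4
      rw [Complex.mul_conj]
  obtain ⟨θ, hθ, hθ0, hθ1, hd⟩ := hcover
  -- The function `θ + (1 - κ)` is positive everywhere and equals `θ` near `K`, so `θ` can be
  -- divided out globally.
  obtain ⟨κ, hκ, -, hκ1, hκ0, hκI⟩ := exists_cutoff hK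
    (isOpen_lt continuous_const hθ.continuous) hθ1
  have hpos : ∀ x, 0 < θ x + (1 - κ x) := fun x => by
    by_cases hx : 0 < θ x
    · linarith [(hκI x).2]
    · rw [hκ0 x hx]; linarith [hθ0 x]
  have hg : ContDiff ℝ ∞ fun x => ((θ x + (1 - κ x))⁻¹ : ℂ) := by
    have : ContDiff ℝ ∞ fun x => (θ x + (1 - κ x))⁻¹ :=
      (hθ.add (contDiff_const.sub hκ)).inv fun x => (hpos x).ne'
    convert Complex.ofRealCLM.contDiff.comp this with x
    simp
  intro N
  obtain ⟨K', hK', m, C, hC, h⟩ := (hd.mul hg) N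
  refine ⟨K', hK', m, C, hC, fun s hs b hb hj k hk => ?_⟩
  convert h s hs b hb hj k hk using 3
  have hθc : ContDiff ℝ ∞ fun x => (θ x : ℂ) := Complex.ofRealCLM.contDiff.comp hθ
  have hw := (contDiff_planeWave k).mul hs
  refine hcongr _ _ hw ((hθc.mul hg).mul hw) fun x hx => ?_
  filter_upwards [hκ1 x hx] with y hy
  have h0 := (hpos y).ne'
  rw [hy, sub_self, add_zero] at h0
  rw [hy]
  have : (θ y : ℂ) ≠ 0 := by exact_mod_cast h0
  push_cast
  rw [sub_self, add_zero, mul_inv_cancel₀ this, one_mul]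

/-- The covectors whose components are all in the closed forward cone. -/
def forwardCovectors (n : ℕ) : Set (Fin n → Mink) := {k | ∀ i, k i ∈ forwardCone}

theorem isClosed_forwardCovectors : IsClosed (forwardCovectors n) := by
  have : forwardCovectors n = ⋂ i, {k | |(k i).2| ≤ (k i).1} := by
    ext k; simp [forwardCovectors, forwardCone]
  rw [this]
  exact isClosed_iInter fun i => isClosed_le (by fun_prop) (by fun_prop)

theorem smul_mem_forwardCovectors {k : Fin n → Mink} (hk : k ∈ forwardCovectors n) {t : ℝ}
    (ht : 0 < t) : t • k ∈ forwardCovectors n := fun i => by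
  have := hk i
  simp only [forwardCone, Set.mem_ofPred_eq, Pi.smul_apply, Prod.smul_fst, Prod.smul_snd,
    smul_eq_mul, abs_mul, abs_of_pos ht] at this ⊢
  gcongr

theorem isFunDeriv_funDeriv {F : Functional} (hF : HasFunDerivs F) (n : ℕ) (φ : Config) :
    IsFunDeriv F n φ (funDeriv F n φ) := by
  have h := hF.2 n φ
  rw [funDeriv, dif_pos h]
  exact h.choose_spec

/-- The covectors that $W$ presents to its left factor are of the form $(|p|,p)$, hence forward;
this is the decay needed against them. -/
theorem IsMicrocausal.rapidDecayOn {F : Functional} (hF : IsMicrocausal F) (n : ℕ) (φ : Config) :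
    RapidDecayOn (forwardCovectors n) (funDeriv F n φ) :=
  (isFunDeriv_funDeriv hF.1 n φ).1.rapidDecayOn isClosed_forwardCovectors
    (fun _ hξ _ ht => smul_mem_forwardCovectors hξ ht)
    fun p hp h => hF.2 n φ p hp (Or.inl h)

end RapidDecay

/-! ### Spectral representation of the regularized two-point function. -/

section Wightman

open MeasureTheory

theorem norm_cexp_sub_cexp_le {x y : ℂ} {r : ℝ} (hx : x.re ≤ r) (hy : y.re ≤ r) :
    ‖Complex.exp x - Complex.exp y‖ ≤ Real.exp r * ‖x - y‖ := by
  have hs : Convex ℝ {z : ℂ | z.re ≤ r} := convex_halfSpace_re_le r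
  refine hs.norm_image_sub_le_of_norm_hasDerivWithin_le (f := Complex.exp) (f' := Complex.exp)
    (fun z _ => (Complex.hasDerivAt_exp z).hasDerivWithinAt) (fun z hz => ?_) hy hx
  rw [Complex.norm_exp]
  exact Real.exp_le_exp.2 hz

/-- The integrand of Frullani's integral representation of the logarithm. -/
def frullani (a : ℂ) (p : ℝ) : ℂ := (Complex.exp (-p) - Complex.exp (-(p * a))) / p

/-- The numerator vanishes at `p = 0`; the mean value inequality for the exponential supplies a
factor `p` that cancels the denominator. -/
theorem norm_frullani_le {a : ℂ} {c p : ℝ} (hc : c ≤ a.re) (hc1 : c ≤ 1) (hp : 0 < p) :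
    ‖frullani a p‖ ≤ Real.exp (-c * p) * ‖a - 1‖ := by
  rw [frullani, norm_div, Complex.norm_real, Real.norm_of_nonneg hp.le, div_le_iff₀ hp]
  refine (norm_cexp_sub_cexp_le (r := -c * p) ?_ ?_).trans_eq ?_
  · simp; nlinarith
  · simp; nlinarith
  · have : (-(p : ℂ) - -(p * a)) = p * (a - 1) := by ring
    rw [this, norm_mul, Complex.norm_real, Real.norm_of_nonneg hp.le]
    ring

theorem measurable_frullani (a : ℂ) : Measurable (frullani a) := by
  unfold frullani
  fun_prop

theorem integrableOn_frullani {a : ℂ} (ha : 0 < a.re) : IntegrableOn (frullani a) (Set.Ioi 0) := by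
  have hc : 0 < min a.re 1 := lt_min ha one_pos
  refine Integrable.mono' ((exp_neg_integrableOn_Ioi 0 hc).mul_const ‖a - 1‖)
    (measurable_frullani a).aestronglyMeasurable ?_
  filter_upwards [ae_restrict_mem measurableSet_Ioi] with p hp
  exact norm_frullani_le (min_le_left _ _) (min_le_right _ _) hp

/-- The derivative of the integrand in `a` is $e^{-pa}$, whose integral is $1/a$. -/
theorem hasDerivAt_integral_frullani {a : ℂ} (ha : 0 < a.re) :
    HasDerivAt (fun a => ∫ p in Set.Ioi (0 : ℝ), frullani a p) a⁻¹ a := by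
  have hd : ∀ z : ℂ, ∀ p ∈ Set.Ioi (0 : ℝ), HasDerivAt (fun a => frullani a p)
      (Complex.exp (-z * p)) z := by
    intro z p hp
    have hp0 : (p : ℂ) ≠ 0 := by exact_mod_cast (ne_of_gt hp)
    have h1 : HasDerivAt (fun a : ℂ => -((p : ℂ) * a)) (-((p : ℂ) * 1)) z :=
      ((hasDerivAt_id z).const_mul (p : ℂ)).neg
    have h2 := ((h1.cexp.const_sub (Complex.exp (-p))).div_const (p : ℂ))
    refine HasDerivAt.congr_deriv h2 ?_
    rw [div_eq_iff hp0]
    ring_nf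
  have h := hasDerivAt_integral_of_dominated_loc_of_deriv_le (𝕜 := ℂ)
    (μ := volume.restrict (Set.Ioi (0 : ℝ))) (F := frullani)
    (F' := fun z p => Complex.exp (-z * p)) (x₀ := a)
    (bound := fun p => Real.exp (-(a.re / 2) * p))
    (Metric.ball_mem_nhds a (half_pos ha))
    (Filter.Eventually.of_forall fun z => (measurable_frullani z).aestronglyMeasurable)
    (integrableOn_frullani ha) (by fun_prop)
    (by
      filter_upwards [ae_restrict_mem measurableSet_Ioi] with p hp z hz
      rw [Complex.norm_exp]
      refine Real.exp_le_exp.2 ?_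
      have h1 : |z.re - a.re| < a.re / 2 := by
        rw [← Complex.sub_re]
        refine (Complex.abs_re_le_norm _).trans_lt ?_
        rwa [← dist_eq_norm]
      have h2 := (abs_lt.1 h1).1
      have hp' : 0 < p := hp
      simp
      nlinarith)
    (exp_neg_integrableOn_Ioi 0 (half_pos ha))
    (by
      filter_upwards [ae_restrict_mem measurableSet_Ioi] with p hp z _
      exact hd z p hp)
  have h3 := h.2
  rw [integral_exp_mul_complex_Ioi (by simpa using ha)] at h3
  refine h3.congr_deriv ?_
  rw [Complex.ofReal_zero, mul_zero, Complex.exp_zero, neg_div_neg_eq, one_div]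

/-- Frullani's integral representation of the logarithm. -/
theorem integral_frullani {a : ℂ} (ha : 0 < a.re) :
    ∫ p in Set.Ioi (0 : ℝ), frullani a p = Complex.log a := by
  have hs : Convex ℝ {z : ℂ | 0 < z.re} := convex_halfSpace_re_gt 0
  have ho : IsOpen {z : ℂ | 0 < z.re} := isOpen_lt continuous_const Complex.continuous_re
  have hd : ∀ z ∈ {z : ℂ | 0 < z.re}, HasDerivAt
      (fun a => (∫ p in Set.Ioi (0 : ℝ), frullani a p) - Complex.log a) 0 z := by
    intro z hz
    have := (hasDerivAt_integral_frullani hz).sub (Complex.hasDerivAt_log (Or.inl hz))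
    rwa [sub_self] at this
  -- Both functions have derivative $1/a$ on the convex right half-plane and vanish at `1`.
  have h := hs.norm_image_sub_le_of_norm_hasDerivWithin_le (C := 0)
    (fun z hz => (hd z hz).hasDerivWithinAt) (fun z _ => by simp)
    (show (1 : ℂ) ∈ {z : ℂ | 0 < z.re} by simp) (show a ∈ {z : ℂ | 0 < z.re} from ha)
  rw [zero_mul, norm_le_zero_iff] at h
  have h1 : ∫ p in Set.Ioi (0 : ℝ), frullani 1 p = 0 := by simp [frullani]
  rw [h1, Complex.log_one, sub_zero, sub_zero] at h
  exact sub_eq_zero.1 h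

/-- Light-cone factorization: $r^2-(t-i\varepsilon)^2=(\varepsilon+i(t-r))(\varepsilon+i(t+r))$.
Both factors lie in the right half-plane, so their arguments add up to less than $\pi$ in modulus
and the principal logarithm splits. -/
theorem wightman_eq {μ ε : ℝ} (hμ : 0 < μ) (hε : 0 < ε) (z : Mink) :
    wightman μ ε z = -(1 / (4 * (Real.pi : ℂ))) * (2 * Real.log μ +
      Complex.log (ε + Complex.I * (z.1 - z.2)) + Complex.log (ε + Complex.I * (z.1 + z.2))) := by
  have hA : 0 < (ε + Complex.I * (z.1 - z.2) : ℂ).re := by simpa using hε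
  have hB : 0 < (ε + Complex.I * (z.1 + z.2) : ℂ).re := by simpa using hε
  have hA0 : (ε + Complex.I * (z.1 - z.2) : ℂ) ≠ 0 := fun h => by simp [h] at hA
  have hB0 : (ε + Complex.I * (z.1 + z.2) : ℂ) ≠ 0 := fun h => by simp [h] at hB
  have h1 : (μ : ℂ) ^ 2 * ((z.2 : ℂ) ^ 2 - ((z.1 : ℂ) - Complex.I * (ε : ℂ)) ^ 2) =
      ((μ ^ 2 : ℝ) : ℂ) * ((ε + Complex.I * (z.1 - z.2)) * (ε + Complex.I * (z.1 + z.2))) := by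
    push_cast
    linear_combination (-(μ : ℂ) ^ 2 * (ε : ℂ) ^ 2 - (μ : ℂ) ^ 2 *
      ((z.1 : ℂ) ^ 2 - (z.2 : ℂ) ^ 2)) * Complex.I_sq
  have hargA := abs_lt.1 (Complex.abs_arg_lt_pi_div_two_iff.2 (Or.inl hA))
  have hargB := abs_lt.1 (Complex.abs_arg_lt_pi_div_two_iff.2 (Or.inl hB))
  rw [wightman, h1, Complex.log_ofReal_mul (by positivity) (mul_ne_zero hA0 hB0),
    Complex.log_mul hA0 hB0 ⟨by linarith [hargA.1, hargB.1], by linarith [hargA.2, hargB.2]⟩,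
    Real.log_pow]
  push_cast
  ring

theorem contDiff_wightman {μ ε : ℝ} (hμ : 0 < μ) (hε : 0 < ε) : ContDiff ℝ ∞ (wightman μ ε) := by
  have h : ∀ {g : Mink → ℂ}, ContDiff ℝ ∞ g → (∀ z, 0 < (g z).re) →
      ContDiff ℝ ∞ fun z => Complex.log (g z) := by
    intro g hg hpos
    refine contDiff_iff_contDiffAt.2 fun z => ?_
    exact ((Complex.contDiffAt_log (n := ∞) (x := g z) (Or.inl (hpos z))).restrict_scalars ℝ).comp z
      hg.contDiffAt
  have h1 : ContDiff ℝ ∞ fun z : Mink => (z.1 : ℂ) := Complex.ofRealCLM.contDiff.comp contDiff_fst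
  have h2 : ContDiff ℝ ∞ fun z : Mink => (z.2 : ℂ) := Complex.ofRealCLM.contDiff.comp contDiff_snd
  rw [funext (wightman_eq hμ hε)]
  refine contDiff_const.mul ((contDiff_const.add (h ?_ fun z => by simpa using hε)).add
    (h ?_ fun z => by simpa using hε))
  · exact contDiff_const.add (contDiff_const.mul (h1.sub h2))
  · exact contDiff_const.add (contDiff_const.mul (h1.add h2))

/-- The covector `(|p|, p)` on the massless shell. -/
def shell (p : ℝ) : Mink := (|p|, p)

/-- The amplitude of the plane wave with covector `(|p|, p)` in the two-point function. -/
def amplitude (ε p : ℝ) : ℂ := (1 / (4 * (Real.pi : ℂ))) * (Complex.exp (-(|p| * ε)) / |p|)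

/-- The infrared subtraction in the two-point function. -/
def subtraction (μ p : ℝ) : ℂ :=
  (1 / (4 * (Real.pi : ℂ))) * (Complex.exp (-|p|) / |p| + Real.log μ * Complex.exp (-|p|))

/-- The spectral representation of the two-point function. -/
def spectralKernel (μ ε p : ℝ) (z : Mink) : ℂ :=
  amplitude ε p * Complex.exp (-(Complex.I * ((|p| * z.1 + p * z.2 : ℝ) : ℂ))) - subtraction μ p

/-- Frullani's integral over `p > 0` gives the logarithm in $t+r$, and that over `p < 0` the one in
$t-r$. Each half-line also yields one $\log\mu$ from the term $\log\mu\,e^{-|p|}$ of the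
subtraction. -/
theorem integral_spectralKernel {μ ε : ℝ} (hμ : 0 < μ) (hε : 0 < ε) (z : Mink) :
    ∫ p, spectralKernel μ ε p z = wightman μ ε z := by
  let g : ℂ → ℝ → ℂ := fun a p => -(1 / (4 * (Real.pi : ℂ))) *
    (frullani a p + Real.log μ * Complex.exp (-1 * p))
  have hi : IntegrableOn (fun p : ℝ => Complex.exp (-1 * p)) (Set.Ioi 0) :=
    integrableOn_exp_mul_complex_Ioi (by simp) 0
  have hg : ∀ a : ℂ, 0 < a.re → IntegrableOn (g a) (Set.Ioi 0) := fun a ha =>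
    ((integrableOn_frullani ha).add (hi.const_mul _)).const_mul _
  have hgi : ∀ a : ℂ, 0 < a.re → ∫ p in Set.Ioi (0 : ℝ), g a p =
      -(1 / (4 * (Real.pi : ℂ))) * (Complex.log a + Real.log μ) := by
    intro a ha
    rw [integral_const_mul, integral_add (integrableOn_frullani ha) (hi.const_mul _),
      integral_frullani ha, integral_const_mul, integral_exp_mul_complex_Ioi (by simp)]
    simp
  have h1 : ∀ p ∈ Set.Ioi (0 : ℝ),
      spectralKernel μ ε p z = g (ε + Complex.I * (z.1 + z.2)) p := by
    intro p hp
    have hp' : 0 < p := hp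
    have he : Complex.exp (-(p * (ε + Complex.I * (z.1 + z.2)))) =
        Complex.exp (-(p * ε)) * Complex.exp (-(Complex.I * (p * z.1 + p * z.2))) := by
      rw [← Complex.exp_add]; congr 1; ring
    simp only [spectralKernel, amplitude, subtraction, g, frullani, abs_of_pos hp', he]
    push_cast
    rw [neg_one_mul]
    ring
  have h2 : ∀ p ∈ Set.Ioi (0 : ℝ),
      spectralKernel μ ε (-p) z = g (ε + Complex.I * (z.1 - z.2)) p := by
    intro p hp
    have hp' : 0 < p := hp
    have he : Complex.exp (-(p * (ε + Complex.I * (z.1 - z.2)))) =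
        Complex.exp (-(p * ε)) * Complex.exp (-(Complex.I * (p * z.1 + -p * z.2))) := by
      rw [← Complex.exp_add]; congr 1; ring
    simp only [spectralKernel, amplitude, subtraction, g, frullani, abs_neg, abs_of_pos hp', he]
    push_cast
    rw [neg_one_mul]
    ring
  have hA : 0 < (ε + Complex.I * (z.1 - z.2) : ℂ).re := by simpa using hε
  have hB : 0 < (ε + Complex.I * (z.1 + z.2) : ℂ).re := by simpa using hε
  have hr : IntegrableOn (fun p => spectralKernel μ ε p z) (Set.Ioi 0) :=
    (hg _ hB).congr_fun (fun p hp => (h1 p hp).symm) measurableSet_Ioi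
  have hl' : IntegrableOn (fun p => spectralKernel μ ε (-p) z) (Set.Ioi 0) :=
    (hg _ hA).congr_fun (fun p hp => (h2 p hp).symm) measurableSet_Ioi
  have hl : IntegrableOn (fun p => spectralKernel μ ε p z) (Set.Iic 0) := by
    rw [integrableOn_Iic_iff_integrableOn_Iio]
    have := IntegrableOn.comp_neg_Iio (c := 0) (f := fun p => spectralKernel μ ε (-p) z)
      (by simpa using hl')
    simpa using this
  have h3 := integral_comp_neg_Ioi 0 (fun p => spectralKernel μ ε p z)
  rw [neg_zero] at h3
  rw [← intervalIntegral.integral_Iic_add_Ioi hl hr, ← h3,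
    setIntegral_congr_fun measurableSet_Ioi h1, setIntegral_congr_fun measurableSet_Ioi h2,
    hgi _ hA, hgi _ hB, wightman_eq hμ hε]
  ring

/-- The profile of the spectral kernel, after removal of the plane wave. -/
def profile (μ ε p s : ℝ) : ℂ := amplitude ε p - subtraction μ p * Complex.exp (Complex.I * |p| * s)

theorem contDiff_profile (μ ε p : ℝ) : ContDiff ℝ ∞ (profile μ ε p) :=
  contDiff_const.sub (contDiff_const.mul (contDiff_const.mul Complex.ofRealCLM.contDiff).cexp)

theorem pow_mul_exp_neg_le (j : ℕ) {x c : ℝ} (hx : 0 ≤ x) (hc : 0 < c) :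
    x ^ j * Real.exp (-(c * x)) ≤ j.factorial / c ^ j := by
  have h := Real.pow_div_factorial_le_exp (c * x) (by positivity) j
  rw [div_le_iff₀ (by positivity), mul_pow] at h
  rw [le_div_iff₀ (by positivity), Real.exp_neg, mul_assoc, mul_comm, mul_assoc,
    inv_mul_le_iff₀ (Real.exp_pos _)]
  linarith

theorem norm_subtraction_le (μ p : ℝ) :
    ‖subtraction μ p‖ ≤ Real.exp (-|p|) / |p| + |Real.log μ| * Real.exp (-|p|) := by
  have hpi : ‖(1 / (4 * (Real.pi : ℂ)))‖ ≤ 1 := by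
    rw [norm_div, norm_mul, Complex.norm_real, Real.norm_of_nonneg Real.pi_pos.le]
    simp only [norm_one, Complex.norm_ofNat]
    rw [div_le_one (by positivity)]
    linarith [Real.pi_gt_three]
  rw [subtraction, norm_mul]
  refine (mul_le_of_le_one_left (norm_nonneg _) hpi).trans ((norm_add_le _ _).trans_eq ?_)
  rw [norm_div, norm_mul, Complex.norm_real, Complex.norm_real, Complex.norm_exp]
  simp

/-- The poles at `p = 0` of amplitude and subtraction cancel, uniformly in `ε`. The exponential
weight is kept because it gives integrability in `p` at fixed `ε`. -/
theorem norm_profile_le {μ ε p s R : ℝ} (hε : 0 < ε) (hε1 : ε ≤ 1) (hp : p ≠ 0) (hs : |s| ≤ R) :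
    ‖profile μ ε p s‖ ≤ (1 + R + |Real.log μ|) * Real.exp (-(|p| * ε / 2)) := by
  have hp' : 0 < |p| := abs_pos.2 hp
  have hpi : ‖(1 / (4 * (Real.pi : ℂ)))‖ ≤ 1 := by
    rw [norm_div, norm_mul, Complex.norm_real, Real.norm_of_nonneg Real.pi_pos.le]
    simp only [norm_one, Complex.norm_ofNat]
    rw [div_le_one (by positivity)]
    linarith [Real.pi_gt_three]
  have h1 : profile μ ε p s = (1 / (4 * (Real.pi : ℂ))) *
      ((Complex.exp (-(|p| * ε)) - Complex.exp (|p| * (Complex.I * s - 1))) / |p| -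
        Real.log μ * Complex.exp (|p| * (Complex.I * s - 1))) := by
    have he : Complex.exp (|p| * (Complex.I * s - 1)) =
        Complex.exp (-|p|) * Complex.exp (Complex.I * |p| * s) := by
      rw [← Complex.exp_add]; congr 1; ring
    rw [profile, amplitude, subtraction, he]
    ring
  have h2 : ‖Complex.exp (-(|p| * ε)) - Complex.exp (|p| * (Complex.I * s - 1))‖ ≤
      Real.exp (-(|p| * ε)) * (|p| * (1 + R)) := by
    refine (norm_cexp_sub_cexp_le (r := -(|p| * ε)) (by simp) (by simp; nlinarith)).trans ?_
    gcongr
    have h3 : (-(|p| * ε) - |p| * (Complex.I * s - 1) : ℂ) =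
        |p| * (((1 - ε : ℝ) : ℂ) - Complex.I * s) := by push_cast; ring
    rw [h3, norm_mul, Complex.norm_real, norm_abs_eq_norm, Real.norm_eq_abs]
    gcongr
    refine (norm_sub_le _ _).trans ?_
    rw [norm_mul, Complex.norm_I, one_mul, Complex.norm_real, Complex.norm_real, Real.norm_eq_abs,
      Real.norm_eq_abs, abs_of_nonneg (by linarith)]
    linarith
  have h4 : ‖Complex.exp (|p| * (Complex.I * s - 1))‖ = Real.exp (-|p|) := by
    rw [Complex.norm_exp]; simp
  have h5 : Real.exp (-(|p| * ε)) ≤ Real.exp (-(|p| * ε / 2)) :=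
    Real.exp_le_exp.2 (by nlinarith)
  have h6 : Real.exp (-|p|) ≤ Real.exp (-(|p| * ε / 2)) :=
    Real.exp_le_exp.2 (by nlinarith)
  have hR : 0 ≤ R := (abs_nonneg s).trans hs
  rw [h1, norm_mul]
  refine (mul_le_of_le_one_left (norm_nonneg _) hpi).trans ((norm_sub_le _ _).trans ?_)
  rw [norm_div, norm_mul, h4, Complex.norm_real, Complex.norm_real, norm_abs_eq_norm,
    Real.norm_eq_abs, Real.norm_eq_abs, add_mul]
  refine add_le_add ?_ (by gcongr)
  rw [div_le_iff₀ hp']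
  calc _ ≤ Real.exp (-(|p| * ε)) * (|p| * (1 + R)) := h2
    _ ≤ Real.exp (-(|p| * ε / 2)) * (|p| * (1 + R)) := by gcongr
    _ = _ := by ring

/-- Differentiation removes the amplitude, which is constant in `s`, and the resulting factor $|p|$
cancels the pole of the subtraction. Half of $e^{-|p|}$ absorbs the remaining powers of $|p|$; the
other half is below the stated weight since `ε ≤ 1`. -/
theorem norm_iteratedDeriv_succ_profile_le {μ ε p : ℝ} (hε1 : ε ≤ 1) (hp : p ≠ 0)
    (j : ℕ) (s : ℝ) : ‖iteratedDeriv (j + 1) (profile μ ε p) s‖ ≤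
      (j.factorial * 2 ^ j + |Real.log μ| * ((j + 1).factorial * 2 ^ (j + 1))) *
        Real.exp (-(|p| * ε / 2)) := by
  have hp' : 0 < |p| := abs_pos.2 hp
  have hd : deriv (profile μ ε p) = fun s : ℝ => -(subtraction μ p * (Complex.I * |p|)) *
      Complex.exp (Complex.I * |p| * s) := by
    ext s
    have h : HasDerivAt (profile μ ε p)
        (-(subtraction μ p * (Complex.exp (Complex.I * |p| * s) * (Complex.I * |p| * 1)))) s :=
      (((Complex.ofRealCLM.hasDerivAt.const_mul _).cexp).const_mul _).const_sub _
    rw [h.deriv]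
    ring
  rw [iteratedDeriv_succ', hd, iteratedDeriv_const_mul_field, iteratedDeriv_cexp_mul]
  have h1 : ‖-(subtraction μ p * (Complex.I * |p|)) *
      ((Complex.I * |p|) ^ j * Complex.exp (Complex.I * |p| * s))‖ =
        ‖subtraction μ p‖ * |p| ^ (j + 1) := by
    have : ‖Complex.exp (Complex.I * |p| * s)‖ = 1 := by rw [Complex.norm_exp]; simp
    rw [norm_mul, norm_neg, norm_mul, norm_mul, norm_mul, norm_pow, norm_mul, this, Complex.norm_I,
      Complex.norm_real, norm_abs_eq_norm, Real.norm_eq_abs]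
    ring
  rw [h1]
  have hexp : Real.exp (-|p|) = Real.exp (-(1 / 2 * |p|)) * Real.exp (-(1 / 2 * |p|)) := by
    rw [← Real.exp_add]; congr 1; ring
  have h2 : ∀ i : ℕ, |p| ^ i * Real.exp (-|p|) ≤
      (i.factorial * 2 ^ i) * Real.exp (-(|p| * ε / 2)) := by
    intro i
    have h3 := pow_mul_exp_neg_le i (abs_nonneg p) (c := 1 / 2) (by norm_num)
    rw [hexp, ← mul_assoc]
    refine mul_le_mul (h3.trans_eq ?_) (Real.exp_le_exp.2 (by nlinarith)) (Real.exp_pos _).le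
      (by positivity)
    rw [one_div, inv_pow, div_inv_eq_mul]
  calc ‖subtraction μ p‖ * |p| ^ (j + 1)
      ≤ (Real.exp (-|p|) / |p| + |Real.log μ| * Real.exp (-|p|)) * |p| ^ (j + 1) := by
        gcongr; exact norm_subtraction_le μ p
    _ = |p| ^ j * Real.exp (-|p|) + |Real.log μ| * (|p| ^ (j + 1) * Real.exp (-|p|)) := by
        rw [pow_succ]; field_simp
    _ ≤ _ := by
        rw [add_mul, mul_assoc |Real.log μ|]
        exact add_le_add (h2 j) (mul_le_mul_of_nonneg_left (h2 (j + 1)) (abs_nonneg _))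

theorem exists_iteratedDeriv_profile_bound (μ : ℝ) (m : ℕ) (R : ℝ) : ∃ C : ℝ, 0 ≤ C ∧
    ∀ ε p s : ℝ, 0 < ε → ε ≤ 1 → p ≠ 0 → |s| ≤ R → ∀ j ≤ m,
      ‖iteratedDeriv j (profile μ ε p) s‖ ≤ C * Real.exp (-(|p| * ε / 2)) := by
  let c : ℕ → ℝ := fun j => j.factorial * 2 ^ j + |Real.log μ| * ((j + 1).factorial * 2 ^ (j + 1))
  have hc : ∀ j, 0 ≤ c j := fun j => by positivity
  refine ⟨(1 + |R| + |Real.log μ|) + ∑ j ∈ Finset.range m, c j,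
    add_nonneg (by positivity) (Finset.sum_nonneg fun j _ => hc j),
    fun ε p s hε hε1 hp hs j hj => ?_⟩
  rcases j with _ | j
  · rw [iteratedDeriv_zero]
    refine (norm_profile_le hε hε1 hp (hs.trans (le_abs_self R))).trans ?_
    refine mul_le_mul_of_nonneg_right ?_ (Real.exp_pos _).le
    exact le_add_of_nonneg_right (Finset.sum_nonneg fun j _ => hc j)
  · refine (norm_iteratedDeriv_succ_profile_le hε1 hp j s).trans ?_
    refine mul_le_mul_of_nonneg_right ?_ (Real.exp_pos _).le
    refine (Finset.single_le_sum (f := c) (fun j _ => hc j) (Finset.mem_range.2 hj)).trans ?_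
    exact le_add_of_nonneg_left (by positivity)

end Wightman

/-! ### Convergence of regularized pairings with independent regulators. -/

section SpectralFamily

open MeasureTheory

theorem JetBound.prod {X ι : Type} [NormedAddCommGroup X] [NormedSpace ℝ X] (s : Finset ι)
    {m : ℕ} {K : Set X} {f : ι → X → ℂ} {b : ι → ℝ} (hb : ∀ i ∈ s, 0 ≤ b i)
    (hf : ∀ i ∈ s, ContDiff ℝ ∞ (f i)) (h : ∀ i ∈ s, JetBound m K (f i) (b i)) :
    JetBound m K (fun x => ∏ i ∈ s, f i x) ((2 ^ m) ^ s.card * ∏ i ∈ s, b i) := by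
  classical
  induction s using Finset.induction_on with
  | empty =>
    intro j _ x _
    simp only [Finset.prod_empty, Finset.card_empty, pow_zero, one_mul]
    rcases j with _ | j
    · simp
    · rw [iteratedFDeriv_succ_const]; simp
  | insert a s ha ih =>
    have h1 := ih (fun i hi => hb i (Finset.mem_insert_of_mem hi))
      (fun i hi => hf i (Finset.mem_insert_of_mem hi))
      (fun i hi => h i (Finset.mem_insert_of_mem hi))
    have h2 := JetBound.mul (hb a (Finset.mem_insert_self _ _)) (hf a (Finset.mem_insert_self _ _))
      (contDiff_prod fun i hi => hf i (Finset.mem_insert_of_mem hi))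
      (h a (Finset.mem_insert_self _ _)) h1
    simp only [Finset.prod_insert ha, Finset.card_insert_of_notMem ha]
    refine h2.mono le_rfl subset_rfl (le_of_eq ?_)
    ring

variable {n : ℕ}

theorem planeWave_sub (k x y : Fin n → Mink) :
    planeWave k (x - y) = planeWave k x * planeWave (-k) y := by
  rw [planeWave, planeWave, planeWave, ← Complex.exp_add]
  congr 1
  have : covPair k (x - y) = covPair k x + covPair (-k) y := by
    simp only [covPair, ← Finset.sum_add_distrib]
    exact Finset.sum_congr rfl fun i _ => by simp; ring
  rw [this]; push_cast; ring

/-- The wave `k` acts on the variable of `u`, which decays, and the wave `-k` on that of `v`, which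
grows at most polynomially. -/
theorem RapidDecayOn.tensor {Λ : Set (Fin n → Mink)} {u v : ((Fin n → Mink) → ℂ) → ℂ}
    (hu : RapidDecayOn Λ u) (hv : IsCompactDistribution v) (N : ℕ) :
    ∃ K : Set ((Fin n → Mink) × (Fin n → Mink)), IsCompact K ∧ ∃ (m : ℕ) (C : ℝ), 0 ≤ C ∧
      ∀ s : (Fin n → Mink) × (Fin n → Mink) → ℂ, ContDiff ℝ ∞ s → ∀ b : ℝ, 0 ≤ b →
        JetBound m K s b → ∀ k ∈ Λ, (1 + ‖k‖) ^ N *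
          ‖u fun x => v fun y => planeWave k (x - y) * s (x, y)‖ ≤ C * b := by
  obtain ⟨K₂, hK₂, m₂, C₂, hC₂, hv'⟩ := hv.exists_bound
  -- The extra `m₂` powers pay for the growth of `v` on `planeWave (-k)`.
  obtain ⟨K₁, hK₁, m₁, C₁, hC₁, hu'⟩ := hu (N + m₂)
  refine ⟨K₁ ×ˢ K₂, hK₁.prod hK₂, m₁ + m₂, C₁ * ((m₂ + 1) * (C₂ * (2 ^ m₂ * (1 + 2 * n) ^ m₂))),
    by positivity, fun s hs b hb hj k hk => ?_⟩
  have hk0 : 0 < (1 + ‖k‖) ^ m₂ := by positivity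
  have hvk : ∀ f : (Fin n → Mink) → ℂ, ContDiff ℝ ∞ f → ∀ b : ℝ, 0 ≤ b → JetBound m₂ K₂ f b →
      ‖v fun y => planeWave (-k) y * f y‖ ≤
        (C₂ * (2 ^ m₂ * (1 + 2 * n) ^ m₂) * (1 + ‖k‖) ^ m₂) * b := by
    intro f hf b hb hj
    have h1 := JetBound.mul (by positivity) (contDiff_planeWave (-k)) hf
      (jetBound_planeWave m₂ K₂ (-k)) hj
    rw [norm_neg] at h1
    exact (hv' _ ((contDiff_planeWave (-k)).mul hf) _ (by positivity) h1).trans_eq (by ring)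
  obtain ⟨hg, hgj⟩ := (hv.mul (contDiff_planeWave (-k))).param_bound hK₂ (by positivity) hvk hs
  have h2 := hu' _ hg _ (by positivity) (hgj m₁ K₁ b hb hj) k hk
  have h3 : (fun x => v fun y => planeWave k (x - y) * s (x, y)) =
      fun x => planeWave k x * v fun y => planeWave (-k) y * s (x, y) := by
    ext x
    have : ContDiff ℝ ∞ fun y => planeWave (-k) y * s (x, y) :=
      (contDiff_planeWave (-k)).mul (hs.comp (contDiff_const.prodMk contDiff_id))
    rw [← hv.map_const_mul _ this]
    congr 1; ext y; rw [planeWave_sub]; ring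
  rw [h3]
  refine le_of_mul_le_mul_right ?_ hk0
  calc _ = (1 + ‖k‖) ^ (N + m₂) *
        ‖u fun x => planeWave k x * v fun y => planeWave (-k) y * s (x, y)‖ := by
        rw [pow_add]; ring
    _ ≤ _ := h2
    _ = _ := by ring

/-- The integrand of the spectral representation of a product of two-point functions. -/
def productKernel (μ : ℝ) (ε p : Fin n → ℝ) (z : (Fin n → Mink) × (Fin n → Mink)) : ℂ :=
  ∏ i, spectralKernel μ (ε i) (p i) (z.1 i - z.2 i)

theorem integral_productKernel {μ : ℝ} (hμ : 0 < μ) {ε : Fin n → ℝ} (hε : ∀ i, 0 < ε i)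
    (z : (Fin n → Mink) × (Fin n → Mink)) :
    ∫ p, productKernel μ ε p z = ∏ i, wightman μ (ε i) (z.1 i - z.2 i) := by
  have := integral_fintype_prod_eq_prod (𝕜 := ℂ) (E := fun _ : Fin n => ℝ)
    (μ := fun _ => volume) (fun i p => spectralKernel μ (ε i) p (z.1 i - z.2 i))
  refine this.trans ?_
  exact Finset.prod_congr rfl fun i _ => integral_spectralKernel hμ (hε i) _

/-- The phase `t ± r` in the `i`-th variable. -/
def phase (i : Fin n) (p : ℝ) : (Fin n → Mink) × (Fin n → Mink) →L[ℝ] ℝ :=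
  LinearMap.mkContinuous
    { toFun := fun z => (z.1 i - z.2 i).1 + p / |p| * (z.1 i - z.2 i).2
      map_add' := fun z w => by simp; ring
      map_smul' := fun a z => by simp; ring } 4 (fun z => by
    have h0 : ‖z.1 i - z.2 i‖ ≤ 2 * ‖z‖ := by
      have h1 : ‖z.1 i‖ ≤ ‖z‖ := (norm_le_pi_norm z.1 i).trans (norm_fst_le z)
      have h2 : ‖z.2 i‖ ≤ ‖z‖ := (norm_le_pi_norm z.2 i).trans (norm_snd_le z)
      linarith [norm_sub_le (z.1 i) (z.2 i)]
    have h1 : |(z.1 i - z.2 i).1| ≤ 2 * ‖z‖ := (norm_fst_le (z.1 i - z.2 i)).trans h0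
    have h2 : |(z.1 i - z.2 i).2| ≤ 2 * ‖z‖ := (norm_snd_le (z.1 i - z.2 i)).trans h0
    have h3 : abs (p / |p|) ≤ 1 := by
      rw [abs_div, abs_abs]; exact div_self_le_one _
    refine (abs_add_le _ _).trans ?_
    rw [abs_mul]
    have h4 : abs (p / |p|) * |(z.1 i - z.2 i).2| ≤ 1 * (2 * ‖z‖) :=
      mul_le_mul h3 h2 (abs_nonneg _) zero_le_one
    linarith)

theorem norm_phase_le (i : Fin n) (p : ℝ) : ‖phase i p‖ ≤ 4 :=
  LinearMap.mkContinuous_norm_le _ (by norm_num) _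

theorem phase_apply (i : Fin n) (p : ℝ) (z : (Fin n → Mink) × (Fin n → Mink)) :
    phase i p z = (z.1 i - z.2 i).1 + p / |p| * (z.1 i - z.2 i).2 := rfl

theorem planeWave_eq_prod (k x : Fin n → Mink) : planeWave k x =
    ∏ i, Complex.exp (-(Complex.I * (((k i).1 * (x i).1 + (k i).2 * (x i).2 : ℝ) : ℂ))) := by
  rw [← Complex.exp_sum, planeWave, covPair]
  congr 1
  rw [Complex.ofReal_sum, Finset.mul_sum, Finset.sum_neg_distrib]

/-- The form used for estimates: all oscillation at the shell covector is in the plane wave, and the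
poles at `p i = 0` have cancelled inside the profiles. The hypothesis `hp` holds almost everywhere.
-/
theorem productKernel_eq_planeWave_mul (μ : ℝ) (ε : Fin n → ℝ) {p : Fin n → ℝ}
    (hp : ∀ i, p i ≠ 0) (z : (Fin n → Mink) × (Fin n → Mink)) :
    productKernel μ ε p z = planeWave (fun i => shell (p i)) (z.1 - z.2) *
      ∏ i, profile μ (ε i) (p i) (phase i (p i) z) := by
  rw [productKernel, planeWave_eq_prod, ← Finset.prod_mul_distrib]
  refine Finset.prod_congr rfl fun i _ => ?_
  have hp' : (|p i| : ℝ) ≠ 0 := abs_ne_zero.2 (hp i)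
  have h1 : Complex.I * |p i| * (phase i (p i) z : ℝ) =
      Complex.I * ((|p i| * (z.1 i - z.2 i).1 + p i * (z.1 i - z.2 i).2 : ℝ) : ℂ) := by
    rw [mul_assoc, ← Complex.ofReal_mul, phase_apply]
    congr 2
    field_simp
  simp only [spectralKernel, profile, h1, shell, Pi.sub_apply]
  rw [mul_sub, mul_left_comm, ← Complex.exp_add, neg_add_cancel, Complex.exp_zero]
  ring

theorem exists_profile_prod_bound (μ : ℝ) (m : ℕ) {K : Set ((Fin n → Mink) × (Fin n → Mink))}
    (hK : IsCompact K) : ∃ C : ℝ, 0 ≤ C ∧ ∀ ε p : Fin n → ℝ, (∀ i, 0 < ε i) → (∀ i, ε i ≤ 1) →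
      (∀ i, p i ≠ 0) → JetBound m K (fun z => ∏ i, profile μ (ε i) (p i) (phase i (p i) z))
        (C * ∏ i, Real.exp (-(|p i| * ε i / 2))) := by
  obtain ⟨ρ, hρ⟩ := hK.isBounded.exists_norm_le
  obtain ⟨C, hC, h⟩ := exists_iteratedDeriv_profile_bound μ m (4 * ρ)
  refine ⟨(2 ^ m) ^ n * (4 ^ m * C) ^ n, by positivity, fun ε p hε hε1 hp => ?_⟩
  have h1 := JetBound.prod (m := m) (K := K) (Finset.univ : Finset (Fin n))
    (f := fun i z => profile μ (ε i) (p i) (phase i (p i) z))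
    (b := fun i => (4 ^ m * C) * Real.exp (-(|p i| * ε i / 2)))
    (fun i _ => by positivity)
    (fun i _ => (contDiff_profile μ (ε i) (p i)).comp (phase i (p i)).contDiff)
    (fun i _ j hj z hz => by
      refine (norm_iteratedFDeriv_comp_functional_le (contDiff_profile μ (ε i) (p i)) _ j z).trans ?_
      have h2 : |phase i (p i) z| ≤ 4 * ρ :=
        ((phase i (p i)).le_opNorm z).trans
          (mul_le_mul (norm_phase_le _ _) (hρ z hz) (norm_nonneg _) (by norm_num))
      have h3 : ‖phase i (p i)‖ ^ j ≤ 4 ^ m :=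
        (pow_le_pow_left₀ (norm_nonneg _) (norm_phase_le _ _) j).trans
          (pow_le_pow_right₀ (by norm_num) hj)
      refine (mul_le_mul (h _ _ _ (hε i) (hε1 i) (hp i) h2 j hj) h3 (by positivity)
        (by positivity)).trans_eq (by ring))
  refine h1.mono le_rfl subset_rfl (le_of_eq ?_)
  rw [Finset.prod_mul_distrib, Finset.prod_const, Finset.card_univ, Fintype.card_fin]
  ring

/-- The coefficients in the expansion of the product kernel into plane waves. -/
def kernelCoeff (μ : ℝ) (ε p : Fin n → ℝ) (t : Finset (Fin n)) : ℂ :=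
  (∏ i ∈ t, amplitude (ε i) (p i)) * ∏ i ∈ Finset.univ \ t, -subtraction μ (p i)

/-- The covectors in the expansion of the product kernel into plane waves. -/
def kernelMode (t : Finset (Fin n)) (p : Fin n → ℝ) : Fin n → Mink :=
  fun i => if i ∈ t then shell (p i) else 0

/-- The form used for measurability and for continuity in `ε` at fixed `p`. Its coefficients have
poles, so the sum cannot be integrated term by term. -/
theorem productKernel_eq_sum (μ : ℝ) (ε p : Fin n → ℝ) (z : (Fin n → Mink) × (Fin n → Mink)) :
    productKernel μ ε p z = ∑ t ∈ (Finset.univ : Finset (Fin n)).powerset,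
      kernelCoeff μ ε p t * planeWave (kernelMode t p) (z.1 - z.2) := by
  simp only [productKernel, spectralKernel, sub_eq_add_neg, Finset.prod_add]
  refine Finset.sum_congr rfl fun t _ => ?_
  rw [Finset.prod_mul_distrib, kernelCoeff]
  have : planeWave (kernelMode t p) (z.1 - z.2) = ∏ i ∈ t, Complex.exp
      (-(Complex.I * ((|p i| * (z.1 i - z.2 i).1 + p i * (z.1 i - z.2 i).2 : ℝ) : ℂ))) := by
    rw [planeWave_eq_prod, ← Finset.prod_subset (Finset.subset_univ t)]
    · refine Finset.prod_congr rfl fun i hi => ?_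
      simp [kernelMode, hi, shell]
    · intro i _ hi
      simp [kernelMode, hi]
  rw [← sub_eq_add_neg, this]
  simp only [sub_eq_add_neg]
  ring

theorem contDiff_planeWave_sub :
    ContDiff ℝ ∞ fun q : (Fin n → Mink) × ((Fin n → Mink) × (Fin n → Mink)) =>
      planeWave q.1 (q.2.1 - q.2.2) := by
  simp only [planeWave_eq_prod]
  refine contDiff_prod fun i _ => ?_
  have h : ContDiff ℝ ∞ fun q : (Fin n → Mink) × ((Fin n → Mink) × (Fin n → Mink)) =>
      (q.1 i).1 * (q.2.1 i - q.2.2 i).1 + (q.1 i).2 * (q.2.1 i - q.2.2 i).2 := by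
    fun_prop
  exact (contDiff_const.mul (Complex.ofRealCLM.contDiff.comp h)).neg.cexp

/-- The product kernels as a family of smooth functions. -/
def kernelFamily (μ : ℝ) (ε : Fin n → ℝ) (p : Fin n → ℝ) :
    smoothFunctions ((Fin n → Mink) × (Fin n → Mink)) :=
  ∑ t ∈ (Finset.univ : Finset (Fin n)).powerset,
    kernelCoeff μ ε p t • sectionAt contDiff_planeWave_sub (kernelMode t p)

theorem kernelFamily_apply (μ : ℝ) (ε p : Fin n → ℝ) :
    (kernelFamily μ ε p).1 = productKernel μ ε p := by
  ext z
  rw [productKernel_eq_sum, kernelFamily]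
  simp only [AddSubmonoidClass.coe_finsetSum, Finset.sum_apply]
  rfl

theorem measurable_kernelMode (t : Finset (Fin n)) : Measurable (kernelMode t) := by
  refine measurable_pi_lambda _ fun i => ?_
  unfold kernelMode shell
  split_ifs
  · exact ((measurable_pi_apply i).abs).prodMk (measurable_pi_apply i)
  · exact measurable_const

theorem measurable_kernelCoeff (μ : ℝ) (ε : Fin n → ℝ) (t : Finset (Fin n)) :
    Measurable fun p => kernelCoeff μ ε p t := by
  have h : ∀ i : Fin n, Measurable fun p : Fin n → ℝ => ((|p i| : ℝ) : ℂ) := fun i =>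
    Complex.measurable_ofReal.comp (measurable_pi_apply i).abs
  unfold kernelCoeff amplitude subtraction
  refine (Finset.measurable_fun_prod _ fun i _ => ?_).mul
    (Finset.measurable_fun_prod _ fun i _ => ?_)
  · exact measurable_const.mul (((h i).mul_const _).neg.cexp.div (h i))
  · exact (measurable_const.mul (((h i).neg.cexp.div (h i)).add
      (measurable_const.mul (h i).neg.cexp))).neg

theorem jetMeasurable_kernelFamily (μ : ℝ) (ε : Fin n → ℝ) :
    JetMeasurable (kernelFamily μ ε) (volume : Measure (Fin n → ℝ)) :=
  JetMeasurable.sum _ fun t _ =>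
    (jetMeasurable_sectionAt contDiff_planeWave_sub (measurable_kernelMode t)).const_mul
      (measurable_kernelCoeff μ ε t).aestronglyMeasurable

theorem ae_ne_zero : ∀ᵐ p : Fin n → ℝ, ∀ i, p i ≠ 0 := by
  refine ae_all_iff.2 fun i => ?_
  exact (Measure.tendsto_eval_ae_ae (μ := fun _ : Fin n => (volume : Measure ℝ))
    (i := i)).eventually (Measure.ae_ne volume 0)

theorem norm_le_norm_shell (p : Fin n → ℝ) : ‖p‖ ≤ ‖fun i => shell (p i)‖ := by
  refine (pi_norm_le_iff_of_nonneg (norm_nonneg _)).2 fun i => ?_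
  exact (norm_snd_le (shell (p i))).trans (norm_le_pi_norm (fun i => shell (p i)) i)

theorem norm_shell_le (p : Fin n → ℝ) : ‖fun i => shell (p i)‖ ≤ ‖p‖ := by
  refine (pi_norm_le_iff_of_nonneg (norm_nonneg _)).2 fun i => ?_
  refine (norm_prod_le_iff).2 ⟨?_, norm_le_pi_norm p i⟩
  exact (norm_abs_eq_norm (p i)).trans_le (norm_le_pi_norm p i)

theorem shell_mem (p : Fin n → ℝ) : (fun i => shell (p i)) ∈ forwardCovectors n :=
  fun i => by simp [shell, forwardCone]

theorem integrable_inv_one_add_norm_pow (n : ℕ) : ∃ d : ℕ,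
    Integrable (fun p : Fin n → ℝ => ((1 + ‖p‖) ^ d)⁻¹) := by
  refine ⟨Module.finrank ℝ (Fin n → ℝ) + 1, ?_⟩
  have := integrable_one_add_norm (E := Fin n → ℝ) (μ := volume)
    (r := (Module.finrank ℝ (Fin n → ℝ) + 1 : ℕ)) (by push_cast; linarith)
  refine this.congr (Filter.Eventually.of_forall fun v => ?_)
  simp only [Real.rpow_neg (by positivity : (0 : ℝ) ≤ 1 + ‖v‖), Real.rpow_natCast]

theorem exists_prod_exp_bound {ε : Fin n → ℝ} (hε : ∀ i, 0 < ε i) (k : ℕ) : ∃ C : ℝ, 0 ≤ C ∧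
    ∀ p : Fin n → ℝ, (1 + ‖p‖) ^ k * ∏ i, Real.exp (-(|p i| * ε i / 2)) ≤ C := by
  obtain ⟨c, hc, hcε⟩ : ∃ c : ℝ, 0 < c ∧ ∀ i, c ≤ ε i / 2 := by
    -- With no variables there is no smallest regulator, and any positive `c` will do.
    rcases isEmpty_or_nonempty (Fin n) with h | h
    · exact ⟨1, one_pos, fun i => h.elim i⟩
    · obtain ⟨i, hi⟩ := Finite.exists_min ε
      exact ⟨ε i / 2, half_pos (hε i), fun j => by linarith [hi j]⟩
  refine ⟨k.factorial / c ^ k * Real.exp c, by positivity, fun p => ?_⟩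
  have h1 : ∏ i, Real.exp (-(|p i| * ε i / 2)) ≤ Real.exp (-(c * ‖p‖)) := by
    rw [← Real.exp_sum]
    refine Real.exp_le_exp.2 ?_
    rw [Finset.sum_neg_distrib, neg_le_neg_iff]
    have h0 : 0 ≤ ∑ i, |p i| * ε i / 2 :=
      Finset.sum_nonneg fun i _ => by have := (hε i).le; positivity
    rw [mul_comm, ← le_div_iff₀ hc]
    refine (pi_norm_le_iff_of_nonneg (by positivity)).2 fun i => ?_
    rw [le_div_iff₀ hc]
    refine le_trans ?_ (Finset.single_le_sum (f := fun i => |p i| * ε i / 2)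
      (fun i _ => by have := (hε i).le; positivity) (Finset.mem_univ i))
    rw [mul_div_assoc]
    exact mul_le_mul_of_nonneg_left (hcε i) (norm_nonneg _)
  have h2 := pow_mul_exp_neg_le k (x := 1 + ‖p‖) (c := c) (by positivity) hc
  calc _ ≤ (1 + ‖p‖) ^ k * Real.exp (-(c * ‖p‖)) := by gcongr
    _ = ((1 + ‖p‖) ^ k * Real.exp (-(c * (1 + ‖p‖)))) * Real.exp c := by
      rw [mul_assoc, ← Real.exp_add]; congr 2; ring
    _ ≤ _ := by gcongr

theorem jetBound_planeWave_sub (m : ℕ) (K : Set ((Fin n → Mink) × (Fin n → Mink)))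
    (k : Fin n → Mink) : JetBound m K (fun z => planeWave k (z.1 - z.2))
      (2 ^ m * ((1 + 2 * n) ^ m * (1 + ‖k‖) ^ m)) := by
  let T : (Fin n → Mink) × (Fin n → Mink) →L[ℝ] (Fin n → Mink) :=
    ContinuousLinearMap.fst ℝ _ _ - ContinuousLinearMap.snd ℝ _ _
  have hT : ‖T‖ ≤ 2 := by
    refine (norm_sub_le _ _).trans ?_
    linarith [ContinuousLinearMap.norm_fst_le ℝ (Fin n → Mink) (Fin n → Mink),
      ContinuousLinearMap.norm_snd_le ℝ (Fin n → Mink) (Fin n → Mink)]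
  refine (JetBound.comp_clm (K := K) T (contDiff_planeWave k)
    (jetBound_planeWave m (T '' K) k)).mono le_rfl subset_rfl ?_
  gcongr
  exact max_le (by norm_num) hT

/-- With positive regulators the exponential weights beat the polynomial growth of the plane wave;
no decay of `u` is involved yet. -/
theorem jetDominated_kernelFamily (μ : ℝ) {ε : Fin n → ℝ} (hε : ∀ i, 0 < ε i)
    (hε1 : ∀ i, ε i ≤ 1) : JetDominated (kernelFamily μ ε) (volume : Measure (Fin n → ℝ)) := by
  intro m K hK
  obtain ⟨d, hd⟩ := integrable_inv_one_add_norm_pow n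
  obtain ⟨C, hC, h⟩ := exists_profile_prod_bound μ m hK
  obtain ⟨D, hD, h'⟩ := exists_prod_exp_bound hε (m + d)
  refine ⟨fun p => (2 ^ m * (2 ^ m * (1 + 2 * n) ^ m * C)) * D * ((1 + ‖p‖) ^ d)⁻¹,
    hd.const_mul _, ?_⟩
  filter_upwards [ae_ne_zero] with p hp
  rw [kernelFamily_apply, funext (productKernel_eq_planeWave_mul μ ε hp)]
  have hsm : ContDiff ℝ ∞ fun z : (Fin n → Mink) × (Fin n → Mink) =>
      planeWave (fun i => shell (p i)) (z.1 - z.2) :=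
    (contDiff_planeWave _).comp (contDiff_fst.sub contDiff_snd)
  have h1 := JetBound.mul (m := m) (K := K) (by positivity) hsm
    (contDiff_prod fun i _ => (contDiff_profile μ (ε i) (p i)).comp (phase i (p i)).contDiff)
    (jetBound_planeWave_sub m K fun i => shell (p i)) (h ε p hε hε1 hp)
  refine h1.mono le_rfl subset_rfl ?_
  rw [← div_eq_mul_inv, le_div_iff₀ (by positivity)]
  have h2 : (1 + ‖fun i => shell (p i)‖) ^ m ≤ (1 + ‖p‖) ^ m := by
    gcongr; exact norm_shell_le p
  have h3 : 0 ≤ ∏ i, Real.exp (-(|p i| * ε i / 2)) := by positivity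
  calc _ ≤ 2 ^ m * (2 ^ m * ((1 + 2 * n) ^ m * (1 + ‖p‖) ^ m) *
        (C * ∏ i, Real.exp (-(|p i| * ε i / 2)))) * (1 + ‖p‖) ^ d := by gcongr
    _ = (2 ^ m * (2 ^ m * (1 + 2 * n) ^ m * C)) *
        ((1 + ‖p‖) ^ (m + d) * ∏ i, Real.exp (-(|p i| * ε i / 2))) := by rw [pow_add]; ring
    _ ≤ _ := by gcongr; exact h' p

/-- The regularized contraction of distributions, with one regulator for each variable. -/
def pairingMulti (μ : ℝ) (ε : Fin n → ℝ) (u v : ((Fin n → Mink) → ℂ) → ℂ) : ℂ :=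
  u fun x => v fun y => ∏ i, wightman μ (ε i) (x i - y i)

theorem pairingMulti_eq_integral {μ : ℝ} (hμ : 0 < μ) {ε : Fin n → ℝ} (hε : ∀ i, 0 < ε i)
    (hε1 : ∀ i, ε i ≤ 1) {u v : ((Fin n → Mink) → ℂ) → ℂ} (hu : IsCompactDistribution u)
    (hv : IsCompactDistribution v) :
    pairingMulti μ ε u v = ∫ p, u fun x => v fun y => productKernel μ ε p (x, y) := by
  have h := (hu.tensor hv).apply_integral (jetMeasurable_kernelFamily μ ε)
    (jetDominated_kernelFamily μ hε hε1)
  simp only [kernelFamily_apply, integral_productKernel hμ hε] at h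
  exact h

theorem tensor_productKernel (μ : ℝ) (ε p : Fin n → ℝ) {u v : ((Fin n → Mink) → ℂ) → ℂ}
    (hu : IsCompactDistribution u) (hv : IsCompactDistribution v) :
    (u fun x => v fun y => productKernel μ ε p (x, y)) =
      ∑ t ∈ (Finset.univ : Finset (Fin n)).powerset, kernelCoeff μ ε p t *
        u fun x => v fun y => planeWave (kernelMode t p) (x - y) := by
  have hsm : ∀ t, ContDiff ℝ ∞ fun z : (Fin n → Mink) × (Fin n → Mink) =>
      planeWave (kernelMode t p) (z.1 - z.2) := fun t =>
    (contDiff_planeWave _).comp (contDiff_fst.sub contDiff_snd)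
  have h := (hu.tensor hv).map_sum (Finset.univ : Finset (Fin n)).powerset
    (f := fun t z => kernelCoeff μ ε p t * planeWave (kernelMode t p) (z.1 - z.2))
    fun t _ => contDiff_const.mul (hsm t)
  simp only [productKernel_eq_sum]
  refine h.trans ?_
  exact Finset.sum_congr rfl fun t _ => (hu.tensor hv).map_const_mul _ (hsm t)

/-- The regularized contractions converge when one of the distributions decays rapidly in the
directions of the forward cone. -/
theorem exists_tendsto_pairingMulti {μ : ℝ} (hμ : 0 < μ) {u v : ((Fin n → Mink) → ℂ) → ℂ}
    (hu : IsCompactDistribution u) (hud : RapidDecayOn (forwardCovectors n) u)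
    (hv : IsCompactDistribution v) : ∃ l : ℂ, Filter.Tendsto (fun ε => pairingMulti μ ε u v)
      (nhdsWithin 0 {ε : Fin n → ℝ | ∀ i, 0 < ε i}) (nhds l) := by
  obtain ⟨d, hd⟩ := integrable_inv_one_add_norm_pow n
  obtain ⟨K, hK, m, C, hC, h⟩ := hud.tensor hv d
  obtain ⟨D, hD, h'⟩ := exists_profile_prod_bound μ m hK
  refine ⟨∫ p, u fun x => v fun y => productKernel μ 0 p (x, y), ?_⟩
  have hev : ∀ᶠ ε in nhdsWithin 0 {ε : Fin n → ℝ | ∀ i, 0 < ε i},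
      (∀ i, 0 < ε i) ∧ ∀ i, ε i ≤ 1 := by
    have h1 : ∀ᶠ ε in nhds (0 : Fin n → ℝ), ∀ i, ε i ≤ 1 := by
      refine Filter.eventually_all.2 fun i => ?_
      exact ((continuous_apply i).tendsto (0 : Fin n → ℝ)).eventually
        (Iic_mem_nhds (by simp))
    filter_upwards [self_mem_nhdsWithin, mem_nhdsWithin_of_mem_nhds h1] with ε h2 h3
    exact ⟨h2, h3⟩
  -- The majorant must not depend on `ε`: the exponential weights are bounded by `1`, and
  -- integrability in `p` comes from the decay of order `d` of `u` along shell covectors.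
  have key := tendsto_integral_filter_of_dominated_convergence
    (l := nhdsWithin 0 {ε : Fin n → ℝ | ∀ i, 0 < ε i}) (μ := (volume : Measure (Fin n → ℝ)))
    (F := fun ε p => u fun x => v fun y => productKernel μ ε p (x, y))
    (f := fun p => u fun x => v fun y => productKernel μ 0 p (x, y))
    (fun p => C * D * ((1 + ‖p‖) ^ d)⁻¹) ?_ ?_ (hd.const_mul _) ?_
  · refine key.congr' ?_
    filter_upwards [hev] with ε hε
    exact (pairingMulti_eq_integral hμ hε.1 hε.2 hu hv).symm
  · filter_upwards [hev] with ε hε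
    have := ((hu.tensor hv).integrable_apply (jetMeasurable_kernelFamily μ ε)
      (jetDominated_kernelFamily μ hε.1 hε.2)).aestronglyMeasurable
    simpa only [kernelFamily_apply] using this
  · filter_upwards [hev] with ε hε
    filter_upwards [ae_ne_zero] with p hp
    simp only [productKernel_eq_planeWave_mul μ ε hp]
    have h1 : ∏ i, Real.exp (-(|p i| * ε i / 2)) ≤ 1 :=
      Finset.prod_le_one (fun i _ => (Real.exp_pos _).le) fun i _ => by
        rw [Real.exp_le_one_iff]
        have := (hε.1 i).le
        have : 0 ≤ |p i| * ε i / 2 := by positivity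
        linarith
    have h2 := h (fun z => ∏ i, profile μ (ε i) (p i) (phase i (p i) z))
      (contDiff_prod fun i _ => (contDiff_profile μ (ε i) (p i)).comp (phase i (p i)).contDiff)
      D hD ((h' ε p hε.1 hε.2 hp).mono le_rfl subset_rfl (mul_le_of_le_one_right hD h1))
      (fun i => shell (p i)) (shell_mem p)
    rw [← div_eq_mul_inv, le_div_iff₀ (by positivity), mul_comm]
    refine le_trans ?_ h2
    gcongr
    exact norm_le_norm_shell p
  -- At fixed `p` only the coefficients of a finite sum depend on `ε`, continuously up to `0`. This
  -- includes `p i = 0`, where division by zero makes the amplitude `0`.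
  · refine Filter.Eventually.of_forall fun p => ?_
    simp only [tensor_productKernel _ _ _ hu hv]
    refine Filter.Tendsto.mono_left (Continuous.tendsto ?_ 0) nhdsWithin_le_nhds
    unfold kernelCoeff amplitude
    fun_prop

end SpectralFamily

/-! ### Partial contractions, and contraction in two steps. -/

section Contractions

open Filter Topology

variable {k n : ℕ}

/-- Pullback of configurations of points along a map of the labels. -/
def pullVars {k n : ℕ} (σ : Fin k → Fin n) : (Fin n → Mink) →L[ℝ] (Fin k → Mink) :=
  ContinuousLinearMap.pi fun j => ContinuousLinearMap.proj (σ j)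

theorem pullVars_apply {k n : ℕ} (σ : Fin k → Fin n) (x : Fin n → Mink) :
    pullVars σ x = fun j => x (σ j) := rfl

/-- Concatenation of configurations of points. -/
def appendVars (k n : ℕ) : (Fin k → Mink) × (Fin n → Mink) →L[ℝ] (Fin (k + n) → Mink) :=
  ContinuousLinearMap.pi fun i => Fin.addCases
    (fun j => (ContinuousLinearMap.proj j).comp (ContinuousLinearMap.fst ℝ _ _))
    (fun j => (ContinuousLinearMap.proj j).comp (ContinuousLinearMap.snd ℝ _ _)) i

theorem appendVars_apply (p : (Fin k → Mink) × (Fin n → Mink)) :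
    appendVars k n p = Fin.append p.1 p.2 := by
  ext1 i
  refine Fin.addCases (fun j => ?_) (fun j => ?_) i <;> simp [appendVars]

theorem covPair_append_zero (κ : Fin n → Mink) (x : Fin (k + n) → Mink) :
    covPair (Fin.append (0 : Fin k → Mink) κ) x = covPair κ fun i => x (Fin.natAdd k i) := by
  simp [covPair, Fin.sum_univ_add]

theorem norm_le_norm_append_zero (κ : Fin n → Mink) :
    ‖κ‖ ≤ ‖Fin.append (0 : Fin k → Mink) κ‖ := by
  refine (pi_norm_le_iff_of_nonneg (norm_nonneg _)).2 fun i => ?_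
  have := norm_le_pi_norm (Fin.append (0 : Fin k → Mink) κ) (Fin.natAdd k i)
  rwa [Fin.append_right] at this

/-- Testing the free variables with `f` leaves a distribution in the contracted ones, so a partial
contraction evaluated at `f` is a full pairing. -/
theorem IsCompactDistribution.contractLeft {u : ((Fin (k + n) → Mink) → ℂ) → ℂ}
    (hu : IsCompactDistribution u) {f : (Fin k → Mink) → ℂ} (hf : ContDiff ℝ ∞ f) :
    IsCompactDistribution fun s : (Fin n → Mink) → ℂ => u fun x =>
      f (fun j => x (Fin.castAdd n j)) * s fun i => x (Fin.natAdd k i) :=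
  (hu.mul (hf.comp (pullVars (Fin.castAdd n)).contDiff)).pushforward (pullVars (Fin.natAdd k))

/-- A covector `κ` of the contracted variables becomes `(0, κ)`, which is still forward because the
closed cone contains `0`. -/
theorem RapidDecayOn.contractLeft {u : ((Fin (k + n) → Mink) → ℂ) → ℂ}
    (hu : RapidDecayOn (forwardCovectors (k + n)) u) {f : (Fin k → Mink) → ℂ}
    (hf : ContDiff ℝ ∞ f) :
    RapidDecayOn (forwardCovectors n) fun s : (Fin n → Mink) → ℂ => u fun x =>
      f (fun j => x (Fin.castAdd n j)) * s fun i => x (Fin.natAdd k i) := by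
  intro N
  obtain ⟨K, hK, m, C, hC, h⟩ := hu N
  have hf' : ContDiff ℝ ∞ fun x : Fin (k + n) → Mink => f fun j => x (Fin.castAdd n j) :=
    hf.comp (pullVars (Fin.castAdd n)).contDiff
  obtain ⟨a, ha, hfa⟩ := exists_jetBound m hK hf'
  let T : (Fin (k + n) → Mink) →L[ℝ] (Fin n → Mink) := pullVars (Fin.natAdd k)
  refine ⟨T '' K, hK.image T.continuous, m, C * (2 ^ m * (a * max 1 ‖T‖ ^ m)), by positivity,
    fun s hs b hb hj κ hκ => ?_⟩
  have hs' : ContDiff ℝ ∞ fun x => s (T x) := hs.comp T.contDiff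
  have h1 := JetBound.mul ha hf' hs' hfa (JetBound.comp_clm T hs hj)
  have hmem : Fin.append (0 : Fin k → Mink) κ ∈ forwardCovectors (k + n) := fun i => by
    refine Fin.addCases (fun j => ?_) (fun j => ?_) i
    · simp [forwardCone]
    · simpa using hκ j
  have h2 := h _ (hf'.mul hs') _ (by positivity) h1 _ hmem
  have h3 : (fun x : Fin (k + n) → Mink => f (fun j => x (Fin.castAdd n j)) *
      (planeWave κ (fun i => x (Fin.natAdd k i)) * s fun i => x (Fin.natAdd k i))) =
      fun x => planeWave (Fin.append (0 : Fin k → Mink) κ) x *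
        (f (fun j => x (Fin.castAdd n j)) * s (T x)) := by
    ext x
    simp only [planeWave, covPair_append_zero, T, pullVars_apply]
    ring
  simp only [h3]
  calc _ ≤ (1 + ‖Fin.append (0 : Fin k → Mink) κ‖) ^ N * _ := by
        gcongr; exact norm_le_norm_append_zero κ
    _ ≤ _ := h2
    _ = _ := by ring

theorem tendsto_const_regulator (n : ℕ) : Tendsto (fun ε : ℝ => fun _ : Fin n => ε) (𝓝[>] 0)
    (𝓝[{ε : Fin n → ℝ | ∀ i, 0 < ε i}] 0) := by
  refine tendsto_nhdsWithin_iff.2 ⟨?_, ?_⟩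
  · exact ((continuous_pi fun _ => continuous_id).tendsto' _ _ rfl).mono_left nhdsWithin_le_nhds
  · filter_upwards [self_mem_nhdsWithin] with ε hε _
    exact hε

theorem exists_tendsto_pairingReg {μ : ℝ} (hμ : 0 < μ) {u v : ((Fin n → Mink) → ℂ) → ℂ}
    (hu : IsCompactDistribution u) (hud : RapidDecayOn (forwardCovectors n) u)
    (hv : IsCompactDistribution v) : PairingExists μ n u v := by
  obtain ⟨l, hl⟩ := exists_tendsto_pairingMulti hμ hu hud hv
  exact ⟨l, hl.comp (tendsto_const_regulator n)⟩

theorem contractExists {μ : ℝ} (hμ : 0 < μ) {u : ((Fin (k + n) → Mink) → ℂ) → ℂ}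
    (hu : IsCompactDistribution u) (hud : RapidDecayOn (forwardCovectors (k + n)) u)
    {v : ((Fin n → Mink) → ℂ) → ℂ} (hv : IsCompactDistribution v) :
    ContractExists μ k n u v := fun _ hf =>
  exists_tendsto_pairingReg hμ (hu.contractLeft hf) (hud.contractLeft hf) hv

/-- The tensor product of distributions, as a distribution in all variables. -/
def tensorDist (w : ((Fin k → Mink) → ℂ) → ℂ) (v : ((Fin n → Mink) → ℂ) → ℂ) :
    ((Fin (k + n) → Mink) → ℂ) → ℂ :=
  fun g => w fun y' => v fun y'' => g (Fin.append y' y'')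

theorem IsCompactDistribution.tensorDist {w : ((Fin k → Mink) → ℂ) → ℂ}
    {v : ((Fin n → Mink) → ℂ) → ℂ} (hw : IsCompactDistribution w) (hv : IsCompactDistribution v) :
    IsCompactDistribution (tensorDist w v) := by
  have := (hw.tensor hv).pushforward (appendVars k n)
  simp only [appendVars_apply] at this
  exact this

theorem contDiff_prod_wightman {μ : ℝ} (hμ : 0 < μ) {ε : Fin n → ℝ} (hε : ∀ i, 0 < ε i) :
    ContDiff ℝ ∞ fun z : (Fin n → Mink) × (Fin n → Mink) =>
      ∏ i, wightman μ (ε i) (z.1 i - z.2 i) := by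
  refine contDiff_prod fun i _ => ?_
  have h : ContDiff ℝ ∞ fun z : (Fin n → Mink) × (Fin n → Mink) => z.1 i - z.2 i := by fun_prop
  exact (contDiff_wightman hμ (hε i)).comp h

theorem contDiff_prod_wightman_sub {μ : ℝ} (hμ : 0 < μ) {ε : ℝ} (hε : 0 < ε) (x : Fin n → Mink) :
    ContDiff ℝ ∞ fun y : Fin n → Mink => ∏ i, wightman μ ε (x i - y i) := by
  refine contDiff_prod fun i _ => ?_
  have h : ContDiff ℝ ∞ fun y : Fin n → Mink => x i - y i := by fun_prop
  exact (contDiff_wightman hμ hε).comp h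

/-- Evaluating the inner contraction on the regularized outer kernel is one pairing with regulator
`δ` on the first `k` variables and `ε` on the rest. -/
theorem contractReg_eq_pairingMulti {μ : ℝ} (hμ : 0 < μ) {δ ε : ℝ} (hδ : 0 < δ) (hε : 0 < ε)
    (u : ((Fin (k + n) → Mink) → ℂ) → ℂ) {v : ((Fin n → Mink) → ℂ) → ℂ}
    (hv : IsCompactDistribution v) {w : ((Fin k → Mink) → ℂ) → ℂ} (hw : IsCompactDistribution w) :
    contractReg μ ε k n u v (fun x => w fun y => ∏ i, wightman μ δ (x i - y i)) =
      pairingMulti μ (Fin.append (fun _ => δ) fun _ => ε) u (tensorDist w v) := by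
  rw [contractReg, pairingMulti]
  congr 1
  ext x
  simp only [tensorDist, Fin.prod_univ_add, Fin.append_left, Fin.append_right]
  have h1 := contDiff_prod_wightman_sub hμ hε fun i => x (Fin.natAdd k i)
  have h2 := contDiff_prod_wightman_sub hμ hδ fun i => x (Fin.castAdd n i)
  simp only [hv.map_const_mul _ h1]
  exact (hw.map_mul_const _ h2).symm

/-- Closed neighbourhoods form a basis in a regular space, so inner limits stay in any closed
neighbourhood that eventually contains `F`. -/
theorem tendsto_of_tendsto_prod {α β E : Type*} [TopologicalSpace E] [RegularSpace E]
    {l : Filter α} {l' : Filter β} [l'.NeBot] {F : α → β → E} {G : α → E} {L : E}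
    (h : Tendsto (fun p : α × β => F p.1 p.2) (l ×ˢ l') (𝓝 L))
    (hG : ∀ᶠ a in l, Tendsto (F a) l' (𝓝 (G a))) : Tendsto G l (𝓝 L) := by
  refine (closed_nhds_basis L).tendsto_right_iff.2 fun V hV => ?_
  filter_upwards [(h.eventually (hV.1 : ∀ᶠ x in 𝓝 L, x ∈ V)).curry, hG] with a ha hGa
  exact hV.2.mem_of_tendsto hGa ha

theorem tendsto_append_regulator (k n : ℕ) :
    Tendsto (fun p : ℝ × ℝ => Fin.append (fun _ : Fin k => p.1) fun _ : Fin n => p.2)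
      (𝓝[>] 0 ×ˢ 𝓝[>] 0) (𝓝[{ε : Fin (k + n) → ℝ | ∀ i, 0 < ε i}] 0) := by
  refine tendsto_nhdsWithin_iff.2 ⟨?_, ?_⟩
  · refine tendsto_pi_nhds.2 fun i => ?_
    refine Fin.addCases (fun j => ?_) (fun j => ?_) i
    · simp only [Fin.append_left]
      exact tendsto_fst.mono_right nhdsWithin_le_nhds
    · simp only [Fin.append_right]
      exact tendsto_snd.mono_right nhdsWithin_le_nhds
  · have h1 : ∀ᶠ p : ℝ × ℝ in 𝓝[>] 0 ×ˢ 𝓝[>] 0, 0 < p.1 ∧ 0 < p.2 :=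
      Eventually.prod_mk (self_mem_nhdsWithin : ∀ᶠ x in 𝓝[>] (0 : ℝ), 0 < x)
        (self_mem_nhdsWithin : ∀ᶠ x in 𝓝[>] (0 : ℝ), 0 < x)
    filter_upwards [h1] with p hp i
    refine Fin.addCases (fun j => ?_) (fun j => ?_) i
    · simpa using hp.1
    · simpa using hp.2

/-- Contracting in two steps gives the same as contracting all variables at once. -/
theorem exists_tendsto_pairingReg_contract {μ : ℝ} (hμ : 0 < μ)
    {u : ((Fin (k + n) → Mink) → ℂ) → ℂ} (hu : IsCompactDistribution u)
    (hud : RapidDecayOn (forwardCovectors (k + n)) u) {v : ((Fin n → Mink) → ℂ) → ℂ}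
    (hv : IsCompactDistribution v) {w : ((Fin k → Mink) → ℂ) → ℂ} (hw : IsCompactDistribution w) :
    Tendsto (fun δ => pairingReg μ δ k (contract μ k n u v) w) (𝓝[>] 0)
      (𝓝 (pairing μ (k + n) u (tensorDist w v))) := by
  obtain ⟨L, hL⟩ := exists_tendsto_pairingMulti hμ hu hud (hw.tensorDist hv)
  have h1 : pairing μ (k + n) u (tensorDist w v) = L :=
    (hL.comp (tendsto_const_regulator (k + n))).limUnder_eq
  rw [h1]
  refine tendsto_of_tendsto_prod (F := fun δ ε =>
    pairingMulti μ (Fin.append (fun _ => δ) fun _ => ε) u (tensorDist w v)) (l' := 𝓝[>] 0) (hL.comp (tendsto_append_regulator k n)) ?_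
  filter_upwards [self_mem_nhdsWithin] with δ hδ
  -- For fixed `δ > 0` the outer kernel is a smooth test function, so the inner limit `ε → 0+`
  -- exists.
  have hf : ContDiff ℝ ∞ fun x : Fin k → Mink => w fun y => ∏ i, wightman μ δ (x i - y i) :=
    hw.contDiff_param (contDiff_prod_wightman hμ (ε := fun _ => δ) fun _ => hδ)
  have h2 := tendsto_nhds_limUnder (contractExists hμ hu hud hv _ hf)
  refine h2.congr' ?_
  filter_upwards [self_mem_nhdsWithin] with ε hε
  exact contractReg_eq_pairingMulti hμ hδ hε u hv hw

end Contractions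

/-! ### Symmetry of iterated directional derivatives. -/

section DirectionalDerivatives

theorem Config.ext {φ ψ : Config} (h : ∀ x, φ.toFun x = ψ.toFun x) : φ = ψ := by
  cases φ; cases ψ
  congr
  exact funext h

namespace Config

theorem shift_zero (φ χ : Config) : φ.shift 0 χ = φ := Config.ext fun x => by simp [shift]

theorem shift_add (φ χ : Config) (s t : ℝ) : (φ.shift s χ).shift t χ = φ.shift (s + t) χ :=
  Config.ext fun x => by simp only [shift]; ring

theorem shift_comm (φ χ χ' : Config) (s t : ℝ) :
    (φ.shift s χ).shift t χ' = (φ.shift t χ').shift s χ :=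
  Config.ext fun x => by simp only [shift]; ring

theorem jet_shift (m : ℕ) (φ χ : Config) (s : ℝ) (x : Mink) :
    (φ.shift s χ).jet m x = φ.jet m x + s • χ.jet m x := by
  have h1 : ContDiffAt ℝ m φ.toFun x := (φ.smooth.of_le (by exact_mod_cast le_top)).contDiffAt
  have h2 : ContDiffAt ℝ m χ.toFun x := (χ.smooth.of_le (by exact_mod_cast le_top)).contDiffAt
  change iteratedFDeriv ℝ m (φ.toFun + s • χ.toFun) x = _
  have h3 : ContDiffAt ℝ m (s • χ.toFun) x := h2.const_smul s
  rw [iteratedFDeriv_add_apply h1 h3, iteratedFDeriv_const_smul_apply h2]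
  rfl

theorem continuous_iff {S : Type*} [TopologicalSpace S] {f : S → Config} :
    Continuous f ↔ ∀ m, Continuous fun s => (f s).jet m := by
  rw [continuous_iInf_rng]
  exact forall_congr' fun m => continuous_induced_rng

theorem continuous_shift_shift (φ χ χ' : Config) :
    Continuous fun p : ℝ × ℝ => (φ.shift p.1 χ).shift p.2 χ' := by
  refine continuous_iff.2 fun m => ContinuousMap.continuous_of_continuous_uncurry _ ?_
  simp only [Function.uncurry_def, jet_shift]
  have h : ∀ ψ : Config, Continuous fun q : (ℝ × ℝ) × Mink => ψ.jet m q.2 := fun ψ =>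
    (ψ.jet m).continuous.comp continuous_snd
  exact ((h φ).add ((continuous_fst.comp continuous_fst).smul (h χ))).add
    ((continuous_snd.comp continuous_fst).smul (h χ'))

end Config

/-- Symmetry of mixed second derivatives, with continuity of one of them only. -/
theorem hasDerivAt_mixed {h h₂ h₁₂ : ℝ → ℝ → ℂ} {h₁ : ℝ → ℂ}
    (H : ∀ s t, HasDerivAt (fun t => h s t) (h₂ s t) t) (hc : ∀ s, Continuous fun t => h₂ s t)
    (H' : ∀ s t, HasDerivAt (fun s => h₂ s t) (h₁₂ s t) s)
    (hc' : Continuous fun p : ℝ × ℝ => h₁₂ p.1 p.2)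
    (H₁ : ∀ t, HasDerivAt (fun s => h s t) (h₁ t) 0) : HasDerivAt h₁ (h₁₂ 0 0) 0 := by
  have hc0 : Continuous fun t => h₁₂ 0 t := hc'.comp (continuous_const.prodMk continuous_id)
  -- Differentiate $h(s,T)-h(s,0)=\int_0^T h_2(s,t)\,dt$ under the integral at $s=0$; the
  -- fundamental theorem of calculus in $T$ then finishes the proof.
  have key : ∀ T, h₁ T = h₁ 0 + ∫ t in (0 : ℝ)..T, h₁₂ 0 t := by
    intro T
    obtain ⟨b, hb⟩ := ((isCompact_closedBall (0 : ℝ) 1).prod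
      (isCompact_uIcc (a := (0 : ℝ)) (b := T))).exists_bound_of_continuousOn hc'.continuousOn
    have h1 := (intervalIntegral.hasDerivAt_integral_of_dominated_loc_of_deriv_le
      (μ := MeasureTheory.volume) (a := 0) (b := T) (F := h₂) (F' := h₁₂) (x₀ := (0 : ℝ))
      (bound := fun _ => b)
      (Metric.closedBall_mem_nhds 0 one_pos)
      (Filter.Eventually.of_forall fun s => (hc s).aestronglyMeasurable)
      ((hc 0).intervalIntegrable _ _) hc0.aestronglyMeasurable
      (Filter.Eventually.of_forall fun t ht s hs => hb (s, t) ⟨hs, Set.uIoc_subset_uIcc ht⟩)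
      intervalIntegrable_const
      (Filter.Eventually.of_forall fun t _ s _ => H' s t)).2
    have h2 : (fun s => ∫ t in (0 : ℝ)..T, h₂ s t) = fun s => h s T - h s 0 := by
      ext s
      exact intervalIntegral.integral_eq_sub_of_hasDerivAt (fun t _ => H s t)
        ((hc s).intervalIntegrable _ _)
    rw [h2] at h1
    rw [h1.unique ((H₁ T).sub (H₁ 0))]
    ring
  rw [funext key]
  exact (hc0.integral_hasStrictDerivAt 0 0).hasDerivAt.const_add _

variable {F G : Functional}

/-- Differentiability is postulated only at parameter `0`; shifting the base point transports it to
every `s`. -/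
theorem IsSmoothFunctional.hasDerivAt (hF : IsSmoothFunctional F) (n : ℕ) (φ χ : Config)
    (ψ : Fin n → Config) (s : ℝ) : HasDerivAt (fun s => gateaux F n (φ.shift s χ) ψ)
      (gateaux F (n + 1) (φ.shift s χ) (Fin.cons χ ψ)) s := by
  have h1 := (hF.1 n (φ.shift s χ) χ ψ).hasDerivAt
  have h2 : HasDerivAt (fun t => gateaux F n ((φ.shift s χ).shift t χ) ψ)
      (gateaux F (n + 1) (φ.shift s χ) (Fin.cons χ ψ)) (s - s) := by
    rw [sub_self]; exact h1
  have h3 := h2.comp_sub_const s s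
  simpa only [Config.shift_add, add_sub_cancel] using h3

/-- Mixed partial derivatives of the two-parameter family $\varphi+s\chi+t\chi'$. -/
theorem IsSmoothFunctional.gateaux_cons_cons (hF : IsSmoothFunctional F) (n : ℕ) (φ χ χ' : Config)
    (ψ : Fin n → Config) : gateaux F (n + 2) φ (Fin.cons χ (Fin.cons χ' ψ)) =
      gateaux F (n + 2) φ (Fin.cons χ' (Fin.cons χ ψ)) := by
  have hcont : ∀ (m : ℕ) (ψ : Fin m → Config),
      Continuous fun p : ℝ × ℝ => gateaux F m ((φ.shift p.1 χ).shift p.2 χ') ψ := fun m ψ =>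
    (hF.2 m).comp ((Config.continuous_shift_shift φ χ χ').prodMk continuous_const)
  have h := hasDerivAt_mixed (h := fun s t => gateaux F n ((φ.shift s χ).shift t χ') ψ)
    (h₂ := fun s t => gateaux F (n + 1) ((φ.shift s χ).shift t χ') (Fin.cons χ' ψ))
    (h₁₂ := fun s t => gateaux F (n + 2) ((φ.shift s χ).shift t χ') (Fin.cons χ (Fin.cons χ' ψ)))
    (h₁ := fun t => gateaux F (n + 1) (φ.shift t χ') (Fin.cons χ ψ))
    (fun s t => hF.hasDerivAt n _ χ' ψ t)
    (fun s => (hcont (n + 1) (Fin.cons χ' ψ)).comp (continuous_const.prodMk continuous_id))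
    (fun s t => by
      simp only [Config.shift_comm φ χ χ']
      exact hF.hasDerivAt (n + 1) _ χ _ s)
    (hcont (n + 2) _)
    (fun t => by
      have := hF.hasDerivAt n (φ.shift t χ') χ ψ 0
      simpa only [Config.shift_comm φ χ χ', Config.shift_zero] using this)
  have h' := hF.hasDerivAt (n + 1) φ χ' (Fin.cons χ ψ) 0
  simpa only [Config.shift_zero] using h.unique h'

/-- Swapping the first two directions is the symmetry of mixed derivatives; any later adjacent swap
happens beneath the outermost derivative, by induction. -/
theorem IsSmoothFunctional.gateaux_comp_swap (hF : IsSmoothFunctional F) : ∀ (n : ℕ) (φ : Config)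
    (ψ : Fin (n + 1) → Config) (i : Fin n),
    gateaux F (n + 1) φ (fun j => ψ (Equiv.swap i.castSucc i.succ j)) = gateaux F (n + 1) φ ψ := by
  intro n
  induction n with
  | zero => exact fun _ _ i => i.elim0
  | succ n ih =>
    intro φ ψ i
    refine Fin.cases ?_ (fun i => ?_) i
    · have h1 : ψ = Fin.cons (ψ 0) (Fin.cons (ψ 1) fun j => ψ j.succ.succ) := by
        ext1 j
        refine Fin.cases rfl (fun j => ?_) j
        refine Fin.cases rfl (fun j => ?_) j
        simp
      have h2 : (fun j => ψ (Equiv.swap (0 : Fin (n + 1)).castSucc (0 : Fin (n + 1)).succ j)) =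
          Fin.cons (ψ 1) (Fin.cons (ψ 0) fun j => ψ j.succ.succ) := by
        ext1 j
        refine Fin.cases (by simp) (fun j => ?_) j
        refine Fin.cases (by simp) (fun j => ?_) j
        rw [Equiv.swap_apply_of_ne_of_ne]
        · simp
        · simp [Fin.ext_iff]
        · simp [Fin.ext_iff]
      rw [h2, hF.gateaux_cons_cons, ← h1]
    · change deriv _ 0 = deriv _ 0
      congr 1
      ext s
      have h1 : Equiv.swap i.succ.castSucc i.succ.succ 0 = 0 :=
        Equiv.swap_apply_of_ne_of_ne (by simp [Fin.ext_iff]) (by simp [Fin.ext_iff])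
      simp only [h1]
      rw [← ih _ (fun j => ψ j.succ) i]
      congr 1
      ext1 j
      congr 1
      have := (Fin.succ_injective (n + 1)).swap_apply i.castSucc i.succ j
      rwa [Fin.succ_castSucc] at this

theorem IsSmoothFunctional.gateaux_comp_perm (hF : IsSmoothFunctional F) (n : ℕ) (φ : Config)
    (ψ : Fin n → Config) (σ : Equiv.Perm (Fin n)) :
    gateaux F n φ (fun j => ψ (σ j)) = gateaux F n φ ψ := by
  rcases n with _ | n
  · rfl
  have hσ : σ ∈ Submonoid.closure (Set.range fun i : Fin n => Equiv.swap i.castSucc i.succ) := by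
    rw [Equiv.Perm.mclosure_swap_castSucc_succ]; trivial
  induction hσ using Submonoid.closure_induction generalizing ψ with
  | mem σ hσ => obtain ⟨i, rfl⟩ := hσ; exact hF.gateaux_comp_swap n φ ψ i
  | one => rfl
  | mul σ τ _ _ h h' => exact (h' fun j => ψ (σ j)).trans (h ψ)

end DirectionalDerivatives

/-! ### Uniqueness and symmetry of functional derivatives. -/

section Density

variable {n : ℕ}

/-- The real and imaginary parts of a plane wave of one particle, as configurations. -/
def trigConfig (k : Mink) (b : Bool) : Config where
  toFun x := bif b then Real.cos (k.1 * x.1 + k.2 * x.2) else Real.sin (k.1 * x.1 + k.2 * x.2)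
  smooth := by
    have h : ContDiff ℝ ∞ fun x : Mink => k.1 * x.1 + k.2 * x.2 := by fun_prop
    cases b
    · exact h.sin
    · exact h.cos

theorem contDiff_prod_config (ψ : Fin n → Config) :
    ContDiff ℝ ∞ fun x : Fin n → Mink => ∏ i, ((ψ i).toFun (x i) : ℂ) := by
  refine contDiff_prod fun i _ => ?_
  have h : ContDiff ℝ ∞ fun x : Fin n → Mink => x i := by fun_prop
  exact Complex.ofRealCLM.contDiff.comp ((ψ i).smooth.comp h)

/-- Configurations are real, so each exponential factor is split as $\cos\theta-i\sin\theta$ to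
reach products of configurations. -/
theorem planeWave_eq_sum (k x : Fin n → Mink) : planeWave k x = ∑ b : Fin n → Bool,
    (∏ i, (bif b i then 1 else -Complex.I : ℂ)) *
      ∏ i, ((trigConfig (k i) (b i)).toFun (x i) : ℂ) := by
  have h : ∀ θ : ℝ, Complex.exp (-(Complex.I * (θ : ℂ))) =
      ∑ b : Bool, (bif b then 1 else -Complex.I : ℂ) *
        ((bif b then Real.cos θ else Real.sin θ : ℝ) : ℂ) := by
    intro θ
    rw [← mul_neg, mul_comm, Complex.exp_mul_I]
    simp
    ring
  rw [planeWave_eq_prod]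
  simp only [h, Finset.prod_univ_sum, Fintype.piFinset_univ, ← Finset.prod_mul_distrib]
  rfl

/-- Distributions with compact support which agree on products of configurations are equal. -/
theorem IsCompactDistribution.ext_prod {u v : ((Fin n → Mink) → ℂ) → ℂ}
    (hu : IsCompactDistribution u) (hv : IsCompactDistribution v)
    (h : ∀ ψ : Fin n → Config, u (fun x => ∏ i, ((ψ i).toFun (x i) : ℂ)) =
      v (fun x => ∏ i, ((ψ i).toFun (x i) : ℂ)))
    {f : (Fin n → Mink) → ℂ} (hf : ContDiff ℝ ∞ f) : u f = v f := by
  refine hu.ext_planeWave hv (fun k => ?_) hf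
  have hs : ∀ b : Fin n → Bool, ContDiff ℝ ∞ fun x : Fin n → Mink =>
      ∏ i, ((trigConfig (k i) (b i)).toFun (x i) : ℂ) := fun b => contDiff_prod_config _
  rw [funext (planeWave_eq_sum k), hu.map_sum _ fun b _ => contDiff_const.mul (hs b),
    hv.map_sum _ fun b _ => contDiff_const.mul (hs b)]
  refine Finset.sum_congr rfl fun b _ => ?_
  rw [hu.map_const_mul _ (hs b), hv.map_const_mul _ (hs b), h]

/-- Makes the choice in `funDeriv` harmless: any explicit kernel may be substituted on smooth
functions. -/
theorem IsFunDeriv.eq_of_contDiff {F : Functional} {φ : Config} {u v : ((Fin n → Mink) → ℂ) → ℂ}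
    (hu : IsFunDeriv F n φ u) (hv : IsFunDeriv F n φ v) {f : (Fin n → Mink) → ℂ}
    (hf : ContDiff ℝ ∞ f) : u f = v f :=
  hu.1.ext_prod hv.1 (fun ψ => (hu.2 ψ).trans (hv.2 ψ).symm) hf

/-- Functional derivatives are symmetric in their variables. -/
theorem IsFunDeriv.comp_perm {F : Functional} (hF : IsSmoothFunctional F) {φ : Config}
    {u : ((Fin n → Mink) → ℂ) → ℂ} (hu : IsFunDeriv F n φ u) (σ : Equiv.Perm (Fin n))
    {f : (Fin n → Mink) → ℂ} (hf : ContDiff ℝ ∞ f) : u (fun x => f fun i => x (σ i)) = u f := by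
  refine (hu.1.pushforward (pullVars σ)).ext_prod hu.1 (fun ψ => ?_) hf
  simp only [pullVars_apply]
  have h : ∀ x : Fin n → Mink, ∏ i, ((ψ i).toFun (x (σ i)) : ℂ) =
      ∏ i, ((ψ (σ.symm i)).toFun (x i) : ℂ) := fun x =>
    Fintype.prod_equiv σ _ _ fun i => by simp
  simp only [h]
  rw [hu.2 fun i => ψ (σ.symm i), hu.2 ψ, hF.gateaux_comp_perm n φ ψ σ.symm]

theorem IsFunDeriv.eq_zero {F : Functional} {φ : Config} {u : ((Fin n → Mink) → ℂ) → ℂ}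
    (hu : IsFunDeriv F n φ u) (h : ∀ ψ, gateaux F n φ ψ = 0) {f : (Fin n → Mink) → ℂ}
    (hf : ContDiff ℝ ∞ f) : u f = 0 :=
  hu.1.ext_prod IsCompactDistribution.zero (fun ψ => (hu.2 ψ).trans (h ψ)) hf

end Density

/-! ### The Leibniz rule for directional and functional derivatives. -/

section Leibniz

/-- A distribution of `n` labels to two factors, which receive `k` and `m` of them. -/
structure Split (n : ℕ) where
  k : ℕ
  m : ℕ
  σ : Fin k ⊕ Fin m ≃ Fin n

namespace Split

variable {n : ℕ}

/-- The new label `0` goes to the first factor. -/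
def consLeft (s : Split n) : Split (n + 1) where
  k := s.k + 1
  m := s.m
  σ :=
    { toFun := Sum.elim (Fin.cons 0 fun i => (s.σ (Sum.inl i)).succ) fun j => (s.σ (Sum.inr j)).succ
      invFun := Fin.cons (Sum.inl 0) fun i => Sum.map Fin.succ id (s.σ.symm i)
      left_inv := by
        rintro (i | j)
        · refine Fin.cases ?_ (fun i => ?_) i <;> simp
        · simp
      right_inv := fun i => by
        refine Fin.cases ?_ (fun i => ?_) i
        · simp
        · rcases h : s.σ.symm i with j | j <;> simp [h, (s.σ.symm_apply_eq.1 h).symm] }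

/-- The new label `0` goes to the second factor. -/
def consRight (s : Split n) : Split (n + 1) where
  k := s.k
  m := s.m + 1
  σ :=
    { toFun := Sum.elim (fun j => (s.σ (Sum.inl j)).succ) (Fin.cons 0 fun i => (s.σ (Sum.inr i)).succ)
      invFun := Fin.cons (Sum.inr 0) fun i => Sum.map id Fin.succ (s.σ.symm i)
      left_inv := by
        rintro (j | i)
        · simp
        · refine Fin.cases ?_ (fun i => ?_) i <;> simp
      right_inv := fun i => by
        refine Fin.cases ?_ (fun i => ?_) i
        · simp
        · rcases h : s.σ.symm i with j | j <;> simp [h, (s.σ.symm_apply_eq.1 h).symm] }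

end Split

/-- All distributions of `n` labels to two factors. -/
def splits : (n : ℕ) → List (Split n)
  | 0 => [⟨0, 0, Equiv.equivOfIsEmpty _ _⟩]
  | n + 1 => (splits n).map Split.consLeft ++ (splits n).map Split.consRight

/-- There are $\binom{n}{k}$ splits with `k` labels in the first factor: the recursion defining
`splits` is Pascal's rule. -/
theorem sum_splits {M : Type*} [AddCommMonoid M] (n : ℕ) (g : ℕ → ℕ → M) :
    ((splits n).map fun s => g s.k s.m).sum =
      ∑ p ∈ Finset.HasAntidiagonal.antidiagonal n, n.choose p.1 • g p.1 p.2 := by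
  induction n generalizing g with
  | zero => simp [splits]
  | succ n ih =>
    rw [Finset.sum_antidiagonal_choose_succ_nsmul, splits, List.map_append, List.sum_append,
      List.map_map, List.map_map, add_comm]
    congr 1
    · exact ih fun k m => g k (m + 1)
    · refine (ih fun k m => g (k + 1) m).trans (Finset.sum_congr rfl fun p hp => ?_)
      rw [Nat.choose_symm_of_eq_add (Finset.HasAntidiagonal.mem_antidiagonal.1 hp).symm]

variable {F G : Functional}

theorem hasDerivAt_list_sum {ι : Type*} (l : List ι) {f : ι → ℝ → ℂ} {f' : ι → ℂ} {x : ℝ}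
    (h : ∀ i, HasDerivAt (f i) (f' i) x) :
    HasDerivAt (fun s => (l.map fun i => f i s).sum) (l.map f').sum x := by
  induction l with
  | nil => simpa using hasDerivAt_const x (0 : ℂ)
  | cons a l ih => simpa using (h a).fun_add ih

theorem IsSmoothFunctional.hasDerivAt_zero (hF : IsSmoothFunctional F) (n : ℕ) (φ χ : Config)
    (ψ : Fin n → Config) : HasDerivAt (fun s => gateaux F n (φ.shift s χ) ψ)
      (gateaux F (n + 1) φ (Fin.cons χ ψ)) 0 := by
  simpa only [Config.shift_zero] using hF.hasDerivAt n φ χ ψ 0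

theorem hasDerivAt_split (hF : IsSmoothFunctional F) (hG : IsSmoothFunctional G) {n : ℕ}
    (s : Split n) (φ χ : Config) (ψ : Fin n → Config) :
    HasDerivAt (fun t => gateaux F s.k (φ.shift t χ) (fun i => ψ (s.σ (Sum.inl i))) *
        gateaux G s.m (φ.shift t χ) fun i => ψ (s.σ (Sum.inr i)))
      (gateaux F (s.k + 1) φ (Fin.cons χ fun i => ψ (s.σ (Sum.inl i))) *
          gateaux G s.m φ (fun i => ψ (s.σ (Sum.inr i))) +
        gateaux F s.k φ (fun i => ψ (s.σ (Sum.inl i))) *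
          gateaux G (s.m + 1) φ (Fin.cons χ fun i => ψ (s.σ (Sum.inr i)))) 0 := by
  have := (hF.hasDerivAt_zero s.k φ χ fun i => ψ (s.σ (Sum.inl i))).fun_mul
    (hG.hasDerivAt_zero s.m φ χ fun i => ψ (s.σ (Sum.inr i)))
  simpa only [Config.shift_zero] using this

/-- The Leibniz rule. -/
theorem gateaux_mul (hF : IsSmoothFunctional F) (hG : IsSmoothFunctional G) (n : ℕ) (φ : Config)
    (ψ : Fin n → Config) : gateaux (F * G) n φ ψ = ((splits n).map fun s =>
      gateaux F s.k φ (fun i => ψ (s.σ (Sum.inl i))) *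
        gateaux G s.m φ fun i => ψ (s.σ (Sum.inr i))).sum := by
  induction n generalizing φ with
  | zero => simp [splits, gateaux]
  | succ n ih =>
    change deriv _ 0 = _
    simp only [ih]
    -- The outermost derivative, in direction `ψ 0`, falls on the first or the second factor, which
    -- matches `consLeft` and `consRight`.
    rw [(hasDerivAt_list_sum (splits n) fun s =>
      hasDerivAt_split hF hG s φ (ψ 0) fun i => ψ i.succ).deriv, List.sum_map_add, splits,
      List.map_append, List.sum_append, List.map_map, List.map_map]
    rfl

theorem IsSmoothFunctional.mul (hF : IsSmoothFunctional F) (hG : IsSmoothFunctional G) :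
    IsSmoothFunctional (F * G) := by
  refine ⟨fun n φ χ ψ => ?_, fun n => ?_⟩
  · simp only [gateaux_mul hF hG]
    exact (hasDerivAt_list_sum (splits n) fun s =>
      hasDerivAt_split hF hG s φ χ ψ).differentiableAt
  · simp only [gateaux_mul hF hG]
    refine continuous_list_sum _ fun s _ => ?_
    have hc : ∀ {k : ℕ} (τ : Fin k → Fin n), Continuous fun p : Config × (Fin n → Config) =>
        (p.1, fun i => p.2 (τ i)) := fun τ => continuous_fst.prodMk
      (continuous_pi fun i => (continuous_apply (τ i)).comp continuous_snd)
    exact ((hF.2 s.k).comp (hc _)).mul ((hG.2 s.m).comp (hc _))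

theorem gateaux_sum {ι : Type*} (t : Finset ι) {F : ι → Functional}
    (hF : ∀ i ∈ t, IsSmoothFunctional (F i)) (n : ℕ) (φ : Config) (ψ : Fin n → Config) :
    gateaux (∑ i ∈ t, F i) n φ ψ = ∑ i ∈ t, gateaux (F i) n φ ψ := by
  induction n generalizing φ with
  | zero => simp [gateaux]
  | succ n ih =>
    change deriv _ 0 = _
    simp only [ih]
    exact deriv_fun_sum fun i hi => (hF i hi).1 n φ _ _

theorem IsSmoothFunctional.sum {ι : Type*} (t : Finset ι) {F : ι → Functional}
    (hF : ∀ i ∈ t, IsSmoothFunctional (F i)) : IsSmoothFunctional (∑ i ∈ t, F i) := by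
  refine ⟨fun n φ χ ψ => ?_, fun n => ?_⟩
  · simp only [gateaux_sum t hF]
    exact DifferentiableAt.fun_sum fun i hi => (hF i hi).1 n φ χ ψ
  · simp only [gateaux_sum t hF]
    exact continuous_finsetSum t fun i hi => (hF i hi).2 n

variable {n : ℕ}

/-- The labels of a split, enumerated. -/
def Split.enum (s : Split n) : Fin (s.k + s.m) ≃ Fin n := finSumFinEquiv.symm.trans s.σ

/-- The kernel of a summand of the Leibniz rule. -/
def splitDist (s : Split n) (w : ((Fin s.k → Mink) → ℂ) → ℂ) (v : ((Fin s.m → Mink) → ℂ) → ℂ) :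
    ((Fin n → Mink) → ℂ) → ℂ :=
  fun f => tensorDist w v fun z => f fun i => z (s.enum.symm i)

theorem IsCompactDistribution.splitDist (s : Split n) {w : ((Fin s.k → Mink) → ℂ) → ℂ}
    {v : ((Fin s.m → Mink) → ℂ) → ℂ} (hw : IsCompactDistribution w)
    (hv : IsCompactDistribution v) : IsCompactDistribution (splitDist s w v) :=
  (hw.tensorDist hv).pushforward (pullVars s.enum.symm)

theorem splitDist_prod (s : Split n) {w : ((Fin s.k → Mink) → ℂ) → ℂ}
    {v : ((Fin s.m → Mink) → ℂ) → ℂ} (hw : IsCompactDistribution w)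
    (hv : IsCompactDistribution v) (ψ : Fin n → Config) :
    splitDist s w v (fun x => ∏ i, ((ψ i).toFun (x i) : ℂ)) =
      w (fun y => ∏ i, ((ψ (s.σ (Sum.inl i))).toFun (y i) : ℂ)) *
        v fun y => ∏ i, ((ψ (s.σ (Sum.inr i))).toFun (y i) : ℂ) := by
  have h : ∀ z : Fin (s.k + s.m) → Mink, ∏ i, ((ψ i).toFun (z (s.enum.symm i)) : ℂ) =
      ∏ i, ((ψ (s.enum i)).toFun (z i) : ℂ) := fun z =>
    (Fintype.prod_equiv s.enum _ _ fun i => by simp).symm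
  simp only [splitDist, tensorDist, h, Fin.prod_univ_add, Fin.append_left, Fin.append_right]
  simp only [Split.enum, Equiv.trans_apply, finSumFinEquiv_symm_apply_castAdd,
    finSumFinEquiv_symm_apply_natAdd]
  simp only [hv.map_const_mul _ (contDiff_prod_config _)]
  exact hw.map_mul_const _ (contDiff_prod_config _)

theorem IsFunDeriv.mul (hF : IsSmoothFunctional F) (hG : IsSmoothFunctional G) {φ : Config}
    {w : (k : ℕ) → ((Fin k → Mink) → ℂ) → ℂ} {v : (m : ℕ) → ((Fin m → Mink) → ℂ) → ℂ}
    (hw : ∀ k, IsFunDeriv F k φ (w k)) (hv : ∀ m, IsFunDeriv G m φ (v m)) :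
    IsFunDeriv (F * G) n φ fun f =>
      ((splits n).map fun s => splitDist s (w s.k) (v s.m) f).sum := by
  refine ⟨IsCompactDistribution.list_sum _ fun s => (hw _).1.splitDist s (hv _).1, fun ψ => ?_⟩
  rw [gateaux_mul hF hG]
  refine congrArg List.sum (List.map_congr_left fun s _ => ?_)
  rw [splitDist_prod s (hw _).1 (hv _).1, (hw _).2, (hv _).2]

theorem IsFunDeriv.sum {ι : Type*} (t : Finset ι) {F : ι → Functional} {φ : Config}
    {u : ι → ((Fin n → Mink) → ℂ) → ℂ} (hF : ∀ i ∈ t, IsSmoothFunctional (F i))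
    (hu : ∀ i ∈ t, IsFunDeriv (F i) n φ (u i)) :
    IsFunDeriv (∑ i ∈ t, F i) n φ fun f => ∑ i ∈ t, u i f :=
  ⟨IsCompactDistribution.sum t fun i hi => (hu i hi).1, fun ψ => by
    rw [gateaux_sum t hF]
    exact Finset.sum_congr rfl fun i hi => (hu i hi).2 ψ⟩

theorem HasFunDerivs.mul (hF : HasFunDerivs F) (hG : HasFunDerivs G) : HasFunDerivs (F * G) :=
  ⟨hF.1.mul hG.1, fun _ φ => ⟨_, IsFunDeriv.mul hF.1 hG.1
    (fun k => isFunDeriv_funDeriv hF k φ) fun m => isFunDeriv_funDeriv hG m φ⟩⟩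

theorem HasFunDerivs.sum {ι : Type*} (t : Finset ι) {F : ι → Functional}
    (hF : ∀ i ∈ t, HasFunDerivs (F i)) : HasFunDerivs (∑ i ∈ t, F i) :=
  ⟨IsSmoothFunctional.sum t fun i hi => (hF i hi).1, fun n φ => ⟨_, IsFunDeriv.sum t
    (fun i hi => (hF i hi).1) fun i hi => isFunDeriv_funDeriv (hF i hi) n φ⟩⟩

end Leibniz

/-! ### Contractions with the derivatives of a product. -/

section ProductContractions

open Filter Topology

theorem IsCompactDistribution.map_list_sum {X : Type} [NormedAddCommGroup X] [NormedSpace ℝ X]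
    {u : (X → ℂ) → ℂ} (hu : IsCompactDistribution u) {ι : Type*} (l : List ι) {f : ι → X → ℂ}
    (hf : ∀ i, ContDiff ℝ ∞ (f i)) :
    ContDiff ℝ ∞ (fun x => (l.map fun i => f i x).sum) ∧
      u (fun x => (l.map fun i => f i x).sum) = (l.map fun i => u (f i)).sum := by
  induction l with
  | nil => simpa using ⟨contDiff_const, hu.map_zero⟩
  | cons a l ih =>
    simp only [List.map_cons, List.sum_cons]
    refine ⟨(hf a).add ih.1, ?_⟩
    rw [← ih.2]
    exact hu.map_add _ _ (hf a) ih.1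

variable {A B C F G : Functional} {n k m : ℕ}

theorem contDiff_apply_prod_wightman {μ ε : ℝ} (hμ : 0 < μ) (hε : 0 < ε)
    {v : ((Fin n → Mink) → ℂ) → ℂ} (hv : IsCompactDistribution v) :
    ContDiff ℝ ∞ fun x : Fin n → Mink => v fun y => ∏ i, wightman μ ε (x i - y i) :=
  hv.contDiff_param (contDiff_prod_wightman hμ (ε := fun _ => ε) fun _ => hε)

/-- By symmetry, the contraction with a summand of the Leibniz rule depends only on the numbers
of derivatives acting on the two factors. -/
theorem pairingReg_splitDist {μ ε : ℝ} (hμ : 0 < μ) (hε : 0 < ε) (hA : HasFunDerivs A) (φ : Config)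
    (s : Split n) {w : ((Fin s.k → Mink) → ℂ) → ℂ} {v : ((Fin s.m → Mink) → ℂ) → ℂ}
    (hw : IsCompactDistribution w) (hv : IsCompactDistribution v) :
    pairingReg μ ε n (funDeriv A n φ) (splitDist s w v) =
      pairingReg μ ε (s.k + s.m) (funDeriv A (s.k + s.m) φ) (tensorDist w v) := by
  obtain ⟨k, m, σ⟩ := s
  obtain rfl : k + m = n := by simpa using Fintype.card_congr σ
  let e : Equiv.Perm (Fin (k + m)) := Split.enum ⟨k, m, σ⟩
  -- Symmetry of the derivative of `A` permutes its variables; the product of two-point functions is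
  -- unchanged when both sets of variables are permuted together.
  rw [pairingReg, pairingReg, ← (isFunDeriv_funDeriv hA (k + m) φ).comp_perm hA.1 e
    (contDiff_apply_prod_wightman hμ hε (hw.tensorDist hv))]
  congr 1
  ext x
  simp only [splitDist]
  congr 1
  ext z
  exact Fintype.prod_equiv e.symm _ _ fun i => by simp [e]

/-- The contraction of `A^(k+m)` with `F^(k) ⊗ G^(m)`. -/
def splitPairing (μ : ℝ) (φ : Config) (A F G : Functional) (k m : ℕ) : ℂ :=
  pairing μ (k + m) (funDeriv A (k + m) φ) (tensorDist (funDeriv F k φ) (funDeriv G m φ))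

theorem tendsto_splitPairing {μ : ℝ} (hμ : 0 < μ) (hA : IsMicrocausal A) (hF : HasFunDerivs F)
    (hG : HasFunDerivs G) (φ : Config) (k m : ℕ) :
    Tendsto (fun ε => pairingReg μ ε (k + m) (funDeriv A (k + m) φ)
      (tensorDist (funDeriv F k φ) (funDeriv G m φ))) (𝓝[>] 0)
      (𝓝 (splitPairing μ φ A F G k m)) :=
  tendsto_nhds_limUnder (exists_tendsto_pairingReg hμ (isFunDeriv_funDeriv hA.1 _ φ).1
    (hA.rapidDecayOn _ φ)
    ((isFunDeriv_funDeriv hF k φ).1.tensorDist (isFunDeriv_funDeriv hG m φ).1))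

/-- The kernel of `F` vanishes on smooth functions, and it is the outer factor of the tensor
product, applied to a function that is smooth because the other factor depends smoothly on
parameters. -/
theorem splitPairing_eq_zero {μ : ℝ} (hμ : 0 < μ) (hA : HasFunDerivs A) (hF : HasFunDerivs F)
    (hG : HasFunDerivs G) (φ : Config) (h : ∀ ψ, gateaux F k φ ψ = 0) (m : ℕ) :
    splitPairing μ φ A F G k m = 0 := by
  refine Tendsto.limUnder_eq (tendsto_const_nhds.congr' ?_)
  filter_upwards [self_mem_nhdsWithin] with ε hε
  refine ((isFunDeriv_funDeriv hA (k + m) φ).1.map_zero).symm.trans ?_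
  rw [pairingReg]
  congr 1
  ext x
  refine ((isFunDeriv_funDeriv hF k φ).eq_zero h ?_).symm
  have h1 := (contDiff_prod_wightman_sub hμ hε x).comp (appendVars k m).contDiff
  simp only [Function.comp_def, appendVars_apply] at h1
  exact (isFunDeriv_funDeriv hG m φ).1.contDiff_param h1

/-- The contraction of `A^(n)` with the `n`-th derivative of a sum of products. -/
theorem tendsto_pairingReg_sum_mul {μ : ℝ} (hμ : 0 < μ) (hA : IsMicrocausal A) {ι : Type*}
    (t : Finset ι) {F G : ι → Functional} (hF : ∀ i ∈ t, HasFunDerivs (F i))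
    (hG : ∀ i ∈ t, HasFunDerivs (G i)) (n : ℕ) (φ : Config) :
    Tendsto (fun ε => pairingReg μ ε n (funDeriv A n φ) (funDeriv (∑ i ∈ t, F i * G i) n φ))
      (𝓝[>] 0) (𝓝 (∑ i ∈ t, ∑ p ∈ Finset.HasAntidiagonal.antidiagonal n,
        n.choose p.1 • splitPairing μ φ A (F i) (G i) p.1 p.2)) := by
  have hu := isFunDeriv_funDeriv hA.1 n φ
  have hd : ∀ i ∈ t, IsFunDeriv (F i * G i) n φ fun f => ((splits n).map fun s =>
      splitDist s (funDeriv (F i) s.k φ) (funDeriv (G i) s.m φ) f).sum := fun i hi =>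
    IsFunDeriv.mul (hF i hi).1 (hG i hi).1 (fun k => isFunDeriv_funDeriv (hF i hi) k φ)
      fun m => isFunDeriv_funDeriv (hG i hi) m φ
  have hsum := IsFunDeriv.sum t (fun i hi => (hF i hi).1.mul (hG i hi).1) hd
  have hall := isFunDeriv_funDeriv (HasFunDerivs.sum t fun i hi => (hF i hi).mul (hG i hi)) n φ
  -- For `ε > 0` all kernels are smooth, so the Leibniz expansion is an exact finite identity, and
  -- the limit is taken term by term.
  have hev : ∀ᶠ ε in 𝓝[>] (0 : ℝ), ∑ i ∈ t, ((splits n).map fun s =>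
      pairingReg μ ε (s.k + s.m) (funDeriv A (s.k + s.m) φ)
        (tensorDist (funDeriv (F i) s.k φ) (funDeriv (G i) s.m φ))).sum =
      pairingReg μ ε n (funDeriv A n φ) (funDeriv (∑ i ∈ t, F i * G i) n φ) := by
    filter_upwards [self_mem_nhdsWithin] with ε hε
    have hs : ∀ i ∈ t, ∀ s : Split n, ContDiff ℝ ∞ fun x : Fin n → Mink =>
        splitDist s (funDeriv (F i) s.k φ) (funDeriv (G i) s.m φ)
          fun y => ∏ j, wightman μ ε (x j - y j) := fun i hi s =>
      contDiff_apply_prod_wightman hμ hε ((isFunDeriv_funDeriv (hF i hi) s.k φ).1.splitDist s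
        (isFunDeriv_funDeriv (hG i hi) s.m φ).1)
    have h1 : (fun x : Fin n → Mink => funDeriv (∑ i ∈ t, F i * G i) n φ
        fun y => ∏ j, wightman μ ε (x j - y j)) = fun x => ∑ i ∈ t, ((splits n).map fun s =>
          splitDist s (funDeriv (F i) s.k φ) (funDeriv (G i) s.m φ)
            fun y => ∏ j, wightman μ ε (x j - y j)).sum := by
      ext x
      exact hall.eq_of_contDiff hsum (contDiff_prod_wightman_sub hμ hε x)
    symm
    rw [pairingReg, h1, hu.1.map_sum t fun i hi => (hu.1.map_list_sum (splits n) (hs i hi)).1]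
    refine Finset.sum_congr rfl fun i hi => ?_
    rw [(hu.1.map_list_sum (splits n) (hs i hi)).2]
    refine congrArg List.sum (List.map_congr_left fun s _ => ?_)
    exact pairingReg_splitDist hμ hε hA.1 φ s (isFunDeriv_funDeriv (hF i hi) s.k φ).1
      (isFunDeriv_funDeriv (hG i hi) s.m φ).1
  refine Tendsto.congr' hev ?_
  refine tendsto_finsetSum t fun i hi => ?_
  rw [← sum_splits]
  exact tendsto_list_sum _ fun s _ => tendsto_splitPairing hμ hA (hF i hi) (hG i hi) φ s.k s.m

/-- The contraction of a finite sum of partial contractions with a distribution. -/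
theorem tendsto_pairingReg_partialStar {μ : ℝ} (hμ : 0 < μ) {A B : PowerSeries Functional}
    (hA : IsField A) (hB : IsField B) (hC : HasFunDerivs C) (k N : ℕ) (φ : Config) :
    Tendsto (fun ε => pairingReg μ ε k (partialStar μ k A B N φ) (funDeriv C k φ)) (𝓝[>] 0)
      (𝓝 (∑ p ∈ Finset.HasAntidiagonal.antidiagonal N, ((p.1.factorial : ℂ)⁻¹) *
        ∑ q ∈ Finset.HasAntidiagonal.antidiagonal p.2, splitPairing μ φ (PowerSeries.coeff q.1 A)
          C (PowerSeries.coeff q.2 B) k p.1)) := by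
  refine tendsto_finsetSum _ fun p _ => Tendsto.const_mul _ (tendsto_finsetSum _ fun q _ => ?_)
  exact exists_tendsto_pairingReg_contract hμ (isFunDeriv_funDeriv (hA q.1).1 (k + p.1) φ).1
    ((hA q.1).rapidDecayOn _ φ) (isFunDeriv_funDeriv (hB q.2).1 p.1 φ).1
    (isFunDeriv_funDeriv hC k φ).1

end ProductContractions

/-! ### Rearrangement of the coefficients of the power series. -/

section Series

/-- Both sides run over quintuples `(k, m, a, b, j)` with total `N`: derivatives on `C` and on `B`,
then the orders in $\hbar$ taken from `A`, `B` and `C`. -/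
theorem sum_antidiagonal_reassoc {M : Type*} [AddCommMonoid M] (N : ℕ) (h : ℕ → ℕ → ℕ → ℕ → ℕ → M) :
    ∑ p ∈ Finset.HasAntidiagonal.antidiagonal N, ∑ q ∈ Finset.HasAntidiagonal.antidiagonal p.2,
      ∑ i ∈ Finset.HasAntidiagonal.antidiagonal q.2,
        ∑ r ∈ Finset.HasAntidiagonal.antidiagonal p.1, h r.1 r.2 q.1 i.1 i.2 =
    ∑ s ∈ Finset.HasAntidiagonal.antidiagonal N, ∑ t ∈ Finset.HasAntidiagonal.antidiagonal s.2,
      ∑ p ∈ Finset.HasAntidiagonal.antidiagonal t.1,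
        ∑ q ∈ Finset.HasAntidiagonal.antidiagonal p.2, h s.1 p.1 q.1 q.2 t.2 := by
  simp only [Finset.sum_sigma']
  refine Finset.sum_bij'
    (fun x _ => ⟨(x.2.2.2.1, N - x.2.2.2.1),
      ⟨(x.2.2.2.2 + (x.2.1.1 + x.2.2.1.1), x.2.2.1.2),
        ⟨(x.2.2.2.2, x.2.1.1 + x.2.2.1.1), (x.2.1.1, x.2.2.1.1)⟩⟩⟩)
    (fun x _ => ⟨(x.1.1 + x.2.2.1.1, x.2.2.2.1 + (x.2.2.2.2 + x.2.1.2)),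
      ⟨(x.2.2.2.1, x.2.2.2.2 + x.2.1.2), ⟨(x.2.2.2.2, x.2.1.2), (x.1.1, x.2.2.1.1)⟩⟩⟩)
    ?_ ?_ ?_ ?_ ?_
  · rintro ⟨⟨n, l⟩, ⟨⟨a, b⟩, ⟨⟨i, j⟩, ⟨k, m⟩⟩⟩⟩ hx
    simp only [Finset.mem_sigma, Finset.HasAntidiagonal.mem_antidiagonal, and_true] at hx ⊢
    omega
  · rintro ⟨⟨n, l⟩, ⟨⟨a, b⟩, ⟨⟨i, j⟩, ⟨k, m⟩⟩⟩⟩ hx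
    simp only [Finset.mem_sigma, Finset.HasAntidiagonal.mem_antidiagonal, and_true] at hx ⊢
    omega
  · rintro ⟨⟨n, l⟩, ⟨⟨a, b⟩, ⟨⟨i, j⟩, ⟨k, m⟩⟩⟩⟩ hx
    simp only [Finset.mem_sigma, Finset.HasAntidiagonal.mem_antidiagonal] at hx
    obtain ⟨h1, h2, h3, h4⟩ := hx
    subst h4 h3 h2 h1
    simp
  · rintro ⟨⟨n, l⟩, ⟨⟨a, b⟩, ⟨⟨i, j⟩, ⟨k, m⟩⟩⟩⟩ hx
    simp only [Finset.mem_sigma, Finset.HasAntidiagonal.mem_antidiagonal] at hx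
    obtain ⟨h1, h2, h3, h4⟩ := hx
    subst h4 h3 h2 h1
    simp
  · intros; rfl

theorem inv_factorial_mul_choose {n k m : ℕ} (h : k + m = n) :
    ((n.factorial : ℂ)⁻¹) * (n.choose k : ℂ) = (k.factorial : ℂ)⁻¹ * (m.factorial : ℂ)⁻¹ := by
  subst h
  have h1 : ((k + m).choose k * k.factorial * m.factorial : ℂ) = ((k + m).factorial : ℂ) := by
    rw [Nat.choose_symm_add]
    exact_mod_cast Nat.add_choose_mul_factorial_mul_factorial k m
  have h2 : (k.factorial : ℂ) ≠ 0 := by exact_mod_cast k.factorial_ne_zero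
  have h3 : (m.factorial : ℂ) ≠ 0 := by exact_mod_cast m.factorial_ne_zero
  have h4 : ((k + m).factorial : ℂ) ≠ 0 := by exact_mod_cast (k + m).factorial_ne_zero
  field_simp
  linear_combination h1

theorem sum_factorial_reassoc (N : ℕ) (g : ℕ → ℕ → ℕ → ℕ → ℕ → ℂ) :
    ∑ p ∈ Finset.HasAntidiagonal.antidiagonal N, (p.1.factorial : ℂ)⁻¹ *
      ∑ q ∈ Finset.HasAntidiagonal.antidiagonal p.2,
        ∑ i ∈ Finset.HasAntidiagonal.antidiagonal q.2,
          ∑ r ∈ Finset.HasAntidiagonal.antidiagonal p.1,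
            p.1.choose r.1 • g r.1 r.2 q.1 i.1 i.2 =
    ∑ s ∈ Finset.HasAntidiagonal.antidiagonal N, (s.1.factorial : ℂ)⁻¹ *
      ∑ t ∈ Finset.HasAntidiagonal.antidiagonal s.2,
        ∑ p ∈ Finset.HasAntidiagonal.antidiagonal t.1, (p.1.factorial : ℂ)⁻¹ *
          ∑ q ∈ Finset.HasAntidiagonal.antidiagonal p.2, g s.1 p.1 q.1 q.2 t.2 := by
  have h := sum_antidiagonal_reassoc N fun k m a b c =>
    (k.factorial : ℂ)⁻¹ * ((m.factorial : ℂ)⁻¹ * g k m a b c)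
  simp only [← Finset.mul_sum] at h
  refine Eq.trans ?_ h
  refine Finset.sum_congr rfl fun p _ => ?_
  rw [Finset.mul_sum]
  refine Finset.sum_congr rfl fun q _ => ?_
  rw [Finset.mul_sum]
  refine Finset.sum_congr rfl fun i _ => ?_
  rw [Finset.mul_sum]
  refine Finset.sum_congr rfl fun r hr => ?_
  rw [nsmul_eq_mul, ← mul_assoc, ← mul_assoc,
    inv_factorial_mul_choose (Finset.HasAntidiagonal.mem_antidiagonal.1 hr)]

variable {A B C : PowerSeries Functional}

/-- The factor from `C` is put first because the free variables of `partialStar`, which are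
contracted with `C`, are the first ones of `A`. -/
theorem coeff_mul_comm (B C : PowerSeries Functional) (N : ℕ) : PowerSeries.coeff N (B * C) =
    ∑ p ∈ Finset.HasAntidiagonal.antidiagonal N,
      PowerSeries.coeff p.2 C * PowerSeries.coeff p.1 B := by
  rw [PowerSeries.coeff_mul]
  exact Finset.sum_congr rfl fun p _ => mul_comm _ _

theorem hasFunDerivs_coeff_mul (hB : IsField B) (hC : IsField C) (N : ℕ) :
    HasFunDerivs (PowerSeries.coeff N (B * C)) := by
  rw [coeff_mul_comm]
  exact HasFunDerivs.sum _ fun p _ => (hC p.2).1.mul (hB p.1).1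

theorem tendsto_pairingReg_coeff_mul {μ : ℝ} (hμ : 0 < μ) (hA : IsField A) (hB : IsField B)
    (hC : IsField C) (n a b : ℕ) (φ : Config) :
    Filter.Tendsto (fun ε => pairingReg μ ε n (funDerivSeries n A a φ)
      (funDerivSeries n (B * C) b φ)) (nhdsWithin 0 (Set.Ioi 0))
      (nhds (∑ i ∈ Finset.HasAntidiagonal.antidiagonal b,
        ∑ r ∈ Finset.HasAntidiagonal.antidiagonal n, n.choose r.1 •
          splitPairing μ φ (PowerSeries.coeff a A) (PowerSeries.coeff i.2 C)
            (PowerSeries.coeff i.1 B) r.1 r.2)) := by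
  have h := tendsto_pairingReg_sum_mul hμ (hA a) (Finset.HasAntidiagonal.antidiagonal b)
    (F := fun i => PowerSeries.coeff i.2 C) (G := fun i => PowerSeries.coeff i.1 B)
    (fun i _ => (hC i.2).1) (fun i _ => (hB i.1).1) n φ
  rw [← coeff_mul_comm] at h
  exact h

end Series

end

end PAQFT

/-! ### Comparison of the two sides, coefficient by coefficient. -/

theorem mainTheorem12 (μ : ℝ) (hμ : 0 < μ) (A B C : PowerSeries PAQFT.Functional)
    (hA : PAQFT.IsField A) (hB : PAQFT.IsField B) (hC : PAQFT.IsField C) (c : ℕ)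
    (hc : ∀ i : ℕ, c < i → ∀ (a : ℕ) (φ : PAQFT.Config) (ψ : Fin i → PAQFT.Config),
      PAQFT.gateaux (PowerSeries.coeff a C) i φ ψ = 0) :
    -- everything that enters the left-hand side is well defined
    ((∀ a : ℕ, PAQFT.HasFunDerivs (PowerSeries.coeff a (B * C))) ∧
      ∀ (n a b : ℕ) (φ : PAQFT.Config),
        PAQFT.PairingExists μ n (PAQFT.funDerivSeries n A a φ)
          (PAQFT.funDerivSeries n (B * C) b φ)) ∧
    -- everything that enters the right-hand side is well defined
    ((∀ (k n a b : ℕ) (φ : PAQFT.Config),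
        PAQFT.ContractExists μ k n (PAQFT.funDerivSeries (k + n) A a φ)
          (PAQFT.funDerivSeries n B b φ)) ∧
      ∀ (k a b : ℕ) (φ : PAQFT.Config),
        PAQFT.PairingExists μ k (PAQFT.partialStar μ k A B a φ)
          (PAQFT.funDerivSeries k C b φ)) ∧
    -- the formula
    PAQFT.star μ A (B * C) =
      ∑ k ∈ Finset.range (c + 1), ((k.factorial : ℂ)⁻¹) •
        (PowerSeries.X ^ k *
          PAQFT.pairingSeries μ k (PAQFT.partialStar μ k A B) (PAQFT.funDerivSeries k C)) := by
  refine ⟨⟨fun a => PAQFT.hasFunDerivs_coeff_mul hB hC a, fun n a b φ =>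
    ⟨_, PAQFT.tendsto_pairingReg_coeff_mul hμ hA hB hC n a b φ⟩⟩, ⟨fun k n a b φ =>
      PAQFT.contractExists hμ (PAQFT.isFunDeriv_funDeriv (hA a).1 (k + n) φ).1
        ((hA a).rapidDecayOn (k + n) φ) (PAQFT.isFunDeriv_funDeriv (hB b).1 n φ).1,
      fun k a b φ => ⟨_, PAQFT.tendsto_pairingReg_partialStar hμ hA hB (hC b).1 k a φ⟩⟩, ?_⟩
  ext N φ
  let g : ℕ → ℕ → ℕ → ℕ → ℕ → ℂ := fun k m a b j => PAQFT.splitPairing μ φ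
    (PowerSeries.coeff a A) (PowerSeries.coeff j C) (PowerSeries.coeff b B) k m
  have hg : ∀ k, c < k → ∀ m a b j, g k m a b j = 0 := fun k hk m a b j =>
    PAQFT.splitPairing_eq_zero hμ (hA a).1 (hC j).1 (hB b).1 φ (hc k hk j φ) m
  -- The contribution of the summand `k` to order $k+M$ in $\hbar$.
  let f : ℕ → ℕ → ℂ := fun k M => (k.factorial : ℂ)⁻¹ *
    ∑ t ∈ Finset.HasAntidiagonal.antidiagonal M,
      ∑ p ∈ Finset.HasAntidiagonal.antidiagonal t.1, (p.1.factorial : ℂ)⁻¹ *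
        ∑ q ∈ Finset.HasAntidiagonal.antidiagonal p.2, g k p.1 q.1 q.2 t.2
  have hleft : PowerSeries.coeff N (PAQFT.star μ A (B * C)) φ =
      ∑ s ∈ Finset.HasAntidiagonal.antidiagonal N, f s.1 s.2 := by
    refine Eq.trans ?_ (PAQFT.sum_factorial_reassoc N g)
    simp only [PAQFT.star, PAQFT.pairingSeries, PowerSeries.coeff_mk]
    refine Finset.sum_congr rfl fun p _ => congrArg _ (Finset.sum_congr rfl fun q _ => ?_)
    exact (PAQFT.tendsto_pairingReg_coeff_mul hμ hA hB hC p.1 q.1 q.2 φ).limUnder_eq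
  have hright : ∀ k, PowerSeries.coeff N (((k.factorial : ℂ)⁻¹) • (PowerSeries.X ^ k *
      PAQFT.pairingSeries μ k (PAQFT.partialStar μ k A B) (PAQFT.funDerivSeries k C)) :
        PowerSeries PAQFT.Functional) φ =
        if k ≤ N then f k (N - k) else 0 := by
    intro k
    rw [PowerSeries.coeff_smul, PowerSeries.coeff_X_pow_mul', Pi.smul_apply]
    split_ifs
    · simp only [PAQFT.pairingSeries, PowerSeries.coeff_mk, smul_eq_mul]
      refine congrArg _ (Finset.sum_congr rfl fun q _ => ?_)
      exact (PAQFT.tendsto_pairingReg_partialStar hμ hA hB (hC q.2).1 k q.1 φ).limUnder_eq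
    · simp
  rw [hleft, map_sum, Finset.sum_apply]
  simp only [hright]
  rw [Finset.Nat.sum_antidiagonal_eq_sum_range_succ f, ← Finset.sum_filter]
  symm
  -- The left-hand side runs over `k ≤ N`, the right-hand side over those `k` that are also at most
  -- `c`; the missing terms have `k > c` and vanish by `hg`.
  refine Finset.sum_subset (fun k hk => ?_) fun k hk hk' => ?_
  · simp only [Finset.mem_filter, Finset.mem_range] at hk ⊢
    omega
  · simp only [Finset.mem_filter, Finset.mem_range] at hk hk'
    have hck : c < k := by omega
    simp only [f, hg k hck, Finset.sum_const_zero, mul_zero]
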